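/- Let $G$ be a finite group. For $k \geqslant 0$, say that $G$ has spread at least $k$ if for any nontrivial $x_1,\dots,x_k \in G$ there is $y \in G$ with $G = \langle x_i, y\rangle$ for all $i$, and uniform spread at least $k$ if there is a conjugacy class $C$ of $G$ such that $y$ can always be chosen in $C$. The spread $s(G)$ and the uniform spread $u(G)$ are the largest such $k$, respectively. A uniform dominating set (UDS) for $G$ is a set $S$ of pairwise conjugate nontrivial elements such that for every nontrivial $x \in G$ there is $y \in S$ with $G = \langle x,y\rangle$; the uniform domination number $\gamma_u(G)$ is the minimal size of a UDS. For $s \in G$ with conjugacy class $s^G$ put \[ P(G,s,2) = \frac{|\{(x_1,x_2) \in s^G \times s^G : \{x_1,x_2\} \text{ is a UDS for } G\}|}{|s^G|^2}, \qquad P_2(G) = \max_{s \in G} P(G,s,2). \] Theorem. Let $G = {\rm L}_2(q) = {\rm PSL}_2(\mathbb{F}_q)$, where $q \geqslant 4$ is a prime power. (i) If $q \geqslant 11$ and $q \not\equiv 3 \pmod 4$, then $s(G) = u(G) = q-1$ if $q \equiv 1 \pmod 4$, and $s(G) = u(G) = q-2$ if $q$ is even. (ii) If $q \equiv 3 \pmod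 4$ and $q \geqslant 11$, then $u(G) \geqslant q-4$ and $s(G) \geqslant q-3$. (iii) If $q \equiv 3 \pmod 4$ and $q \geqslant 11$ is a prime, then $s(G) \geqslant \frac{1}{2}(3q-7)$ and $s(G) - u(G) = \frac{1}{2}(q+1)$. (iv) $\gamma_u(G) = 4$ if $q = 9$; $\gamma_u(G) = 3$ if $q \in \{5,7\}$ or $q$ is even; and $\gamma_u(G) = 2$ if $q \geqslant 11$ is odd. In particular, a UDS exists in every case. (v) If $q \geqslant 11$ is odd, then \[ P_2(G) = \begin{cases} \frac{1}{2}\left(1+\frac{1}{q}\right) & \text{if } q \equiv 1 \pmod 4, \\ \frac{1}{2}\left(1-\frac{q+3}{q(q-1)}\right) & \text{if } q \equiv 3 \pmod 4. \end{cases} \] In particular, $P_2(G) \geqslant \frac{24}{55}$, with equality if and only if $q = 11$. -/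

import Mathlib

open scoped MatrixGroups

noncomputable section

/-- `G` has spread at least `k`: any `k` nontrivial elements have a common `y` that generates `G`
together with each of them. -/
def HasSpread (G : Type*) [Group G] (k : ℕ) : Prop :=
  ∀ x : Fin k → G, (∀ i, x i ≠ 1) → ∃ y : G, ∀ i, Subgroup.closure {x i, y} = ⊤

/-- `G` has uniform spread at least `k`: the element `y` can always be chosen in one fixed
conjugacy class `C`. -/
def HasUniformSpread (G : Type*) [Group G] (k : ℕ) : Prop :=
  ∃ C : ConjClasses G, ∀ x : Fin k → G, (∀ i, x i ≠ 1) →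
    ∃ y ∈ C.carrier, ∀ i, Subgroup.closure {x i, y} = ⊤

/-- The spread `s(G)`: the largest `k` with `HasSpread G k`. For a finite non-cyclic group the set
below contains `0` and is bounded, because no `y` works for the list of all nontrivial elements. -/
def spread (G : Type*) [Group G] : ℕ := sSup {k | HasSpread G k}

/-- The uniform spread `u(G)`: the largest `k` with `HasUniformSpread G k`. -/
def uniformSpread (G : Type*) [Group G] : ℕ := sSup {k | HasUniformSpread G k}

/-- `S` is a total dominating set: a set of nontrivial elements such that each nontrivial `x`
generates `G` together with some `y ∈ S`. -/
def IsTotalDominatingSet {G : Type*} [Group G] (S : Set G) : Prop :=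
  (∀ y ∈ S, y ≠ 1) ∧ ∀ x : G, x ≠ 1 → ∃ y ∈ S, Subgroup.closure {x, y} = ⊤

/-- `S` is a uniform dominating set: a total dominating set of conjugate elements. -/
def IsUniformDominatingSet {G : Type*} [Group G] (S : Set G) : Prop :=
  IsTotalDominatingSet S ∧ ∀ x ∈ S, ∀ y ∈ S, IsConj x y

/-- The uniform domination number `γ_u(G)`: the minimal size of a (finite) uniform dominating set.
It has the value `0` when there is no such set; for a nontrivial group it is positive when there
is one. -/
def uniformDominationNumber (G : Type*) [Group G] : ℕ :=
  sInf {n | ∃ S : Finset G, IsUniformDominatingSet (S : Set G) ∧ S.card = n}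

/-- `P(G, s, c)`: the probability that `c` independent uniformly random conjugates of `s` form a
uniform dominating set. -/
def udsProb (G : Type*) [Group G] (s : G) (c : ℕ) : ℝ :=
  (Nat.card {x : Fin c → G //
      (∀ i, x i ∈ conjugatesOf s) ∧ IsUniformDominatingSet (Set.range x)} : ℝ) /
    (Nat.card (conjugatesOf s) : ℝ) ^ c

/-- `P_c(G)`: the maximum of `P(G, s, c)` over `s ∈ G`. -/
def maxUdsProb (G : Type*) [Group G] (c : ℕ) : ℝ := ⨆ s : G, udsProb G s c

end

/-! Everything is lifted to SL(2,q), where PSL(2,q) is generated by a pair exactly when no proper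
subgroup contains the centre and the pair (`generates_iff`). Let y generate a nonsplit torus, a
cyclic group of order q+1. The central fact is that for q even or q ≥ 11 a proper subgroup
containing this torus lies in its normaliser `dihedral y` (`le_dihedral_or_eq_top`). Hence x and y
generate as soon as x lies outside `dihedral y`. No classification of subgroups is used. Burnside's
count of fixed points on the projective line settles the case of two orbits. For a transitive
overgroup it is combined with the number of conjugates of torus elements and with the structure of a
point stabiliser (`counting_inequality`). If there are no unipotent elements, the torus acts on the
cosets of its normaliser with tiny stabilisers, and divisibility finishes
(`le_dihedral_of_card_upperGroup_eq_one`).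

The spread is then a matter of counting. The conjugates of y are the q(q-1) matrices of trace τ = tr
y. A nonscalar x lies in `dihedral A` only if it commutes with A, which happens for at most two A of
trace τ, or if tr x = 0 and tr (xA) = 0. The latter is a plane section of the class, with at most
q-1, q or q+1 points for q ≡ 1 mod 4, q even, q ≡ 3 mod 4. The union bound gives uniform spread at
least q-1, q-2, q-4 respectively. Involutions with a common fixed point show that the first two
values are sharp. For q ≡ 3 mod 4 one more element is gained in the spread by using generators of
split tori against sets of involutions (`eq_top_of_diag_of_tr_eq_zero`). If moreover q is prime, a
unipotent element generates with everything that moves its fixed point. So only sets whose fixed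
points cover the projective line are dangerous. These contain at least (q+1)/2 elements with
eigenvectors, and such elements lie in no normaliser of a nonsplit torus. This accounts for the
exact difference (q+1)/2 between spread and uniform spread.

For dominating pairs, two torus generators A, B work if and only if no nonscalar x normalises both
tori. The trace-zero matrices orthogonal to A and B are the multiples of the commutator AB - BA, and
one of them has determinant 1 exactly when the determinant of the commutator is a nonzero square.
This determinant depends only on τ and σ = tr (AB) (`independent_companion_iff`). For q odd,
counting the σ that give nonsquares yields both the existence of dominating pairs and the exact
probability. For q even everything is a square, so pairs never dominate, but the common involution
of two distinct tori is unique and a third torus can avoid it.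

The fields of order 5, 7, 9 are exceptional because subgroups A₄, S₄, A₅ of small index meet the
relevant classes; conjugates of a subgroup of small index intersect nontrivially
(`not_dominates_of_index`). The elements of order 4 in PSL(2,9) and the dominating set of size four
there are treated by finite computation over an explicit field. -/

set_option linter.unusedSectionVars false

/-! ### Matrices of determinant one: entries, traces and normalisers of tori. -/

namespace SL2

open Matrix Matrix.SpecialLinearGroup

variable {F : Type*} [Field F]

/-- The element of `SL(2, F)` with given entries. -/
def ofEntries (a b c d : F) (h : a * d - b * c = 1) : SL(2, F) :=
  ⟨!![a, b; c, d], by rw [det_fin_two_of, h]⟩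

section entries
variable (a b c d : F) (h : a * d - b * c = 1)
@[simp] lemma ofEntries_00 : ofEntries a b c d h 0 0 = a := rfl
@[simp] lemma ofEntries_01 : ofEntries a b c d h 0 1 = b := rfl
@[simp] lemma ofEntries_10 : ofEntries a b c d h 1 0 = c := rfl
@[simp] lemma ofEntries_11 : ofEntries a b c d h 1 1 = d := rfl
end entries

lemma det_eq (A : SL(2, F)) : A 0 0 * A 1 1 - A 0 1 * A 1 0 = 1 := by
  have := A.2; rwa [det_fin_two] at this

lemma ext_entries {A B : SL(2, F)} (h0 : A 0 0 = B 0 0) (h1 : A 0 1 = B 0 1)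
    (h2 : A 1 0 = B 1 0) (h3 : A 1 1 = B 1 1) : A = B := by
  ext i j; fin_cases i <;> fin_cases j <;> assumption

@[simp] lemma mul_00 (A B : SL(2, F)) : (A * B) 0 0 = A 0 0 * B 0 0 + A 0 1 * B 1 0 := by
  simp [coe_mul, Matrix.mul_apply, Fin.sum_univ_two]
@[simp] lemma mul_01 (A B : SL(2, F)) : (A * B) 0 1 = A 0 0 * B 0 1 + A 0 1 * B 1 1 := by
  simp [coe_mul, Matrix.mul_apply, Fin.sum_univ_two]
@[simp] lemma mul_10 (A B : SL(2, F)) : (A * B) 1 0 = A 1 0 * B 0 0 + A 1 1 * B 1 0 := by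
  simp [coe_mul, Matrix.mul_apply, Fin.sum_univ_two]
@[simp] lemma mul_11 (A B : SL(2, F)) : (A * B) 1 1 = A 1 0 * B 0 1 + A 1 1 * B 1 1 := by
  simp [coe_mul, Matrix.mul_apply, Fin.sum_univ_two]

@[simp] lemma inv_00 (A : SL(2, F)) : A⁻¹ 0 0 = A 1 1 := by
  simp [coe_inv, adjugate_fin_two]
@[simp] lemma inv_01 (A : SL(2, F)) : A⁻¹ 0 1 = -A 0 1 := by
  simp [coe_inv, adjugate_fin_two]
@[simp] lemma inv_10 (A : SL(2, F)) : A⁻¹ 1 0 = -A 1 0 := by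
  simp [coe_inv, adjugate_fin_two]
@[simp] lemma inv_11 (A : SL(2, F)) : A⁻¹ 1 1 = A 0 0 := by
  simp [coe_inv, adjugate_fin_two]

@[simp] lemma one_00 : (1 : SL(2, F)) 0 0 = 1 := by simp
@[simp] lemma one_01 : (1 : SL(2, F)) 0 1 = 0 := by simp
@[simp] lemma one_10 : (1 : SL(2, F)) 1 0 = 0 := by simp
@[simp] lemma one_11 : (1 : SL(2, F)) 1 1 = 1 := by simp
@[simp] lemma neg_apply (A : SL(2, F)) (i j : Fin 2) : (-A) i j = -A i j := by
  simp [coe_neg]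

/-- The trace of an element of `SL(2, F)`. -/
def tr (A : SL(2, F)) : F := A 0 0 + A 1 1

lemma tr_mul_comm (A B : SL(2, F)) : tr (A * B) = tr (B * A) := by
  simp only [tr, mul_00, mul_11]; ring

@[simp] lemma tr_conj (g A : SL(2, F)) : tr (g * A * g⁻¹) = tr A := by
  rw [tr_mul_comm, ← mul_assoc]; simp

@[simp] lemma tr_neg (A : SL(2, F)) : tr (-A) = -tr A := by simp [tr]; ring

/-- `x² - τ x + 1` has no root. -/
def Nonsplit (τ : F) : Prop := ∀ c : F, c ^ 2 - τ * c + 1 ≠ 0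

lemma Nonsplit.neg {τ : F} (h : Nonsplit τ) : Nonsplit (-τ) := fun c hc ↦
  h (-c) (by linear_combination hc)

lemma Nonsplit.entry_10_ne_zero {A : SL(2, F)} (h : Nonsplit (tr A)) : A 1 0 ≠ 0 := fun h0 ↦
  h (A 0 0) (by have := det_eq A; rw [h0] at this; simp only [tr]; linear_combination -this)

/-- `A` is a scalar matrix. -/
def IsScalar (A : SL(2, F)) : Prop := A 0 1 = 0 ∧ A 1 0 = 0 ∧ A 0 0 = A 1 1

lemma isScalar_iff_eq {A : SL(2, F)} : IsScalar A ↔ A = 1 ∨ A = -1 := by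
  constructor
  · rintro ⟨h1, h2, h3⟩
    have hd := det_eq A
    rw [h1, ← h3] at hd
    have : (A 0 0 - 1) * (A 0 0 + 1) = 0 := by linear_combination hd
    rcases mul_eq_zero.1 this with h | h
    · left; apply ext_entries <;> simp [h1, h2, ← h3]; all_goals linear_combination h
    · right; apply ext_entries <;> simp [h1, h2, ← h3]; all_goals linear_combination h
  · rintro (rfl | rfl) <;> simp [IsScalar]

lemma mem_center_iff_isScalar {A : SL(2, F)} :
    A ∈ Subgroup.center SL(2, F) ↔ IsScalar A := by
  constructor
  · intro h
    rw [Matrix.SpecialLinearGroup.mem_center_iff] at h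
    obtain ⟨r, -, hr⟩ := h
    have e : ∀ i j, (Matrix.scalar (Fin 2) r) i j = A i j := fun i j ↦ by rw [hr]
    refine ⟨?_, ?_, ?_⟩ <;> simp [← e]
  · intro h
    rw [Subgroup.mem_center_iff]
    intro g
    rcases isScalar_iff_eq.1 h with rfl | rfl <;> simp

lemma Nonsplit.not_isScalar {A : SL(2, F)} (h : Nonsplit (tr A)) : ¬ IsScalar A :=
  fun hs ↦ h.entry_10_ne_zero hs.2.1

/-- The elements centralising or inverting `y`. -/
def dihedral (y : SL(2, F)) : Subgroup SL(2, F) where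
  carrier := {g | g * y * g⁻¹ = y ∨ g * y * g⁻¹ = y⁻¹}
  one_mem' := by simp
  mul_mem' := by
    rintro a b ha hb
    have e : a * b * y * (a * b)⁻¹ = a * (b * y * b⁻¹) * a⁻¹ := by group
    have e' : a * y⁻¹ * a⁻¹ = (a * y * a⁻¹)⁻¹ := by group
    simp only [Set.mem_ofPred_eq] at *
    rw [e]
    rcases hb with hb | hb <;> rcases ha with ha | ha <;> rw [hb] <;> simp [ha, e']
  inv_mem' := by
    rintro a ha
    simp only [Set.mem_ofPred_eq, inv_inv] at *
    rcases ha with ha | ha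
    · left
      conv_lhs => rw [← ha]
      group
    · right
      have : y = a⁻¹ * y⁻¹ * a := by rw [← ha]; group
      have h2 : y⁻¹ = a⁻¹ * y * a := by
        conv_lhs => rw [this]
        group
      exact h2.symm

lemma mem_dihedral {g y : SL(2, F)} :
    g ∈ dihedral y ↔ g * y * g⁻¹ = y ∨ g * y * g⁻¹ = y⁻¹ := Iff.rfl

/-- By Cayley–Hamilton a matrix of determinant 1 and trace 0 satisfies h⁻¹ = -h. Applied to g and to
gy this gives gy = -(gy)⁻¹ = -y⁻¹g⁻¹ = y⁻¹g. -/
lemma inverts_of_tr {g y : SL(2, F)} (h1 : tr g = 0) (h2 : tr (g * y) = 0) :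
    g * y * g⁻¹ = y⁻¹ := by
  rw [mul_inv_eq_iff_eq_mul]
  simp only [tr, mul_00, mul_11] at h1 h2
  apply ext_entries <;> simp
  · linear_combination h2 - y 1 1 * h1
  · linear_combination y 0 1 * h1
  · linear_combination y 1 0 * h1
  · linear_combination h2 - y 0 0 * h1

lemma tr_eq_zero_of_inverts {g y : SL(2, F)} (hy : ¬ IsScalar y) (h : g * y * g⁻¹ = y⁻¹) :
    tr g = 0 ∧ tr (g * y) = 0 := by
  rw [mul_inv_eq_iff_eq_mul] at h
  have e00 : (g * y) 0 0 = (y⁻¹ * g) 0 0 := by rw [h]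
  have e01 : (g * y) 0 1 = (y⁻¹ * g) 0 1 := by rw [h]
  have e10 : (g * y) 1 0 = (y⁻¹ * g) 1 0 := by rw [h]
  have e11 : (g * y) 1 1 = (y⁻¹ * g) 1 1 := by rw [h]
  simp at e00 e01 e10 e11
  have t : tr g = 0 := by
    by_contra ht
    refine hy ⟨?_, ?_, ?_⟩
    · refine (mul_eq_zero.1 (?_ : tr g * y 0 1 = 0)).resolve_left ht
      simp only [tr]; linear_combination e01
    · refine (mul_eq_zero.1 (?_ : tr g * y 1 0 = 0)).resolve_left ht
      simp only [tr]; linear_combination e10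
    · refine sub_eq_zero.1 ((mul_eq_zero.1 (?_ : tr g * (y 0 0 - y 1 1) = 0)).resolve_left ht)
      simp only [tr]; linear_combination e00 - e11
  refine ⟨t, ?_⟩
  simp only [tr, mul_00, mul_11] at t ⊢
  linear_combination e00 + y 1 1 * t

/-- Inverting y becomes two linear conditions on traces; all later counts of normalisers rest on
this form. -/
lemma mem_dihedral_iff_tr {g y : SL(2, F)} (hy : ¬ IsScalar y) :
    g ∈ dihedral y ↔ Commute g y ∨ (tr g = 0 ∧ tr (g * y) = 0) := by
  rw [mem_dihedral]
  refine or_congr ?_ ⟨tr_eq_zero_of_inverts hy, fun h ↦ inverts_of_tr h.1 h.2⟩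
  rw [mul_inv_eq_iff_eq_mul]; rfl

lemma center_le_dihedral (y : SL(2, F)) : Subgroup.center SL(2, F) ≤ dihedral y := fun g hg ↦ by
  left; rw [mul_inv_eq_iff_eq_mul]; exact ((Subgroup.mem_center_iff.1 hg) y).symm

/-- Elements commuting with a nonscalar matrix are its linear polynomials. -/
lemma commute_iff {g y : SL(2, F)} (hy : y 1 0 ≠ 0) :
    Commute g y ↔ ∃ a b : F, g 0 0 = a + b * y 0 0 ∧ g 0 1 = b * y 0 1 ∧ g 1 0 = b * y 1 0 ∧
      g 1 1 = a + b * y 1 1 := by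
  constructor
  · intro h
    have e00 : (g * y) 0 0 = (y * g) 0 0 := by rw [h.eq]
    have e10 : (g * y) 1 0 = (y * g) 1 0 := by rw [h.eq]
    simp at e00 e10
    refine ⟨g 0 0 - g 1 0 / y 1 0 * y 0 0, g 1 0 / y 1 0, by ring, ?_, by field_simp, ?_⟩ <;>
      field_simp
    · linear_combination e00
    · linear_combination e10
  · rintro ⟨a, b, h0, h1, h2, h3⟩
    show g * y = y * g
    apply ext_entries <;> simp [h0, h1, h2, h3] <;> ring

/-- Upper unitriangular matrices. -/
def upper (b : F) : SL(2, F) := ofEntries 1 b 0 1 (by ring)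
/-- Lower unitriangular matrices. -/
def lower (b : F) : SL(2, F) := ofEntries 1 0 b 1 (by ring)
/-- Diagonal matrices. -/
def diag (s : F) (hs : s ≠ 0) : SL(2, F) := ofEntries s 0 0 s⁻¹ (by field_simp; simp)

section
variable (b : F)
@[simp] lemma upper_00 : upper b 0 0 = 1 := rfl
@[simp] lemma upper_01 : upper b 0 1 = b := rfl
@[simp] lemma upper_10 : upper b 1 0 = 0 := rfl
@[simp] lemma upper_11 : upper b 1 1 = 1 := rfl
@[simp] lemma lower_00 : lower b 0 0 = 1 := rfl
@[simp] lemma lower_01 : lower b 0 1 = 0 := rfl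
@[simp] lemma lower_10 : lower b 1 0 = b := rfl
@[simp] lemma lower_11 : lower b 1 1 = 1 := rfl
variable (hb : b ≠ 0)
@[simp] lemma diag_00 : diag b hb 0 0 = b := rfl
@[simp] lemma diag_01 : diag b hb 0 1 = 0 := rfl
@[simp] lemma diag_10 : diag b hb 1 0 = 0 := rfl
@[simp] lemma diag_11 : diag b hb 1 1 = b⁻¹ := rfl
end

lemma upper_mul (a b : F) : upper a * upper b = upper (a + b) := by
  apply ext_entries <;> simp [add_comm]
lemma upper_inv (a : F) : (upper a)⁻¹ = upper (-a) := by apply ext_entries <;> simp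
lemma lower_mul (a b : F) : lower a * lower b = lower (a + b) := by
  apply ext_entries <;> simp
lemma lower_inv (a : F) : (lower a)⁻¹ = lower (-a) := by apply ext_entries <;> simp

lemma eq_top_of_upper_lower {Γ : Subgroup SL(2, F)} (hu : ∀ b, upper b ∈ Γ)
    (hl : ∀ b, lower b ∈ Γ) : Γ = ⊤ := by
  have key : ∀ A : SL(2, F), A 1 0 ≠ 0 → A ∈ Γ := by
    intro A hA
    have : A = upper ((A 0 0 - 1) / A 1 0) * lower (A 1 0) * upper ((A 1 1 - 1) / A 1 0) := by
      have hd := det_eq A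
      apply ext_entries <;> simp <;> field_simp <;> ring_nf
      linear_combination -hd
    rw [this]
    exact Γ.mul_mem (Γ.mul_mem (hu _) (hl _)) (hu _)
  refine (Subgroup.eq_top_iff' _).2 fun A ↦ ?_
  by_cases hA : A 1 0 = 0
  · have h1 : lower 1 * A ∈ Γ := key _ (by
      have hd := det_eq A
      simp [hA] at *
      intro h0
      simp [h0] at hd)
    simpa using Γ.mul_mem (Γ.inv_mem (hl 1)) h1
  · exact key A hA

/-- All upper unitriangular matrices together with one matrix that is not upper triangular generate
`SL(2, F)`. -/
lemma eq_top_of_upper {Γ : Subgroup SL(2, F)} (hu : ∀ b, upper b ∈ Γ) {g : SL(2, F)}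
    (hg : g ∈ Γ) (hg0 : g 1 0 ≠ 0) : Γ = ⊤ := by
  refine eq_top_of_upper_lower hu fun b ↦ ?_
  have hd := det_eq g
  -- The product is antidiagonal, a Weyl element, so it conjugates upper unitriangular matrices to
  -- lower ones.
  have hw : upper (-(g 0 0 / g 1 0)) * g * upper (-(g 1 1 / g 1 0)) ∈ Γ :=
    Γ.mul_mem (Γ.mul_mem (hu _) hg) (hu _)
  set w := upper (-(g 0 0 / g 1 0)) * g * upper (-(g 1 1 / g 1 0)) with hwdef
  have : lower b = w * upper (-b / g 1 0 ^ 2) * w⁻¹ := by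
    rw [eq_mul_inv_iff_mul_eq]
    apply ext_entries <;> simp [hwdef] <;> field_simp <;> ring_nf <;> try simp
    linear_combination (-b) * hd
  rw [this]
  exact Γ.mul_mem (Γ.mul_mem hw (hu _)) (Γ.inv_mem hw)

/-- Conjugation would take y into the two-element set {y, y⁻¹}. Among at least three upper
unitriangular matrices two have the same effect, so a nontrivial one commutes with y; likewise for
lower ones. A matrix commuting with both kinds is scalar. -/
lemma dihedral_ne_top [Finite F] (hF : 3 ≤ Nat.card F) {y : SL(2, F)} (hy : ¬ IsScalar y) :
    dihedral y ≠ ⊤ := by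
  intro h
  have key : ∀ f : F → SL(2, F), (∀ a b, f (a - b) = (f b)⁻¹ * f a) →
      ∃ c : F, c ≠ 0 ∧ Commute (f c) y := by
    intro f hf
    classical
    have := Fintype.ofFinite F
    rw [Nat.card_eq_fintype_card] at hF
    obtain ⟨a, -, b, -, hab, he⟩ := Finset.exists_ne_map_eq_of_card_lt_of_maps_to
      (s := (Finset.univ : Finset F)) (t := {y, y⁻¹}) (f := fun a ↦ f a * y * (f a)⁻¹)
      (lt_of_le_of_lt Finset.card_le_two (by rw [Finset.card_univ]; omega))
      (fun a _ ↦ by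
        have : f a ∈ dihedral y := h ▸ Subgroup.mem_top _
        simpa [mem_dihedral] using this)
    refine ⟨a - b, sub_ne_zero.2 hab, ?_⟩
    rw [hf, Commute, SemiconjBy, ← mul_inv_eq_iff_eq_mul]
    rw [show (f b)⁻¹ * f a * y * ((f b)⁻¹ * f a)⁻¹ = (f b)⁻¹ * (f a * y * (f a)⁻¹) * f b by group,
      he]
    group
  obtain ⟨c, hc, hcy⟩ := key upper fun a b ↦ by rw [upper_inv, upper_mul]; congr 1; ring
  obtain ⟨e, he, hey⟩ := key lower fun a b ↦ by rw [lower_inv, lower_mul]; congr 1; ring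
  have h00 : (upper c * y) 0 0 = (y * upper c) 0 0 := by rw [hcy.eq]
  have h01 : (upper c * y) 0 1 = (y * upper c) 0 1 := by rw [hcy.eq]
  have g00 : (lower e * y) 0 0 = (y * lower e) 0 0 := by rw [hey.eq]
  simp at h00 h01 g00
  refine hy ⟨g00.resolve_right he, h00.resolve_left hc, ?_⟩
  have : c * (y 0 0 - y 1 1) = 0 := by linear_combination -h01
  exact sub_eq_zero.1 ((mul_eq_zero.1 this).resolve_left hc)

/-! ### Generating pairs of `PSL(2, F)` -/

/-- The images of `A` and `B` generate `PSL(2, F)`. -/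
def Generates (A B : SL(2, F)) : Prop :=
  Subgroup.closure {(A : PSL(2, F)), (B : PSL(2, F))} = ⊤

/-- Subgroups of the quotient correspond to subgroups containing the centre; from here on the
quotient is avoided. -/
lemma generates_iff {A B : SL(2, F)} : Generates A B ↔
    ∀ Γ : Subgroup SL(2, F), Subgroup.center SL(2, F) ≤ Γ → A ∈ Γ → B ∈ Γ → Γ = ⊤ := by
  set π := QuotientGroup.mk' (Subgroup.center SL(2, F))
  constructor
  · intro h Γ hc hA hB
    have h1 : Subgroup.closure {(A : PSL(2, F)), (B : PSL(2, F))} ≤ Γ.map π := by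
      rw [Subgroup.closure_le]
      rintro x (rfl | rfl)
      exacts [⟨A, hA, rfl⟩, ⟨B, hB, rfl⟩]
    rw [h, top_le_iff] at h1
    have h2 := congrArg (Subgroup.comap π) h1
    rw [Subgroup.comap_map_eq, Subgroup.comap_top, QuotientGroup.ker_mk', sup_eq_left.2 hc] at h2
    exact h2
  · intro h
    have := h ((Subgroup.closure {(A : PSL(2, F)), (B : PSL(2, F))}).comap π)
      (fun z hz ↦ by
        have : π z = 1 := (QuotientGroup.eq_one_iff z).2 hz
        rw [Subgroup.mem_comap, this]; exact Subgroup.one_mem _)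
      (Subgroup.subset_closure (by left; rfl)) (Subgroup.subset_closure (by right; rfl))
    have h2 := congrArg (Subgroup.map π) this
    rwa [Subgroup.map_comap_eq_self_of_surjective (QuotientGroup.mk'_surjective _),
      Subgroup.map_top_of_surjective _ (QuotientGroup.mk'_surjective _)] at h2

lemma not_generates_of_mem {A B : SL(2, F)} {Γ : Subgroup SL(2, F)}
    (hc : Subgroup.center SL(2, F) ≤ Γ) (hA : A ∈ Γ) (hB : B ∈ Γ) (h : Γ ≠ ⊤) :
    ¬ Generates A B := fun hg ↦ h (generates_iff.1 hg Γ hc hA hB)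

lemma Generates.of_mem_zpowers {A B C : SL(2, F)} (h : Generates A B) (hB : B ∈ Subgroup.zpowers C) :
    Generates A C :=
  generates_iff.2 fun Γ hc hA hC ↦ generates_iff.1 h Γ hc hA (Subgroup.zpowers_le.2 hC hB)

lemma Generates.conj {A B : SL(2, F)} (h : Generates A B) (g : SL(2, F)) :
    Generates (g * A * g⁻¹) (g * B * g⁻¹) := by
  refine generates_iff.2 fun Γ hc hA hB ↦ ?_
  have := generates_iff.1 h (Γ.comap (MulAut.conj g).toMonoidHom)
    (fun z hz ↦ by
      have : g * z * g⁻¹ = z := by rw [(Subgroup.mem_center_iff.1 hz g)]; group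
      simpa [Subgroup.mem_comap, MulAut.conj_apply, this] using hc hz)
    (by simpa [Subgroup.mem_comap] using hA) (by simpa [Subgroup.mem_comap] using hB)
  refine (Subgroup.eq_top_iff' _).2 fun x ↦ ?_
  have hx : g⁻¹ * x * g ∈ Γ.comap (MulAut.conj g).toMonoidHom := this ▸ Subgroup.mem_top _
  simpa [Subgroup.mem_comap, mul_assoc] using hx

lemma mk_eq_one_iff {A : SL(2, F)} : (A : PSL(2, F)) = 1 ↔ IsScalar A := by
  rw [QuotientGroup.eq_one_iff, mem_center_iff_isScalar]

lemma mk_eq_mk_iff {A B : SL(2, F)} : (A : PSL(2, F)) = B ↔ A = B ∨ A = -B := by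
  rw [QuotientGroup.eq, mem_center_iff_isScalar, isScalar_iff_eq]
  refine or_congr ?_ ?_
  · rw [inv_mul_eq_one]
  · rw [inv_mul_eq_iff_eq_mul]
    constructor
    · rintro rfl; simp
    · rintro rfl; simp

end SL2

namespace SL2

open Matrix Matrix.SpecialLinearGroup OnePoint

variable {F : Type*} [Field F]

/-! ### The action on the projective line -/

section action
variable [DecidableEq F]

/-- Möbius transformations. -/
instance : MulAction SL(2, F) (OnePoint F) :=
  MulAction.compHom (OnePoint F) (Matrix.SpecialLinearGroup.toGL (n := Fin 2) (R := F))

lemma smul_infty (A : SL(2, F)) :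
    A • (∞ : OnePoint F) = if A 1 0 = 0 then ∞ else ((A 0 0 / A 1 0 : F) : OnePoint F) :=
  OnePoint.smul_infty_eq_ite (Matrix.SpecialLinearGroup.toGL A)

lemma smul_coe (A : SL(2, F)) (k : F) :
    A • (k : OnePoint F) = if A 1 0 * k + A 1 1 = 0 then ∞
      else (((A 0 0 * k + A 0 1) / (A 1 0 * k + A 1 1) : F) : OnePoint F) :=
  OnePoint.smul_some_eq_ite (g := Matrix.SpecialLinearGroup.toGL A)

lemma smul_infty_eq_self_iff {A : SL(2, F)} : A • (∞ : OnePoint F) = ∞ ↔ A 1 0 = 0 := by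
  rw [smul_infty]; split_ifs with h <;> simp [h]

lemma smul_coe_eq_self_iff {A : SL(2, F)} {k : F} :
    A • (k : OnePoint F) = k ↔ A 1 0 * k ^ 2 + (A 1 1 - A 0 0) * k - A 0 1 = 0 := by
  rw [smul_coe]
  have hd := det_eq A
  split_ifs with h
  · simp only [OnePoint.infty_ne_coe, false_iff]
    intro h2
    have h3 : A 0 0 * k + A 0 1 = 0 := by linear_combination k * h - h2
    have : (1 : F) = 0 := by linear_combination A 0 0 * h - A 1 0 * h3 - hd
    exact one_ne_zero this
  · rw [OnePoint.coe_eq_coe, div_eq_iff h]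
    constructor <;> intro h2 <;> linear_combination -h2

lemma exists_smul_infty_eq (p : OnePoint F) : ∃ g : SL(2, F), g • (∞ : OnePoint F) = p := by
  induction p using OnePoint.rec with
  | infty => exact ⟨1, one_smul _ _⟩
  | coe k => exact ⟨ofEntries k (-1) 1 0 (by ring), by simp [smul_infty]⟩

instance : MulAction.IsPretransitive SL(2, F) (OnePoint F) where
  exists_smul_eq p r := by
    obtain ⟨g, rfl⟩ := exists_smul_infty_eq p
    obtain ⟨h, rfl⟩ := exists_smul_infty_eq r
    exact ⟨h * g⁻¹, by rw [mul_smul, inv_smul_smul]⟩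

lemma IsScalar.smul_eq {A : SL(2, F)} (h : IsScalar A) (p : OnePoint F) : A • p = p := by
  induction p using OnePoint.rec with
  | infty => exact smul_infty_eq_self_iff.2 h.2.1
  | coe k => rw [smul_coe_eq_self_iff]; rw [h.1, h.2.1, h.2.2]; ring

lemma center_le_stabilizer (p : OnePoint F) :
    Subgroup.center SL(2, F) ≤ MulAction.stabilizer SL(2, F) p :=
  fun _ hA ↦ (mem_center_iff_isScalar.1 hA).smul_eq p

lemma stabilizer_ne_top (p : OnePoint F) : MulAction.stabilizer SL(2, F) p ≠ ⊤ := by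
  intro h
  obtain ⟨q, hq⟩ : ∃ q, q ≠ p := by
    by_cases hp : p = ∞
    · exact ⟨(0 : F), hp ▸ OnePoint.coe_ne_infty _⟩
    · exact ⟨∞, Ne.symm hp⟩
  obtain ⟨g, rfl⟩ := MulAction.exists_smul_eq SL(2, F) p q
  exact hq (by have : g ∈ MulAction.stabilizer SL(2, F) p := h ▸ Subgroup.mem_top g
               exact this)

lemma not_generates_of_smul_eq {A B : SL(2, F)} {p : OnePoint F} (hA : A • p = p)
    (hB : B • p = p) : ¬ Generates A B :=
  not_generates_of_mem (center_le_stabilizer p) hA hB (stabilizer_ne_top p)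

/-- A fixed point is an eigenvector, and its eigenvalue c k + d is a root of the characteristic
polynomial. -/
lemma Nonsplit.smul_ne {A : SL(2, F)} (h : Nonsplit (tr A)) (p : OnePoint F) : A • p ≠ p := by
  induction p using OnePoint.rec with
  | infty => rw [Ne, smul_infty_eq_self_iff]; exact h.entry_10_ne_zero
  | coe k =>
    rw [Ne, smul_coe_eq_self_iff]
    intro hk
    refine h (A 1 0 * k + A 1 1) ?_
    simp only [tr]
    linear_combination A 1 0 * hk - det_eq A

lemma exists_smul_eq_of_not_nonsplit {A : SL(2, F)} (h : ¬ Nonsplit (tr A)) :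
    ∃ p : OnePoint F, A • p = p := by
  by_cases h0 : A 1 0 = 0
  · exact ⟨∞, smul_infty_eq_self_iff.2 h0⟩
  · simp only [Nonsplit, not_forall, not_not] at h
    obtain ⟨c, hc⟩ := h
    refine ⟨((c - A 1 1) / A 1 0 : F), smul_coe_eq_self_iff.2 ?_⟩
    have hd := det_eq A
    simp only [tr] at hc
    field_simp
    linear_combination hc + hd

lemma nonsplit_iff_smul_ne {A : SL(2, F)} :
    Nonsplit (tr A) ↔ ∀ p : OnePoint F, A • p ≠ p :=
  ⟨Nonsplit.smul_ne, fun h ↦ by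
    by_contra h2
    obtain ⟨p, hp⟩ := exists_smul_eq_of_not_nonsplit h2
    exact h p hp⟩

open Classical in
/-- The fixed points of an element of `SL(2, F)` as a finite set. -/
noncomputable def fixedPts [Fintype F] (A : SL(2, F)) : Finset (OnePoint F) :=
  Finset.univ.filter fun p ↦ A • p = p

@[simp] lemma mem_fixedPts [Fintype F] {A : SL(2, F)} {p : OnePoint F} :
    p ∈ fixedPts A ↔ A • p = p := by simp [fixedPts]

/-- The finite fixed points are the roots of a quadratic polynomial, whose leading coefficient
vanishes exactly if ∞ is fixed too. -/
lemma card_fixedPts_le_two [Fintype F] {A : SL(2, F)} (hA : ¬ IsScalar A) :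
    (fixedPts A).card ≤ 2 := by
  classical
  have hd := det_eq A
  by_contra! hc
  obtain ⟨p, q, r, hp, hq, hr, hpq, hpr, hqr⟩ := Finset.two_lt_card_iff.1 hc
  simp only [mem_fixedPts] at hp hq hr
  have two : ∀ j k : F, j ≠ k → A • (j : OnePoint F) = j → A • (k : OnePoint F) = k →
      A 1 0 * (j + k) + (A 1 1 - A 0 0) = 0 := fun j k hjk hj hk ↦ by
    rw [smul_coe_eq_self_iff] at hj hk
    refine (mul_eq_zero.1 (?_ : (j - k) * _ = 0)).resolve_left (sub_ne_zero.2 hjk)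
    linear_combination hj - hk
  have fin : ∀ j k : F, j ≠ k → A • (j : OnePoint F) = j → A • (k : OnePoint F) = k →
      A 1 0 = 0 → False := fun j k hjk hj hk h0 ↦ by
    have h1 := two j k hjk hj hk
    rw [h0, zero_mul, zero_add] at h1
    rw [smul_coe_eq_self_iff] at hj
    exact hA ⟨by rw [h0, h1] at hj; linear_combination -hj, h0, (sub_eq_zero.1 h1).symm⟩
  have three : ∀ j k : F, j ≠ k → A • (∞ : OnePoint F) = ∞ → A • (j : OnePoint F) = j →
      A • (k : OnePoint F) = k → False := fun j k hjk h0 hj hk ↦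
    fin j k hjk hj hk (smul_infty_eq_self_iff.1 h0)
  have ne : ∀ {j k : F}, (j : OnePoint F) ≠ k → j ≠ k := fun h e ↦ h (by rw [e])
  induction p using OnePoint.rec with
  | infty =>
    induction q using OnePoint.rec with
    | infty => exact hpq rfl
    | coe j =>
      induction r using OnePoint.rec with
      | infty => exact hpr rfl
      | coe k => exact three j k (ne hqr) hp hq hr
  | coe i =>
    induction q using OnePoint.rec with
    | infty =>
      induction r using OnePoint.rec with
      | infty => exact hqr rfl
      | coe k => exact three i k (ne hpr) hq hp hr
    | coe j =>
      induction r using OnePoint.rec with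
      | infty => exact three i j (ne hpq) hr hp hq
      | coe k =>
        refine fin i j (ne hpq) hp hq ?_
        have h1 := two i j (ne hpq) hp hq
        have h2 := two i k (ne hpr) hp hr
        refine (mul_eq_zero.1 (?_ : A 1 0 * (j - k) = 0)).resolve_right (sub_ne_zero.2 (ne hqr))
        linear_combination h1 - h2

lemma card_onePoint [Finite F] : Nat.card (OnePoint F) = Nat.card F + 1 := by
  have := Fintype.ofFinite F
  rw [show Nat.card (OnePoint F) = Nat.card (Option F) from rfl]
  simp

end action

/-! ### Counting points on a conic -/

lemma Nonsplit.form_eq_zero {τ : F} (h : Nonsplit τ) {a b : F}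
    (hab : a ^ 2 + τ * a * b + b ^ 2 = 0) : a = 0 ∧ b = 0 := by
  by_cases hb : b = 0
  · subst hb; simpa using hab
  · exfalso
    refine h (-(a / b)) ?_
    field_simp
    linear_combination hab

section conic
variable [Fintype F] [DecidableEq F]

/-- The points of the affine conic `a² + τ a b + b² = r`. -/
def conic (τ r : F) : Finset (F × F) :=
  Finset.univ.filter fun v ↦ v.1 ^ 2 + τ * v.1 * v.2 + v.2 ^ 2 = r

lemma mem_conic {τ r : F} {v : F × F} :
    v ∈ conic τ r ↔ v.1 ^ 2 + τ * v.1 * v.2 + v.2 ^ 2 = r := by simp [conic]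

/-- Projection from a point of the conic to the q+1 slopes is injective. The form a² + τab + b² is
anisotropic, so every slope belongs to at most one further point. -/
lemma card_conic_le {τ : F} (h : Nonsplit τ) {r : F} :
    (conic τ r).card ≤ Fintype.card F + 1 := by
  rcases (conic τ r).eq_empty_or_nonempty with he | ⟨⟨u, v⟩, huv⟩
  · simp [he]
  rw [mem_conic] at huv
  simp only at huv
  -- slope of the line through `(u, v)`; at `(u, v)` itself the slope of the tangent
  let f : F × F → OnePoint F := fun w ↦
    if w.1 = u then (if w.2 = v then (if τ * u + 2 * v = 0 then ∞ else
      ((-(2 * u + τ * v) / (τ * u + 2 * v) : F) : OnePoint F)) else ∞)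
    else (((w.2 - v) / (w.1 - u) : F) : OnePoint F)
  -- Subtracting the equations of w and (u, v) and dividing by the displacement leaves a linear
  -- equation along the line, with leading coefficient 1 + τm + m² ≠ 0.
  have key : ∀ w ∈ conic τ r, w.1 ≠ u →
      (w.1 - u) * (1 + τ * ((w.2 - v) / (w.1 - u)) + ((w.2 - v) / (w.1 - u)) ^ 2) =
        -(2 * u + τ * v + (τ * u + 2 * v) * ((w.2 - v) / (w.1 - u))) := by
    intro w hw hne
    rw [mem_conic] at hw
    have : w.1 - u ≠ 0 := sub_ne_zero.2 hne
    field_simp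
    linear_combination hw - huv
  have key2 : ∀ w ∈ conic τ r, w.1 = u → w.2 ≠ v → w.2 - v = -(τ * u + 2 * v) := by
    intro w hw he hne
    rw [mem_conic, he] at hw
    have : (w.2 - v) * (w.2 - v + (τ * u + 2 * v)) = 0 := by linear_combination hw - huv
    linear_combination (mul_eq_zero.1 this).resolve_left (sub_ne_zero.2 hne)
  have hinj : Set.InjOn f (conic τ r) := by
    have case1 : ∀ w ∈ conic τ r, ∀ w' ∈ conic τ r, w.1 ≠ u → f w = f w' → w = w' := by
      intro w hw w' hw' h1 he
      have hk := key w hw h1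
      simp only [f, if_neg h1] at he
      have hw1 := sub_ne_zero.2 h1
      have hs := fun hz : (1 : F) ^ 2 + τ * 1 * ((w.2 - v) / (w.1 - u)) +
        ((w.2 - v) / (w.1 - u)) ^ 2 = 0 ↦ one_ne_zero (h.form_eq_zero hz).1
      split_ifs at he with g1 g2 g3
      · exact absurd he (OnePoint.coe_ne_infty _)
      · rw [OnePoint.coe_eq_coe] at he
        exfalso
        rw [he] at hk hs
        refine hs ?_
        refine (mul_eq_zero.1 (?_ : (w.1 - u) * _ = 0)).resolve_left hw1
        rw [one_pow, mul_one, hk, mul_div_cancel₀ _ g3]; ring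
      · exact absurd he (OnePoint.coe_ne_infty _)
      · rw [OnePoint.coe_eq_coe] at he
        have hk' := key w' hw' g1
        rw [← he, ← hk] at hk'
        have h2 : w'.1 - u = w.1 - u := mul_right_cancel₀ (by simpa using hs) hk'
        have h3 : w'.1 = w.1 := sub_left_inj.1 h2
        rw [h3, div_left_inj' hw1] at he
        exact Prod.ext h3.symm (sub_left_inj.1 he)
    intro w hw w' hw' he
    by_cases h1 : w.1 = u
    · by_cases h2 : w'.1 = u
      · refine Prod.ext (h1.trans h2.symm) ?_
        simp only [f, if_pos h1, if_pos h2] at he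
        by_cases h3 : w.2 = v <;> by_cases h4 : w'.2 = v
        · rw [h3, h4]
        · have := key2 w' hw' h2 h4
          rw [if_pos h3, if_neg h4] at he
          split_ifs at he with h5
          · rw [h5, neg_zero] at this; exact absurd (sub_eq_zero.1 this) h4
          · exact absurd he (OnePoint.coe_ne_infty _)
        · have := key2 w hw h1 h3
          rw [if_neg h3, if_pos h4] at he
          split_ifs at he with h5
          · rw [h5, neg_zero] at this; exact absurd (sub_eq_zero.1 this) h3
          · exact absurd he.symm (OnePoint.coe_ne_infty _)
        · exact sub_left_inj.1 ((key2 w hw h1 h3).trans (key2 w' hw' h2 h4).symm)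
      · exact (case1 w' hw' w hw h2 he.symm).symm
    · exact case1 w hw w' hw' h1 he
  have := Finset.card_le_card_of_injOn f (t := Finset.univ) (fun _ _ ↦ Finset.mem_univ _) hinj
  refine this.trans ?_
  rw [Finset.card_univ, show Fintype.card (OnePoint F) = Fintype.card (Option F) from
    Fintype.card_congr (Equiv.refl _)]
  simp

/-- The q² - 1 nonzero vectors are distributed over q - 1 nonzero values, each taken at most q + 1
times, so every bound is attained. -/
lemma card_conic {τ : F} (h : Nonsplit τ) {r : F} (hr : r ≠ 0) :
    (conic τ r).card = Fintype.card F + 1 := by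
  have h0 : (conic τ (0 : F)) = {(0, 0)} := by
    ext ⟨a, b⟩
    rw [mem_conic, Finset.mem_singleton, Prod.mk_inj]
    exact ⟨h.form_eq_zero, by rintro ⟨rfl, rfl⟩; ring⟩
  have tot : ∑ r : F, (conic τ r).card = Fintype.card F * Fintype.card F := by
    rw [← Fintype.card_prod, ← Finset.card_univ]
    exact (Finset.card_eq_sum_card_fiberwise (s := Finset.univ) (t := Finset.univ)
      (f := fun v : F × F ↦ v.1 ^ 2 + τ * v.1 * v.2 + v.2 ^ 2) (fun _ _ ↦ by simp)).symm
  rw [← Finset.add_sum_erase _ _ (Finset.mem_univ (0 : F)), h0, Finset.card_singleton] at tot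
  by_contra hne
  have hlt : ∑ r ∈ Finset.univ.erase (0 : F), (conic τ r).card <
      ∑ r ∈ Finset.univ.erase (0 : F), (Fintype.card F + 1) :=
    Finset.sum_lt_sum (fun i _ ↦ card_conic_le h)
      ⟨r, Finset.mem_erase.2 ⟨hr, Finset.mem_univ _⟩, lt_of_le_of_ne (card_conic_le h) hne⟩
  rw [Finset.sum_const, Finset.card_erase_of_mem (Finset.mem_univ _), Finset.card_univ,
    smul_eq_mul] at hlt
  have hq : 1 ≤ Fintype.card F := Fintype.card_pos
  obtain ⟨n, hn⟩ := Nat.exists_eq_add_of_le hq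
  rw [hn] at tot hlt
  simp only [add_tsub_cancel_left] at hlt
  nlinarith

end conic

end SL2

namespace SL2

open Matrix Matrix.SpecialLinearGroup OnePoint

variable {F : Type*} [Field F]

/-! ### Nonsplit tori -/

/-- The element with characteristic polynomial `x² - τ x + 1` in companion form. -/
def companion (τ : F) : SL(2, F) := ofEntries 0 (-1) 1 τ (by ring)

@[simp] lemma companion_00 (τ : F) : companion τ 0 0 = 0 := rfl
@[simp] lemma companion_01 (τ : F) : companion τ 0 1 = -1 := rfl
@[simp] lemma companion_10 (τ : F) : companion τ 1 0 = 1 := rfl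
@[simp] lemma companion_11 (τ : F) : companion τ 1 1 = τ := rfl
@[simp] lemma tr_companion (τ : F) : tr (companion τ) = τ := by simp [tr]

/-- In the basis v, Av the matrix takes companion form. The determinant of that basis is a quadratic
form in v which, up to the factor A 1 0, is a norm form; since conics have points, v can be chosen
with determinant exactly 1, so conjugation takes place in SL rather than GL. -/
lemma exists_conj_companion [Finite F] {A : SL(2, F)} (h : Nonsplit (tr A)) :
    ∃ g : SL(2, F), g * companion (tr A) * g⁻¹ = A := by
  classical
  have := Fintype.ofFinite F
  have hc := h.entry_10_ne_zero
  have hd := det_eq A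
  obtain ⟨⟨X, Y⟩, hXY⟩ : (conic (-(tr A)) (A 1 0)).Nonempty := by
    rw [← Finset.card_pos, card_conic h.neg hc]; omega
  rw [mem_conic] at hXY
  simp only [tr] at hXY
  set x := (X - A 1 1 * Y) / A 1 0 with hx
  have hX : X = A 1 0 * x + A 1 1 * Y := by rw [hx]; field_simp; ring
  rw [hX] at hXY
  have hdet : x * (A 1 0 * x + A 1 1 * Y) - (A 0 0 * x + A 0 1 * Y) * Y = 1 := by
    apply mul_left_cancel₀ hc
    linear_combination hXY + Y ^ 2 * hd
  refine ⟨ofEntries x (A 0 0 * x + A 0 1 * Y) Y (A 1 0 * x + A 1 1 * Y) hdet, ?_⟩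
  rw [mul_inv_eq_iff_eq_mul]
  apply ext_entries <;> simp [tr]
  · linear_combination x * hd
  · linear_combination Y * hd

lemma exists_conj_of_tr_eq [Finite F] {A B : SL(2, F)} (h : Nonsplit (tr A)) (hB : tr B = tr A) :
    ∃ g : SL(2, F), g * A * g⁻¹ = B := by
  obtain ⟨g, hg⟩ := exists_conj_companion h
  obtain ⟨k, hk⟩ := exists_conj_companion (A := B) (hB ▸ h)
  rw [hB] at hk
  refine ⟨k * g⁻¹, ?_⟩
  have h1 : g⁻¹ * A * g = companion (tr A) := by
    have := congrArg (fun z ↦ g⁻¹ * z * g) hg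
    simpa [mul_assoc] using this.symm
  rw [← hk, ← h1]
  group

/-- The centraliser of `y`. -/
def torus (y : SL(2, F)) : Subgroup SL(2, F) := Subgroup.centralizer {y}

lemma mem_torus {g y : SL(2, F)} : g ∈ torus y ↔ Commute g y := by
  rw [torus, Subgroup.mem_centralizer_singleton_iff, Commute, SemiconjBy]

lemma self_mem_torus (y : SL(2, F)) : y ∈ torus y := mem_torus.2 (Commute.refl y)

lemma center_le_torus (y : SL(2, F)) : Subgroup.center SL(2, F) ≤ torus y :=
  Subgroup.center_le_centralizer _

lemma torus_le_dihedral (y : SL(2, F)) : torus y ≤ dihedral y := fun g hg ↦ by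
  left; rw [mul_inv_eq_iff_eq_mul]; exact (mem_torus.1 hg)

/-- The linear polynomial `a + b y`. -/
def linComb (y : SL(2, F)) (a b : F) (h : a ^ 2 + tr y * a * b + b ^ 2 = 1) : SL(2, F) :=
  ofEntries (a + b * y 0 0) (b * y 0 1) (b * y 1 0) (a + b * y 1 1) (by
    have := det_eq y; simp only [tr] at h; linear_combination h + b ^ 2 * this)

lemma mem_torus_iff {g y : SL(2, F)} (hy : y 1 0 ≠ 0) :
    g ∈ torus y ↔ ∃ a b h, g = linComb y a b h := by
  rw [mem_torus, commute_iff hy]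
  constructor
  · rintro ⟨a, b, h0, h1, h2, h3⟩
    have hd := det_eq g
    have hd' := det_eq y
    refine ⟨a, b, ?_, ext_entries h0 h1 h2 h3⟩
    rw [h0, h1, h2, h3] at hd
    simp only [tr]
    linear_combination hd - b ^ 2 * hd'
  · rintro ⟨a, b, h, rfl⟩
    exact ⟨a, b, rfl, rfl, rfl, rfl⟩

/-- The centraliser consists of the combinations a + by of determinant a² + τab + b² = 1, which is a
conic. -/
lemma card_torus [Finite F] {y : SL(2, F)} (hy : Nonsplit (tr y)) :
    Nat.card (torus y) = Nat.card F + 1 := by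
  classical
  have := Fintype.ofFinite F
  have hc := hy.entry_10_ne_zero
  rw [Nat.card_eq_fintype_card (α := F), ← card_conic hy one_ne_zero, ← Fintype.card_coe,
    ← Nat.card_eq_fintype_card]
  refine (Nat.card_eq_of_bijective (fun v : conic (tr y) (1 : F) ↦
    (⟨linComb y v.1.1 v.1.2 (mem_conic.1 v.2), (mem_torus_iff hc).2 ⟨_, _, _, rfl⟩⟩ : torus y))
    ⟨?_, ?_⟩).symm
  · rintro ⟨⟨a, b⟩, h⟩ ⟨⟨a', b'⟩, h'⟩ he
    simp only [Subtype.mk.injEq] at he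
    have h0 : a + b * y 0 0 = a' + b' * y 0 0 := congrArg (fun g : SL(2, F) ↦ g 0 0) he
    have h1 : b * y 1 0 = b' * y 1 0 := congrArg (fun g : SL(2, F) ↦ g 1 0) he
    obtain rfl := mul_right_cancel₀ hc h1
    obtain rfl := add_right_cancel h0
    rfl
  · rintro ⟨g, hg⟩
    obtain ⟨a, b, h, rfl⟩ := (mem_torus_iff hc).1 hg
    exact ⟨⟨(a, b), mem_conic.2 h⟩, rfl⟩

lemma tr_eq_of_mem_torus {z y : SL(2, F)} (hy : Nonsplit (tr y)) (hz : z ∈ torus y)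
    (h : tr z = tr y) : z = y ∨ z = y⁻¹ := by
  obtain ⟨a, b, hab, rfl⟩ := (mem_torus_iff hy.entry_10_ne_zero).1 hz
  have ht : 2 * a + b * tr y = tr y := by
    rw [← h]; simp only [linComb, tr, ofEntries_00, ofEntries_11]
    simp only [linComb, tr, ofEntries_00, ofEntries_11] at h
    linear_combination b * h
  set τ := tr y with hτ
  -- P and Q are the coefficients of 1 and y in z² - τz + 1 for z = a + by. This element factors as
  -- (z - y)(z - y⁻¹), and the product below is the product of the norms of the two factors.
  have P : a ^ 2 - b ^ 2 - τ * a + 1 = 0 := by linear_combination a * ht - hab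
  have Q : 2 * a * b + b ^ 2 * τ - τ * b = 0 := by linear_combination b * ht
  have : (a ^ 2 + τ * a * (b - 1) + (b - 1) ^ 2) *
      ((a - τ) ^ 2 + τ * (a - τ) * (b + 1) + (b + 1) ^ 2) = 0 := by
    linear_combination (a ^ 2 - b ^ 2 - τ * a + 1 + τ * (2 * a * b + b ^ 2 * τ - τ * b)) * P +
      (2 * a * b + b ^ 2 * τ - τ * b) * Q
  rcases mul_eq_zero.1 this with h | h
  · obtain ⟨h1, h2⟩ := hy.form_eq_zero h
    have hb : b = 1 := sub_eq_zero.1 h2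
    left; apply ext_entries <;> simp [linComb, h1, hb]
  · obtain ⟨h1, h2⟩ := hy.form_eq_zero h
    have hb : b = -1 := eq_neg_of_add_eq_zero_left h2
    have ha : a = y 0 0 + y 1 1 := sub_eq_zero.1 h1
    right; apply ext_entries <;> simp [linComb, ha, hb]

lemma torus_eq_of_mem {z y : SL(2, F)} (hy : Nonsplit (tr y)) (hz : z ∈ torus y)
    (hz' : ¬ IsScalar z) : torus z = torus y := by
  have hc := hy.entry_10_ne_zero
  obtain ⟨a, b, hab, rfl⟩ := (mem_torus_iff hc).1 hz
  have hb : b ≠ 0 := by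
    rintro rfl
    exact hz' ⟨by simp [linComb], by simp [linComb], by simp [linComb]⟩
  ext g
  rw [mem_torus, mem_torus, commute_iff hc, commute_iff (by simp [linComb, hb, hc])]
  constructor
  · rintro ⟨c, e, h0, h1, h2, h3⟩
    refine ⟨c + e * a, e * b, ?_, ?_, ?_, ?_⟩ <;> simp [h0, h1, h2, h3, linComb] <;> ring
  · rintro ⟨c, e, h0, h1, h2, h3⟩
    refine ⟨c - e / b * a, e / b, ?_, ?_, ?_, ?_⟩ <;> simp [h0, h1, h2, h3, linComb] <;>
      field_simp <;> ring

lemma nonsplit_of_mem_torus {z y : SL(2, F)} (hy : Nonsplit (tr y)) (hz : z ∈ torus y)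
    (hz' : ¬ IsScalar z) : Nonsplit (tr z) := by
  obtain ⟨a, b, h, rfl⟩ := (mem_torus_iff hy.entry_10_ne_zero).1 hz
  have hb : b ≠ 0 := by
    rintro rfl
    exact hz' ⟨by simp [linComb], by simp [linComb], by simp [linComb]⟩
  intro c hc
  refine hy ((c - a) / b) ?_
  simp only [tr, linComb, ofEntries_00, ofEntries_11] at hc h ⊢
  field_simp
  linear_combination hc + h

/-- The elements normalising a torus containing `z`, expressed through a generator. -/
lemma conj_mem_dihedral {g z t y : SL(2, F)} (hy : Nonsplit (tr y)) (hz : z ∈ torus y)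
    (ht : t ∈ torus y) (hz' : ¬ IsScalar z) (ht' : ¬ IsScalar t) (h : g * z * g⁻¹ = t) :
    g ∈ dihedral y := by
  rw [mem_dihedral]
  -- The conjugate of y commutes with t, hence lies in the torus, and it has the trace of y.
  refine tr_eq_of_mem_torus hy ?_ (tr_conj _ _)
  rw [← torus_eq_of_mem hy ht ht', mem_torus, ← h]
  have h1 : Commute y z := by
    have := self_mem_torus y
    rwa [← torus_eq_of_mem hy hz hz', mem_torus] at this
  show g * y * g⁻¹ * (g * z * g⁻¹) = g * z * g⁻¹ * (g * y * g⁻¹)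
  have e : ∀ a b : SL(2, F), g * a * g⁻¹ * (g * b * g⁻¹) = g * (a * b) * g⁻¹ := by intros; group
  rw [e, e, h1.eq]

/-- Replacing y by an eigenvalue embeds the torus in the multiplicative group of a field, where
finite subgroups are cyclic. -/
lemma isCyclic_torus [Finite F] {y : SL(2, F)} (hy : Nonsplit (tr y)) : IsCyclic (torus y) := by
  let K := AlgebraicClosure F
  obtain ⟨l, hl⟩ : ∃ l : K, l ^ 2 - algebraMap F K (tr y) * l + 1 = 0 := by
    obtain ⟨l, hl⟩ := IsAlgClosed.exists_root (k := K)
      (Polynomial.X ^ 2 - Polynomial.C (algebraMap F K (tr y)) * Polynomial.X + 1) (by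
        have : (Polynomial.X ^ 2 - Polynomial.C (algebraMap F K (tr y)) * Polynomial.X + 1 :
          Polynomial K).degree = 2 := by compute_degree!
        rw [this]; decide)
    exact ⟨l, by simpa [Polynomial.IsRoot] using hl⟩
  have hc := hy.entry_10_ne_zero
  have hl' : ∀ a : F, algebraMap F K a ≠ l := fun a ha ↦ by
    subst ha
    refine hy a ((algebraMap F K).injective ?_)
    simpa using hl
  -- This is a + by ↦ a + bl, with a and b recovered from the first column.
  let f : torus y →* K :=
    { toFun := fun g ↦ algebraMap F K (g.1 0 0) +
        algebraMap F K (g.1 1 0 / y 1 0) * (l - algebraMap F K (y 0 0))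
      map_one' := by simp
      map_mul' := by
        rintro ⟨g, hg⟩ ⟨h, hh⟩
        obtain ⟨a, b, hab, rfl⟩ := (mem_torus_iff hc).1 hg
        obtain ⟨a', b', hab', rfl⟩ := (mem_torus_iff hc).1 hh
        have hd' : algebraMap F K (y 0 1) * algebraMap F K (y 1 0) =
            algebraMap F K (y 0 0) * algebraMap F K (y 1 1) - 1 := by
          rw [← map_mul, ← map_mul, ← map_one (algebraMap F K), ← map_sub]
          congr 1; linear_combination -(det_eq y)
        have e1 : (linComb y a b hab * linComb y a' b' hab') 1 0 / y 1 0 =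
            b * (a' + b' * y 0 0) + (a + b * y 1 1) * b' := by
          simp [linComb]; field_simp
        simp only [tr, map_add] at hl
        simp only [Subgroup.coe_mul, e1]
        simp only [linComb, mul_00, ofEntries_00, ofEntries_01, ofEntries_10,
          mul_div_cancel_right₀ _ hc, map_add, map_mul]
        linear_combination (-(algebraMap F K b * algebraMap F K b')) * (hl - hd') }
  refine isCyclic_of_injective_ringHom f ?_
  rw [injective_iff_map_eq_one]
  rintro ⟨g, hg⟩ h1
  obtain ⟨a, b, hab, rfl⟩ := (mem_torus_iff hc).1 hg
  have h2 : algebraMap F K a + algebraMap F K b * l = 1 := by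
    rw [← h1]
    simp only [f, MonoidHom.coe_mk, OneHom.coe_mk, linComb, ofEntries_00, ofEntries_10,
      mul_div_cancel_right₀ _ hc, map_add, map_mul]
    ring
  have hb : b = 0 := by
    by_contra hb
    refine hl' ((1 - a) / b) ?_
    have : algebraMap F K b ≠ 0 := by simpa using hb
    rw [map_div₀, map_sub, map_one, div_eq_iff this]
    linear_combination -h2
  subst hb
  have ha : a = 1 := (algebraMap F K).injective (by simpa using h2)
  subst ha
  exact Subtype.ext (ext_entries (by simp [linComb]) (by simp [linComb]) (by simp [linComb])
    (by simp [linComb]))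

end SL2

namespace SL2

open Matrix Matrix.SpecialLinearGroup OnePoint

/-! ### Subgroups containing a nonsplit torus: counting fixed points -/

section overgroups

variable {F : Type*} [Field F] [Fintype F] [DecidableEq F]

open Classical in
noncomputable instance : Fintype SL(2, F) := Fintype.ofFinite _

/-- The number of scalar matrices in `SL(2, F)`. -/
def numScalars (F : Type*) [Field F] [DecidableEq F] : ℕ := ({1, -1} : Finset F).card

lemma numScalars_pos : 1 ≤ numScalars F := Finset.card_pos.2 ⟨1, by simp⟩
lemma numScalars_le : numScalars F ≤ 2 := Finset.card_le_two

open Classical in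
lemma card_filter_isScalar (Γ : Subgroup SL(2, F)) (hΓ : Subgroup.center SL(2, F) ≤ Γ) :
    (Finset.univ.filter fun a : Γ ↦ IsScalar a.1).card = numScalars F := by
  refine Finset.card_bij (fun a _ ↦ a.1 0 0) ?_ ?_ ?_
  · rintro ⟨a, ha⟩ h
    simp only [Finset.mem_filter, Finset.mem_univ, true_and] at h
    rcases isScalar_iff_eq.1 h with rfl | rfl <;> simp
  · rintro ⟨a, ha⟩ h ⟨b, hb⟩ h' e
    simp only [Finset.mem_filter, Finset.mem_univ, true_and] at h h' e
    exact Subtype.ext (ext_entries e (h.1.trans h'.1.symm) (h.2.1.trans h'.2.1.symm)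
      (h.2.2.symm.trans (e.trans h'.2.2)))
  · intro b hb
    simp only [Finset.mem_insert, Finset.mem_singleton] at hb
    rcases hb with rfl | rfl
    · exact ⟨1, by rw [Finset.mem_filter]; exact ⟨Finset.mem_univ _, isScalar_iff_eq.2 (.inl rfl)⟩,
        by simp⟩
    · refine ⟨⟨-1, hΓ (mem_center_iff_isScalar.2 (by simp [IsScalar]))⟩,
        by rw [Finset.mem_filter]; exact ⟨Finset.mem_univ _, isScalar_iff_eq.2 (.inr rfl)⟩, by simp⟩

variable (Γ : Subgroup SL(2, F))

open Classical in
/-- The number of elements of `Γ` without fixed points. -/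
noncomputable def numNonsplit : ℕ := (Finset.univ.filter fun a : Γ ↦ Nonsplit (tr a.1)).card

open Classical in
/-- The number of nonscalar elements of `Γ` with exactly one fixed point. -/
noncomputable def numUnipotent : ℕ :=
  (Finset.univ.filter fun a : Γ ↦ ¬ IsScalar a.1 ∧ (fixedPts a.1).card = 1).card

/-- The number of orbits of `Γ` on the projective line. -/
noncomputable def numOrbits : ℕ := Nat.card (MulAction.orbitRel.Quotient Γ (OnePoint F))

lemma fintypeCard_onePoint : Fintype.card (OnePoint F) = Fintype.card F + 1 := by
  rw [← Nat.card_eq_fintype_card, card_onePoint, Nat.card_eq_fintype_card]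

lemma card_fixedPts_eq_zero_iff {A : SL(2, F)} : (fixedPts A).card = 0 ↔ Nonsplit (tr A) := by
  rw [Finset.card_eq_zero, nonsplit_iff_smul_ne, Finset.eq_empty_iff_forall_notMem]
  simp

variable {Γ}

open Classical in
/-- Burnside's count. -/
lemma burnside (hΓ : Subgroup.center SL(2, F) ≤ Γ) :
    2 * numNonsplit Γ + numUnipotent Γ + numOrbits Γ * Fintype.card Γ + numScalars F * 2 =
      2 * Fintype.card Γ + numScalars F * (Fintype.card F + 1) := by
  have b := MulAction.sum_card_fixedBy_eq_card_orbits_mul_card_group Γ (OnePoint F)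
  have hr : Fintype.card (Quotient (MulAction.orbitRel Γ (OnePoint F))) = numOrbits Γ := by
    rw [numOrbits, Nat.card_eq_fintype_card]
  have hf : ∀ a : Γ, Fintype.card (MulAction.fixedBy (OnePoint F) a) = (fixedPts a.1).card := by
    intro a
    rw [← Set.toFinset_card]
    congr 1
    ext p
    simp [fixedPts]
    rfl
  simp only [hf, hr] at b
  have hsc : ∀ a : Γ, IsScalar a.1 → (fixedPts a.1).card = Fintype.card F + 1 := by
    intro a ha
    rw [← fintypeCard_onePoint, ← Finset.card_univ]
    congr 1
    ext p
    simp [ha.smul_eq p]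
  -- The indicator terms lift the number of fixed points of every nonscalar element to 2, so that
  -- the sum over Γ can be evaluated.
  have key : ∀ a : Γ, (fixedPts a.1).card + 2 * (if Nonsplit (tr a.1) then 1 else 0) +
      (if ¬ IsScalar a.1 ∧ (fixedPts a.1).card = 1 then 1 else 0) +
        2 * (if IsScalar a.1 then 1 else 0) =
      2 + (Fintype.card F + 1) * (if IsScalar a.1 then 1 else 0) := by
    intro a
    by_cases h : IsScalar a.1
    · have h2 : ¬ Nonsplit (tr a.1) := fun hn ↦ hn.not_isScalar h
      simp [h, h2, hsc a h]; ring
    · have h2 := card_fixedPts_le_two h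
      simp only [h, not_false_eq_true, true_and, ← card_fixedPts_eq_zero_iff]
      interval_cases (fixedPts a.1).card <;> simp
  have := Finset.sum_congr (rfl : (Finset.univ : Finset Γ) = Finset.univ) fun a _ ↦ key a
  simp only [Finset.sum_add_distrib, ← Finset.mul_sum, Finset.sum_boole, Nat.cast_id] at this
  rw [b, card_filter_isScalar Γ hΓ, Finset.sum_const, Finset.card_univ] at this
  change _ + 2 * numNonsplit Γ + numUnipotent Γ + _ = _ at this
  simp only [smul_eq_mul] at this
  linarith

variable {y : SL(2, F)}

lemma numNonsplit_torus (hy : Nonsplit (tr y)) :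
    numNonsplit (torus y) + numScalars F = Fintype.card F + 1 := by
  classical
  rw [← Nat.card_eq_fintype_card, ← card_torus hy, Nat.card_eq_fintype_card,
    ← card_filter_isScalar (torus y) (center_le_torus y), numNonsplit, ← Finset.card_univ,
    ← Finset.card_union_of_disjoint]
  · congr 1
    ext a
    simp only [Finset.mem_union, Finset.mem_filter, Finset.mem_univ, true_and, iff_true]
    by_cases h : IsScalar a.1
    · exact .inr h
    · exact .inl (nonsplit_of_mem_torus hy a.2 h)
  · rw [Finset.disjoint_filter]
    exact fun a _ h ↦ h.not_isScalar

/-- Nonscalar elements of the torus fix nothing, so it acts freely modulo scalars. Thus there is one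
orbit for q even and there are two for q odd. -/
lemma numOrbits_torus (hy : Nonsplit (tr y)) : numOrbits (torus y) = numScalars F := by
  classical
  have h1 := burnside (center_le_torus y)
  have h2 := numNonsplit_torus hy
  have h3 : numUnipotent (torus y) = 0 := by
    rw [numUnipotent, Finset.card_eq_zero, Finset.filter_eq_empty_iff]
    rintro a - ⟨h, h'⟩
    rw [card_fixedPts_eq_zero_iff.2 (nonsplit_of_mem_torus hy a.2 h)] at h'
    exact absurd h' zero_ne_one
  have h4 : Fintype.card (torus y) = Fintype.card F + 1 := by
    rw [← Nat.card_eq_fintype_card, card_torus hy, Nat.card_eq_fintype_card]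
  rw [h3, h4] at h1
  have : numOrbits (torus y) * (Fintype.card F + 1) = numScalars F * (Fintype.card F + 1) := by
    omega
  exact Nat.eq_of_mul_eq_mul_right (by omega) this

lemma numOrbits_le (hy : Nonsplit (tr y)) (hT : torus y ≤ Γ) : numOrbits Γ ≤ numScalars F := by
  classical
  rw [← numOrbits_torus hy]
  refine Nat.card_le_card_of_surjective
    (Quotient.map' (s₁ := MulAction.orbitRel (torus y) (OnePoint F))
      (s₂ := MulAction.orbitRel Γ (OnePoint F)) id ?_) ?_
  · rintro a b ⟨g, hg⟩
    exact ⟨⟨g.1, hT g.2⟩, hg⟩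
  · intro z
    induction z using Quotient.inductionOn' with
    | h p => exact ⟨Quotient.mk'' p, rfl⟩

lemma numOrbits_pos : 1 ≤ numOrbits Γ := by
  classical
  have : Nonempty (MulAction.orbitRel.Quotient Γ (OnePoint F)) := ⟨Quotient.mk'' ∞⟩
  exact Nat.card_pos

/-- The torus already contributes that many fixed-point-free elements, so there are no others. In
particular every Γ-conjugate of y stays in the torus, where its trace makes it y or y⁻¹. -/
lemma le_dihedral_of_numNonsplit_le (hy : Nonsplit (tr y)) (hT : torus y ≤ Γ)
    (h : numNonsplit Γ + numScalars F ≤ Fintype.card F + 1) : Γ ≤ dihedral y := by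
  classical
  have h0 := numNonsplit_torus hy
  intro g hg
  have hg' : g * y * g⁻¹ ∈ torus y := by
    have hle : numNonsplit Γ ≤ numNonsplit (torus y) := by omega
    let f : torus y → Γ := fun a ↦ ⟨a.1, hT a.2⟩
    have hf : Function.Injective f := fun a b e ↦ Subtype.ext (congrArg (fun z : Γ ↦ z.1) e)
    have hsub : ((Finset.univ.filter fun a : torus y ↦ Nonsplit (tr a.1)).image f) ⊆
        (Finset.univ.filter fun a : Γ ↦ Nonsplit (tr a.1)) := by
      intro z hz
      obtain ⟨a, ha, rfl⟩ := Finset.mem_image.1 hz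
      simpa [f] using ha
    have heq := Finset.eq_of_subset_of_card_le hsub (by
      rw [Finset.card_image_of_injective _ hf]; exact hle)
    have hmem : (⟨g * y * g⁻¹, Γ.mul_mem (Γ.mul_mem hg (hT (self_mem_torus y))) (Γ.inv_mem hg)⟩ : Γ)
        ∈ (Finset.univ.filter fun a : Γ ↦ Nonsplit (tr a.1)) := by simpa using hy
    rw [← heq] at hmem
    obtain ⟨a, -, ha⟩ := Finset.mem_image.1 hmem
    have : a.1 = g * y * g⁻¹ := congrArg (fun z : Γ ↦ z.1) ha
    exact this ▸ a.2
  exact tr_eq_of_mem_torus hy hg' (tr_conj _ _)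

/-- The number of orbits is then exactly two, the terms with |Γ| cancel in Burnside's identity, and
what remains bounds the number of fixed-point-free elements by that of the torus. -/
lemma le_dihedral_of_numOrbits_ne_one (hy : Nonsplit (tr y)) (hT : torus y ≤ Γ)
    (h : numOrbits Γ ≠ 1) : Γ ≤ dihedral y := by
  have h1 := numOrbits_le hy hT
  have h2 := numOrbits_pos (Γ := Γ)
  have h3 := numScalars_le (F := F)
  have h4 : numOrbits Γ = 2 := by omega
  have h5 : numScalars F = 2 := by omega
  have b := burnside ((center_le_torus y).trans hT)
  rw [h4, h5] at b
  exact le_dihedral_of_numNonsplit_le hy hT (by omega)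

/-- Two elements that invert y have a product that centralises it, so the torus has index at most
two in its normaliser. -/
lemma card_dihedral_inf_le (hy : Nonsplit (tr y)) (hT : torus y ≤ Γ) :
    Nat.card (dihedral y ⊓ Γ : Subgroup SL(2, F)) = Fintype.card F + 1 ∧
      dihedral y ⊓ Γ = torus y ∨
    Nat.card (dihedral y ⊓ Γ : Subgroup SL(2, F)) = 2 * (Fintype.card F + 1) := by
  classical
  have hle : torus y ≤ dihedral y ⊓ Γ := le_inf (torus_le_dihedral y) hT
  have hcard : Nat.card (torus y) = Fintype.card F + 1 := by
    rw [card_torus hy, Nat.card_eq_fintype_card]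
  by_cases heq : dihedral y ⊓ Γ = torus y
  · exact .inl ⟨by rw [heq, hcard], heq⟩
  right
  have hidx : ((torus y).subgroupOf (dihedral y ⊓ Γ)).index = 2 := by
    rw [Subgroup.index_eq_two_iff]
    obtain ⟨a, ha, ha'⟩ := Set.not_subset.1 fun h ↦ heq (le_antisymm h hle)
    refine ⟨⟨a, ha⟩, ?_⟩
    have inv : ∀ b ∈ dihedral y, b ∉ torus y → b * y * b⁻¹ = y⁻¹ := fun b hb hb' ↦
      hb.resolve_left fun h ↦ hb' (mem_torus.2 (mul_inv_eq_iff_eq_mul.1 h))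
    rintro ⟨b, hb⟩
    rw [Subgroup.mem_subgroupOf, Subgroup.mem_subgroupOf]
    simp only [Subgroup.coe_mul]
    by_cases hbT : b ∈ torus y
    · right
      refine ⟨hbT, fun h ↦ ha' ?_⟩
      simpa using (torus y).mul_mem ((torus y).inv_mem hbT) h
    · left
      refine ⟨?_, hbT⟩
      rw [mem_torus]
      show b * a * y = y * (b * a)
      have e1 := mul_inv_eq_iff_eq_mul.1 (inv a ha.1 ha')
      have e2 : b * y⁻¹ * b⁻¹ = y := by
        have := congrArg (·⁻¹) (inv b hb.1 hbT)
        simpa [mul_assoc] using this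
      rw [mul_assoc, e1, ← mul_assoc, mul_inv_eq_iff_eq_mul.1 e2, mul_assoc]
  rw [← Subgroup.index_mul_card ((torus y).subgroupOf (dihedral y ⊓ Γ)), hidx,
    Nat.card_congr (Subgroup.subgroupOfEquivOfLe hle).toEquiv, hcard]

lemma card_dihedral_inf_le_two_mul (hy : Nonsplit (tr y)) (hT : torus y ≤ Γ) :
    Nat.card (dihedral y ⊓ Γ : Subgroup SL(2, F)) ≤ 2 * (Fintype.card F + 1) := by
  rcases card_dihedral_inf_le hy hT with h | h <;> omega

open Classical in
/-- Conjugates of the nonscalar elements of the torus provide many nonsplit elements. -/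
lemma card_mul_le_numNonsplit (hy : Nonsplit (tr y)) (hT : torus y ≤ Γ) :
    Fintype.card Γ * (Fintype.card F + 1 - numScalars F) ≤
      2 * (Fintype.card F + 1) * numNonsplit Γ := by
  classical
  have h0 := numNonsplit_torus hy
  have hn : Fintype.card F + 1 - numScalars F = numNonsplit (torus y) := by omega
  rw [hn, numNonsplit, ← Finset.card_univ, ← Finset.card_product, numNonsplit,
    mul_comm (2 * (Fintype.card F + 1))]
  let f : Γ × torus y → Γ := fun p ↦ p.1 * ⟨p.2.1, hT p.2.2⟩ * p.1⁻¹
  have hf : ∀ p, (f p).1 = p.1.1 * p.2.1 * p.1.1⁻¹ := fun p ↦ rfl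
  refine (Finset.card_le_mul_card_image_of_maps_to (f := f)
    (t := (Finset.univ.filter fun a : Γ ↦ Nonsplit (tr a.1))) ?_
    (2 * (Fintype.card F + 1)) ?_).trans (by rw [mul_comm])
  · rintro ⟨g, t⟩ h
    simp only [Finset.mem_product, Finset.mem_filter, Finset.mem_univ, true_and] at h ⊢
    rwa [hf, tr_conj]
  · intro z hz
    rcases Finset.eq_empty_or_nonempty ((Finset.univ ×ˢ
      (Finset.univ.filter fun a : torus y ↦ Nonsplit (tr a.1))).filter fun p ↦ f p = z) with he | ⟨p0, hp0⟩
    · rw [he]; simp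
    -- The fibre over z injects into the normaliser of the torus in Γ: for a fixed pair (g₀, t₀)
    -- send (g, t) to g₀⁻¹g. The component t is determined by g and z.
    refine le_trans ?_ (card_dihedral_inf_le_two_mul hy hT)
    simp only [Finset.mem_filter, Finset.mem_product, Finset.mem_univ, true_and] at hp0
    obtain ⟨hp1, hp2⟩ := hp0
    have hmem : ∀ p : Γ × torus y, Nonsplit (tr p.2.1) → f p = z →
        p0.1.1⁻¹ * p.1.1 ∈ dihedral y ⊓ Γ := by
      intro p h1 h2
      refine ⟨conj_mem_dihedral hy p.2.2 p0.2.2 h1.not_isScalar hp1.not_isScalar ?_,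
        Γ.mul_mem (Γ.inv_mem p0.1.2) p.1.2⟩
      have e := congrArg (fun z : Γ ↦ z.1) (h2.trans hp2.symm)
      simp only [hf] at e
      calc p0.1.1⁻¹ * p.1.1 * p.2.1 * (p0.1.1⁻¹ * p.1.1)⁻¹
          = p0.1.1⁻¹ * (p.1.1 * p.2.1 * p.1.1⁻¹) * p0.1.1 := by group
        _ = p0.2.1 := by rw [e]; group
    rw [← Fintype.card_coe, ← Nat.card_eq_fintype_card]
    refine Nat.card_le_card_of_injective (fun p ↦ (⟨p0.1.1⁻¹ * p.1.1.1, hmem p.1 ?_ ?_⟩ :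
      (dihedral y ⊓ Γ : Subgroup SL(2, F)))) ?_
    · have := p.2; simp only [Finset.mem_filter, Finset.mem_product, Finset.mem_univ, true_and] at this
      exact this.1
    · have := p.2; simp only [Finset.mem_filter, Finset.mem_product, Finset.mem_univ, true_and] at this
      exact this.2
    · rintro ⟨⟨g, t⟩, h⟩ ⟨⟨g', t'⟩, h'⟩ e
      simp only [Finset.mem_filter, Finset.mem_product, Finset.mem_univ, true_and] at h h'
      simp only [Subtype.mk.injEq, mul_right_inj] at e
      obtain rfl : g = g' := Subtype.ext e
      have e2 := congrArg (fun z : Γ ↦ z.1) (h.2.trans h'.2.symm)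
      simp only [hf, mul_left_inj, mul_right_inj] at e2
      obtain rfl : t = t' := Subtype.ext e2
      rfl

end overgroups

end SL2

/-! ### Point stabilisers of subgroups that are transitive on the projective line. -/

namespace SL2

open Matrix Matrix.SpecialLinearGroup OnePoint

section overgroups

variable {F : Type*} [Field F]

/-- The additive group of `b` with `upper b ∈ Γ`. -/
def upperGroup (Γ : Subgroup SL(2, F)) : AddSubgroup F where
  carrier := {b | upper b ∈ Γ}
  zero_mem' := by
    have : upper (0 : F) = 1 := by apply ext_entries <;> simp
    show upper (0 : F) ∈ Γ
    rw [this]; exact Γ.one_mem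
  add_mem' := by
    intro a b ha hb
    show upper (a + b) ∈ Γ
    rw [← upper_mul]; exact Γ.mul_mem ha hb
  neg_mem' := by
    intro a ha
    show upper (-a) ∈ Γ
    rw [← upper_inv]; exact Γ.inv_mem ha

lemma mem_upperGroup {Γ : Subgroup SL(2, F)} {b : F} : b ∈ upperGroup Γ ↔ upper b ∈ Γ := Iff.rfl

variable [Fintype F] [DecidableEq F] (Γ : Subgroup SL(2, F))

lemma mem_stabilizer_infty {Γ : Subgroup SL(2, F)} {g : Γ} :
    g ∈ MulAction.stabilizer Γ (∞ : OnePoint F) ↔ g.1 1 0 = 0 := by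
  rw [← smul_infty_eq_self_iff]; rfl

/-- The upper left entry, as a character of the stabiliser of `∞`. -/
def eigenvalueHom : MulAction.stabilizer Γ (∞ : OnePoint F) →* Fˣ where
  toFun g := ⟨g.1.1 0 0, g.1.1 1 1, by
      have := det_eq g.1.1; rw [mem_stabilizer_infty.1 g.2] at this; linear_combination this, by
      have := det_eq g.1.1; rw [mem_stabilizer_infty.1 g.2] at this; linear_combination this⟩
  map_one' := by ext; simp
  map_mul' := by
    intro a b
    ext
    have := mem_stabilizer_infty.1 b.2
    simp [this]

@[simp] lemma eigenvalueHom_apply (g : MulAction.stabilizer Γ (∞ : OnePoint F)) :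
    (eigenvalueHom Γ g : F) = g.1.1 0 0 := rfl

/-- The kernel of the eigenvalue character consists of the unitriangular elements of Γ. -/
lemma card_stabilizer_eq : Nat.card (MulAction.stabilizer Γ (∞ : OnePoint F)) =
    Nat.card (upperGroup Γ) * Nat.card (eigenvalueHom Γ).range := by
  rw [← Subgroup.card_mul_index (eigenvalueHom Γ).ker, Subgroup.index_ker]
  congr 1
  refine (Nat.card_eq_of_bijective (fun b : upperGroup Γ ↦ (⟨⟨⟨upper b.1, b.2⟩,
    mem_stabilizer_infty.2 (by simp)⟩, by rw [MonoidHom.mem_ker]; ext; simp⟩ :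
      (eigenvalueHom Γ).ker)) ⟨?_, ?_⟩).symm
  · intro b b' h
    exact Subtype.ext (congrArg (fun z : (eigenvalueHom Γ).ker ↦ z.1.1.1 0 1) h)
  · intro g
    have h0 : g.1.1.1 1 0 = 0 := mem_stabilizer_infty.1 g.1.2
    have h1 : g.1.1.1 0 0 = 1 := congrArg (Units.val) g.2
    have hd := det_eq g.1.1.1
    rw [h0, h1] at hd
    have e : upper (g.1.1.1 0 1) = g.1.1.1 := by
      apply ext_entries <;> simp [h0, h1]
      linear_combination -hd
    exact ⟨⟨g.1.1.1 0 1, by rw [mem_upperGroup, e]; exact g.1.1.2⟩,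
      Subtype.ext (Subtype.ext (Subtype.ext e))⟩

variable {Γ}

lemma card_upperGroup_dvd : Nat.card (upperGroup Γ) ∣ Fintype.card F := by
  rw [← Nat.card_eq_fintype_card]; exact AddSubgroup.card_addSubgroup_dvd_card _

lemma card_range_dvd : Nat.card (eigenvalueHom Γ).range ∣ Fintype.card F - 1 := by
  rw [← Fintype.card_units, ← Nat.card_eq_fintype_card]
  exact Subgroup.card_subgroup_dvd_card _

/-- Conjugation by an element with eigenvalue l multiplies the parameter b of a unipotent by l². For
fixed b ≠ 0 the map l ↦ l²b goes into the nonzero elements of `upperGroup Γ`, and its fibres have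
the form {l, -l}. -/
lemma card_range_le (hx : 1 < Nat.card (upperGroup Γ)) :
    Nat.card (eigenvalueHom Γ).range ≤ numScalars F * (Nat.card (upperGroup Γ) - 1) := by
  classical
  have : Nontrivial (upperGroup Γ) := by
    rw [← Finite.one_lt_card_iff_nontrivial]; exact hx
  obtain ⟨⟨b, hb⟩, hb0⟩ := exists_ne (0 : upperGroup Γ)
  have hb0 : b ≠ 0 := fun h ↦ hb0 (Subtype.ext h)
  rw [Nat.card_eq_fintype_card, Nat.card_eq_fintype_card, ← Finset.card_univ]
  have hcard : ((Finset.univ : Finset (upperGroup Γ)).erase 0).card =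
      Fintype.card (upperGroup Γ) - 1 := by
    rw [Finset.card_erase_of_mem (Finset.mem_univ _), Finset.card_univ]
  rw [← hcard]
  have hmem : ∀ l : (eigenvalueHom Γ).range, ((l.1 : F) ^ 2 * b) ∈ upperGroup Γ := by
    rintro ⟨l, g, rfl⟩
    rw [mem_upperGroup]
    have := Γ.mul_mem (Γ.mul_mem g.1.2 hb) (Γ.inv_mem g.1.2)
    convert this using 1
    have h0 := mem_stabilizer_infty.1 g.2
    have hd := det_eq g.1.1
    rw [h0] at hd
    apply ext_entries <;> simp [h0]
    · linear_combination -hd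
    · ring
    · linear_combination -hd
  refine Finset.card_le_mul_card_image_of_maps_to
    (f := fun l : (eigenvalueHom Γ).range ↦ (⟨_, hmem l⟩ : upperGroup Γ)) ?_ _ ?_
  · intro l _
    refine Finset.mem_erase.2 ⟨fun h ↦ ?_, Finset.mem_univ _⟩
    have : (l.1 : F) ^ 2 * b = 0 := congrArg (fun z : upperGroup Γ ↦ z.1) h
    simp [hb0] at this
  · intro z _
    rcases Finset.eq_empty_or_nonempty ((Finset.univ : Finset (eigenvalueHom Γ).range).filter
      fun l ↦ (⟨_, hmem l⟩ : upperGroup Γ) = z) with he | ⟨l0, hl0⟩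
    · rw [he]; simp
    refine Finset.card_le_card_of_injOn (fun l ↦ (l.1 : F) / l0.1) ?_ ?_
    · intro l hl
      simp only [Finset.coe_filter, Finset.mem_univ, true_and, Finset.mem_filter] at hl hl0
      have h1 : (l.1 : F) ^ 2 * b = (l0.1 : F) ^ 2 * b :=
        congrArg (fun z : upperGroup Γ ↦ z.1) (hl.trans hl0.symm)
      have h2 := mul_right_cancel₀ hb0 h1
      have h3 : (l0.1 : F) ≠ 0 := Units.ne_zero _
      simp only [Finset.coe_insert, Finset.coe_singleton, Set.mem_insert_iff,
        Set.mem_singleton_iff, div_eq_iff h3]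
      rcases sq_eq_sq_iff_eq_or_eq_neg.1 h2 with h | h
      · left; rw [h, one_mul]
      · right; rw [h, neg_one_mul]
    · intro l _ l' _ h
      have h3 : (l0.1 : F) ≠ 0 := Units.ne_zero _
      exact Subtype.ext (Units.ext ((div_left_inj' h3).1 h))

open Classical in
lemma card_eq_of_numOrbits_eq_one (h : numOrbits Γ = 1) :
    Fintype.card Γ = (Fintype.card F + 1) * Nat.card (MulAction.stabilizer Γ (∞ : OnePoint F)) := by
  have : Subsingleton (MulAction.orbitRel.Quotient Γ (OnePoint F)) :=
    Finite.card_le_one_iff_subsingleton.1 h.le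
  have := (MulAction.pretransitive_iff_subsingleton_quotient Γ (OnePoint F)).2 this
  rw [← fintypeCard_onePoint, ← Nat.card_eq_fintype_card, ← Nat.card_eq_fintype_card (α := OnePoint F),
    ← Subgroup.index_mul_card (MulAction.stabilizer Γ (∞ : OnePoint F)),
    MulAction.index_stabilizer_of_transitive]

/-- By transitivity every point carries conjugates of ±`upper b` with b ≠ 0. Such an element fixes
only its own point, so different points contribute different elements. -/
lemma le_numUnipotent (hΓ : Subgroup.center SL(2, F) ≤ Γ) (h : numOrbits Γ = 1) :
    (Fintype.card F + 1) * (numScalars F * (Nat.card (upperGroup Γ) - 1)) ≤ numUnipotent Γ := by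
  classical
  have : Subsingleton (MulAction.orbitRel.Quotient Γ (OnePoint F)) :=
    Finite.card_le_one_iff_subsingleton.1 h.le
  have := (MulAction.pretransitive_iff_subsingleton_quotient Γ (OnePoint F)).2 this
  have hg : ∀ p : OnePoint F, ∃ g : Γ, g • (∞ : OnePoint F) = p :=
    fun p ↦ MulAction.exists_smul_eq Γ ∞ p
  choose g hg using hg
  have hcard : ((Finset.univ : Finset (upperGroup Γ)).erase 0).card =
      Nat.card (upperGroup Γ) - 1 := by
    rw [Finset.card_erase_of_mem (Finset.mem_univ _), Finset.card_univ, Nat.card_eq_fintype_card]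
  rw [← hcard, ← fintypeCard_onePoint, ← Finset.card_univ, numScalars, ← Finset.card_product,
    ← Finset.card_product, numUnipotent]
  -- the matrix `ε • upper b`
  let u : F × F → SL(2, F) := fun v ↦ if v.1 = 1 then upper v.2 else -upper v.2
  have hu00 : ∀ v : F × F, v.1 ∈ ({1, -1} : Finset F) → u v 0 0 = v.1 := by
    rintro ⟨e, b⟩ he
    simp only [u]
    split_ifs with h1
    · simp [h1]
    · have : e = -1 := by simpa [h1] using he
      simp [this]
  have hu10 : ∀ v : F × F, u v 1 0 = 0 := by
    intro v; simp only [u]; split_ifs <;> simp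
  have hu11 : ∀ v : F × F, u v 1 1 = u v 0 0 := by
    intro v; simp only [u]; split_ifs <;> simp
  have hu01 : ∀ v : F × F, v.1 ∈ ({1, -1} : Finset F) → u v 0 1 = v.1 * v.2 := by
    rintro ⟨e, b⟩ he
    simp only [u]
    split_ifs with h1
    · simp [h1]
    · have : e = -1 := by simpa [h1] using he
      simp [this]
  have huΓ : ∀ v : F × F, v.2 ∈ upperGroup Γ → u v ∈ Γ := by
    intro v hv
    simp only [u]
    split_ifs with h1
    · exact hv
    · rw [← neg_one_mul]
      exact Γ.mul_mem (hΓ (mem_center_iff_isScalar.2 (isScalar_iff_eq.2 (.inr rfl)))) hv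
  let f : OnePoint F × (F × upperGroup Γ) → Γ := fun v ↦
    g v.1 * ⟨u (v.2.1, v.2.2.1), huΓ _ v.2.2.2⟩ * (g v.1)⁻¹
  have hfv : ∀ v, (f v).1 = (g v.1).1 * u (v.2.1, v.2.2.1) * (g v.1).1⁻¹ := fun v ↦ rfl
  have fix : ∀ v : F × F, v.1 ∈ ({1, -1} : Finset F) → v.2 ≠ 0 → ∀ p : OnePoint F,
      u v • p = p ↔ p = ∞ := by
    intro v hv hv2 p
    induction p using OnePoint.rec with
    | infty => simp [smul_infty_eq_self_iff, hu10]
    | coe k =>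
      rw [smul_coe_eq_self_iff, hu10, hu11, hu01 v hv]
      have : v.1 ≠ 0 := by
        intro h0; rw [h0] at hv; simp at hv
      simp [this, hv2]
  have ffix : ∀ v : OnePoint F × (F × upperGroup Γ), v.2.1 ∈ ({1, -1} : Finset F) → v.2.2 ≠ 0 →
      ∀ p : OnePoint F, (f v).1 • p = p ↔ p = v.1 := by
    intro v h1 h2 p
    have hne : v.2.2.1 ≠ 0 := fun h ↦ h2 (Subtype.ext h)
    rw [hfv, mul_smul, mul_smul, smul_eq_iff_eq_inv_smul, fix (v.2.1, v.2.2.1) h1 hne,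
      inv_smul_eq_iff]
    rw [show (g v.1).1 • (∞ : OnePoint F) = v.1 from hg v.1]
  refine Finset.card_le_card_of_injOn f ?_ ?_
  · rintro ⟨p, e, b⟩ hv
    simp only [Finset.coe_product, Set.mem_prod, Finset.mem_coe, Finset.mem_univ, true_and,
      Finset.mem_erase, and_true] at hv
    have hx := ffix (p, e, b) hv.1 hv.2
    simp only [Finset.mem_coe, Finset.mem_filter, Finset.mem_univ, true_and]
    have hfp : fixedPts (f (p, e, b)).1 = {p} := by
      ext r; rw [mem_fixedPts, hx, Finset.mem_singleton]
    refine ⟨fun hs ↦ ?_, by rw [hfp, Finset.card_singleton]⟩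
    have h1 := (hx (g p • (0 : F))).1 (hs.smul_eq _)
    have h2 : (g p) • (((0 : F) : OnePoint F)) = g p • ∞ := by rw [hg]; exact h1
    exact OnePoint.coe_ne_infty _ (MulAction.injective (g p) h2)
  · rintro ⟨p, e, b⟩ hv ⟨p', e', b'⟩ hv' he
    simp only [Finset.coe_product, Set.mem_prod, Finset.mem_coe, Finset.mem_univ, true_and,
      Finset.mem_erase, and_true] at hv hv'
    have hp : p = p' := (ffix (p', e', b') hv'.1 hv'.2 p).1 (by
      rw [← he]; exact (ffix (p, e, b) hv.1 hv.2 p).2 rfl)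
    subst hp
    have h1 := congrArg (fun z : Γ ↦ z.1) he
    simp only [hfv, mul_left_inj, mul_right_inj] at h1
    have h00 : e = e' := (hu00 (e, b.1) hv.1).symm.trans ((congrArg (fun z : SL(2, F) ↦ z 0 0) h1).trans (hu00 (e', b'.1) hv'.1))
    subst h00
    have he0 : e ≠ 0 := by
      rintro rfl; have := hv.1; simp at this
    have h01 : e * b.1 = e * b'.1 := (hu01 (e, b.1) hv.1).symm.trans ((congrArg (fun z : SL(2, F) ↦ z 0 1) h1).trans (hu01 (e, b'.1) hv.1))
    rw [Subtype.ext (mul_left_cancel₀ he0 h01)]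

variable {y : SL(2, F)}

/-- The main counting inequality for a subgroup that contains a nonsplit torus and is transitive on
the projective line. -/
lemma counting_inequality (hy : Nonsplit (tr y)) (hT : torus y ≤ Γ) (h : numOrbits Γ = 1) :
    (Fintype.card F + 1) * (Nat.card (upperGroup Γ) - 1) ≤
      Nat.card (upperGroup Γ) * Nat.card (eigenvalueHom Γ).range + Fintype.card F - 1 := by
  classical
  have hΓ := (center_le_torus y).trans hT
  have b := burnside hΓ
  have h1 := le_numUnipotent hΓ h
  have h2 := card_eq_of_numOrbits_eq_one h
  have h3 := card_mul_le_numNonsplit hy hT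
  have hq : 1 ≤ Fintype.card F := Fintype.card_pos
  have hd := numScalars_pos (F := F)
  have hd2 := numScalars_le (F := F)
  rw [h, one_mul] at b
  rw [← card_stabilizer_eq]
  set M := Nat.card (MulAction.stabilizer Γ (∞ : OnePoint F))
  set q := Fintype.card F
  set d := numScalars F
  set n := numNonsplit Γ
  set x := Nat.card (upperGroup Γ) - 1
  rw [h2, show 2 * (q + 1) * n = (q + 1) * (2 * n) by ring, mul_assoc] at h3
  have h4 := Nat.le_of_mul_le_mul_left h3 (by omega)
  rw [h2] at b
  obtain ⟨k, hk⟩ : ∃ k, q + 1 = d + k := ⟨q + 1 - d, by omega⟩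
  rw [show q + 1 - d = k by omega] at h4
  -- `M k + d (q+1) x ≤ 2 n + u = M (q+1) + d (q-1)`
  have h5 : (q + 1) * (d * x) + M * k + (q + 1) * M + d * 2 ≤
      2 * ((q + 1) * M) + d * (q + 1) := by omega
  have h6 : d * ((q + 1) * x) + d * 2 ≤ d * M + d * (q + 1) := by
    have e : (q + 1) * M = d * M + k * M := by rw [hk]; ring
    nlinarith [h5, e]
  have h7 : (q + 1) * x + 2 ≤ M + (q + 1) := by
    have : d * ((q + 1) * x + 2) ≤ d * (M + (q + 1)) := by linarith
    exact Nat.le_of_mul_le_mul_left this hd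
  omega

end overgroups

end SL2

/-! ### Overgroups of a nonsplit torus. -/

namespace SL2

open Matrix Matrix.SpecialLinearGroup OnePoint

/-- Orbit counting for an action with a distinguished fixed point. -/
lemma card_dvd_of_stabilizers {T X : Type*} [Group T] [MulAction T X] [Finite T] [Finite X]
    (x₀ : X) (h0 : ∀ t : T, t • x₀ = x₀) (k : ℕ)
    (hk : ∀ x, x ≠ x₀ → Nat.card (MulAction.stabilizer T x) ∣ k) :
    Nat.card T ∣ k * (Nat.card X - 1) := by
  classical
  have := Fintype.ofFinite T
  have := Fintype.ofFinite X
  have e := MulAction.card_eq_sum_card_group_div_card_stabilizer T X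
  let ω₀ : Quotient (MulAction.orbitRel T X) := Quotient.mk'' x₀
  have hone : ∀ x : X, (Quotient.mk'' x : Quotient (MulAction.orbitRel T X)) = ω₀ → x = x₀ := by
    intro x hx
    obtain ⟨t, ht⟩ := MulAction.orbitRel_apply.1 (Quotient.exact' hx)
    exact ht.symm.trans (h0 t)
  rw [← Finset.add_sum_erase _ _ (Finset.mem_univ ω₀)] at e
  have h1 : Fintype.card (MulAction.stabilizer T ω₀.out) = Fintype.card T := by
    rw [hone ω₀.out (Quotient.out_eq' _)]
    rw [← Nat.card_eq_fintype_card, ← Nat.card_eq_fintype_card]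
    have : MulAction.stabilizer T x₀ = ⊤ := (Subgroup.eq_top_iff' _).2 h0
    rw [this, Subgroup.card_top]
  rw [h1, Nat.div_self Fintype.card_pos] at e
  rw [Nat.card_eq_fintype_card, Nat.card_eq_fintype_card, e, add_tsub_cancel_left, Finset.mul_sum]
  refine Finset.dvd_sum fun ω hω ↦ ?_
  have hne : ω.out ≠ x₀ := fun h ↦ (Finset.mem_erase.1 hω).1 (by
    rw [← Quotient.out_eq' ω, h])
  obtain ⟨j, hj⟩ := hk _ hne
  have h2 := Subgroup.card_subgroup_dvd_card (MulAction.stabilizer T ω.out)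
  rw [Nat.card_eq_fintype_card, Nat.card_eq_fintype_card] at h2
  rw [Nat.card_eq_fintype_card] at hj
  obtain ⟨l, hl⟩ := h2
  rw [hl, Nat.mul_div_cancel_left _ Fintype.card_pos, hj]
  exact ⟨j, by ring⟩

section overgroups

variable {F : Type*} [Field F] [Fintype F] [DecidableEq F] {Γ : Subgroup SL(2, F)} {y : SL(2, F)}

lemma numScalars_eq_one_iff : numScalars F = 1 ↔ (-1 : F) = 1 := by
  rw [numScalars, Finset.card_eq_one]
  constructor
  · rintro ⟨a, ha⟩
    have h1 : (1 : F) ∈ ({1, -1} : Finset F) := by simp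
    have h2 : (-1 : F) ∈ ({1, -1} : Finset F) := by simp
    rw [ha, Finset.mem_singleton] at h1 h2
    exact h2.trans h1.symm
  · intro h; exact ⟨1, by simp [h]⟩

lemma neg_one_eq_one_iff_even : (-1 : F) = 1 ↔ Even (Fintype.card F) := by
  rw [neg_one_eq_one_iff, FiniteField.even_card_iff_char_two, Nat.even_iff]

lemma numScalars_eq_two_of_odd (h : Odd (Fintype.card F)) : numScalars F = 2 := by
  have h1 := numScalars_le (F := F)
  have h2 := numScalars_pos (F := F)
  have h3 : numScalars F ≠ 1 := by
    rw [Ne, numScalars_eq_one_iff, neg_one_eq_one_iff_even]; exact Nat.not_even_iff_odd.2 h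
  omega

lemma eq_or_eq_neg_of_mem_torus {s t : SL(2, F)} (hy : Nonsplit (tr y)) (hs : s ∈ torus y)
    (ht : t ∈ torus y) (hs0 : tr s = 0) (ht0 : tr t = 0) (hs' : ¬ IsScalar s) :
    t = s ∨ t = -s := by
  have h := torus_eq_of_mem hy hs hs'
  rw [← h] at ht
  rcases tr_eq_of_mem_torus (nonsplit_of_mem_torus hy hs hs') ht (ht0.trans hs0.symm) with e | e
  · exact .inl e
  · right
    rw [e]
    have : s 1 1 = -s 0 0 := by simp only [tr] at hs0; linear_combination hs0
    apply ext_entries <;> simp [this]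

/-- The torus normalises few of its conjugates. -/
lemma card_stabilizer_coset_dvd (hy : Nonsplit (tr y)) {g : SL(2, F)}
    (hg : g ∉ dihedral y) (K : Subgroup SL(2, F)) (hK : ∀ t ∈ K, t ∈ torus y ∧
      g⁻¹ * t * g ∈ dihedral y ⊓ Γ) (hcK : Subgroup.center SL(2, F) ≤ K) :
    (numScalars F = 1 → Nat.card K = 1) ∧
      (numScalars F = 2 → Nat.card K = 2 ∨ Nat.card K = 4 ∧ dihedral y ⊓ Γ ≠ torus y) := by
  classical
  have hsc := card_filter_isScalar K hcK
  -- an element of `K` that is not scalar has trace zero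
  have key : ∀ t ∈ K, ¬ IsScalar t → tr t = 0 ∧ g⁻¹ * t * g ∉ torus y := by
    intro t ht hts
    have htT := (hK t ht).1
    have hnot : g⁻¹ * t * g ∉ torus y := by
      intro hc
      refine hg ?_
      rw [← (dihedral y).inv_mem_iff]
      refine conj_mem_dihedral hy htT hc hts ?_ (by rw [inv_inv])
      intro hs
      have : t = g⁻¹ * t * g := by
        have h1 := mem_center_iff_isScalar.2 hs
        have h2 := Subgroup.mem_center_iff.1 h1 g
        calc t = g * (g⁻¹ * t * g) * g⁻¹ := by group
          _ = g⁻¹ * t * g := by rw [h2]; group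
      exact hts (this ▸ hs)
    refine ⟨?_, hnot⟩
    have h1 := ((mem_dihedral_iff_tr hy.not_isScalar).1 (hK t ht).2.1).resolve_left
      (fun h ↦ hnot (mem_torus.2 h))
    have := h1.1
    rwa [show g⁻¹ * t * g = g⁻¹ * t * g⁻¹⁻¹ by group, tr_conj] at this
  by_cases hall : ∀ t ∈ K, IsScalar t
  · have : Nat.card K = numScalars F := by
      rw [← hsc, Nat.card_eq_fintype_card, ← Finset.card_univ]
      congr 1
      ext t
      simp [hall t.1 t.2]
    exact ⟨fun h ↦ this.trans h, fun h ↦ .inl (this.trans h)⟩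
  push Not at hall
  obtain ⟨s, hsK, hs⟩ := hall
  obtain ⟨hs0, hs1⟩ := key s hsK hs
  have hNS := nonsplit_of_mem_torus hy (hK s hsK).1 hs
  constructor
  · intro h
    exfalso
    rw [numScalars_eq_one_iff] at h
    refine hNS 1 ?_
    rw [hs0]
    linear_combination -h
  · intro h
    right
    refine ⟨?_, fun he ↦ hs1 (he ▸ (hK s hsK).2)⟩
    have hnegs : -s ∈ K := by
      rw [← neg_one_mul]
      exact K.mul_mem (hcK (mem_center_iff_isScalar.2 (isScalar_iff_eq.2 (.inr rfl)))) hsK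
    have hne : (2 : F) ≠ 0 := by
      intro h2
      have : numScalars F = 1 := numScalars_eq_one_iff.2 (by linear_combination -h2)
      omega
    have hsne : s ≠ -s := by
      intro h1
      have h2 : s 1 0 = -s 1 0 := by
        conv_lhs => rw [h1]
        simp
      have h3 : 2 * s 1 0 = 0 := by linear_combination h2
      exact hNS.entry_10_ne_zero ((mul_eq_zero.1 h3).resolve_left hne)
    rw [Nat.card_eq_fintype_card, ← Finset.card_univ,
      ← Finset.card_filter_add_card_filter_not (fun a : K ↦ IsScalar a.1), hsc, h]
    have : (Finset.univ.filter fun a : K ↦ ¬ IsScalar a.1) = {⟨s, hsK⟩, ⟨-s, hnegs⟩} := by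
      ext t
      simp only [Finset.mem_filter, Finset.mem_univ, true_and, Finset.mem_insert,
        Finset.mem_singleton]
      constructor
      · intro ht
        rcases eq_or_eq_neg_of_mem_torus hy (hK s hsK).1 (hK t.1 t.2).1 hs0 (key t.1 t.2 ht).1 hs
          with e | e
        · exact .inl (Subtype.ext e)
        · exact .inr (Subtype.ext e)
      · rintro (rfl | rfl)
        · exact hs
        · intro h1
          refine hs ⟨?_, ?_, ?_⟩
          · simpa using h1.1
          · simpa using h1.2.1
          · simpa using h1.2.2
    rw [this, Finset.card_pair (fun h1 ↦ hsne (congrArg (fun z : K ↦ z.1) h1))]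

/-- The torus acts on the cosets of its normaliser in Γ. It fixes the trivial coset, and every other
coset has a stabiliser of order 1 for q even and of order 2 or 4 for q odd; 4 occurs only when Γ
contains elements inverting the torus. -/
lemma card_torus_dvd (hy : Nonsplit (tr y)) (hT : torus y ≤ Γ) :
    (numScalars F = 1 → Fintype.card F + 1 ∣ ((dihedral y ⊓ Γ).subgroupOf Γ).index - 1) ∧
    (numScalars F = 2 → dihedral y ⊓ Γ = torus y →
      Fintype.card F + 1 ∣ 2 * (((dihedral y ⊓ Γ).subgroupOf Γ).index - 1)) ∧
    (numScalars F = 2 →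
      Fintype.card F + 1 ∣ 4 * (((dihedral y ⊓ Γ).subgroupOf Γ).index - 1)) := by
  classical
  set N := (dihedral y ⊓ Γ).subgroupOf Γ
  set T := (torus y).subgroupOf Γ
  have hle : torus y ≤ dihedral y ⊓ Γ := le_inf (torus_le_dihedral y) hT
  have hTcard : Nat.card T = Fintype.card F + 1 := by
    rw [Nat.card_congr (Subgroup.subgroupOfEquivOfLe hT).toEquiv, card_torus hy,
      Nat.card_eq_fintype_card]
  have hidx : N.index = Nat.card (Γ ⧸ N) := rfl
  rw [hidx, ← hTcard]
  have hfix : ∀ t : T, t • ((1 : Γ) : Γ ⧸ N) = ((1 : Γ) : Γ ⧸ N) := by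
    intro t
    show (((t.1 * 1 : Γ)) : Γ ⧸ N) = _
    rw [QuotientGroup.eq, mul_one, mul_one, N.inv_mem_iff, Subgroup.mem_subgroupOf]
    exact hle t.2
  have hstab : ∀ x : Γ ⧸ N, x ≠ ((1 : Γ) : Γ ⧸ N) →
      (numScalars F = 1 → Nat.card (MulAction.stabilizer T x) = 1) ∧
      (numScalars F = 2 → Nat.card (MulAction.stabilizer T x) = 2 ∨
        Nat.card (MulAction.stabilizer T x) = 4 ∧ dihedral y ⊓ Γ ≠ torus y) := by
    intro x
    induction x using QuotientGroup.induction_on with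
    | H g =>
    intro hx
    have hg : g.1 ∉ dihedral y := by
      intro h
      refine hx ?_
      rw [QuotientGroup.eq, mul_one, N.inv_mem_iff, Subgroup.mem_subgroupOf]
      exact ⟨h, g.2⟩
    have hmem : ∀ t : T, t ∈ MulAction.stabilizer T ((g : Γ) : Γ ⧸ N) ↔
        g.1⁻¹ * t.1.1 * g.1 ∈ dihedral y ⊓ Γ := by
      intro t
      rw [MulAction.mem_stabilizer_iff]
      change (((t.1 * g : Γ)) : Γ ⧸ N) = _ ↔ _
      rw [eq_comm, QuotientGroup.eq, Subgroup.mem_subgroupOf, ← mul_assoc]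
      rfl
    let K : Subgroup SL(2, F) :=
      ((MulAction.stabilizer T ((g : Γ) : Γ ⧸ N)).map T.subtype).map Γ.subtype
    have hKmem : ∀ t : SL(2, F), t ∈ K ↔ t ∈ torus y ∧ g.1⁻¹ * t * g.1 ∈ dihedral y ⊓ Γ := by
      intro t
      constructor
      · rintro ⟨_, ⟨t, ht, rfl⟩, rfl⟩
        exact ⟨t.2, (hmem t).1 ht⟩
      · rintro ⟨h1, h2⟩
        exact ⟨⟨t, hT h1⟩, ⟨⟨⟨t, hT h1⟩, h1⟩, (hmem _).2 h2, rfl⟩, rfl⟩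
    have hKcard : Nat.card K = Nat.card (MulAction.stabilizer T ((g : Γ) : Γ ⧸ N)) := by
      rw [Subgroup.card_map_of_injective Γ.subtype_injective,
        Subgroup.card_map_of_injective T.subtype_injective]
    rw [← hKcard]
    refine card_stabilizer_coset_dvd hy hg K (fun t ht ↦ (hKmem t).1 ht) fun t ht ↦
      (hKmem t).2 ⟨center_le_torus y ht, ?_⟩
    have : g.1⁻¹ * t * g.1 = t := by
      rw [Subgroup.mem_center_iff.1 ht]; group
    rw [this]
    exact hle (center_le_torus y ht)
  refine ⟨fun h ↦ ?_, fun h h' ↦ ?_, fun h ↦ ?_⟩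
  · simpa using card_dvd_of_stabilizers _ hfix 1 fun x hx ↦ by rw [(hstab x hx).1 h]
  · refine card_dvd_of_stabilizers _ hfix 2 fun x hx ↦ ?_
    rcases (hstab x hx).2 h with e | e
    · rw [e]
    · exact absurd h' e.2
  · refine card_dvd_of_stabilizers _ hfix 4 fun x hx ↦ ?_
    rcases (hstab x hx).2 h with e | e
    · rw [e]; decide
    · rw [e.1]

/-- A subgroup of order prime to the characteristic that contains a nonsplit torus normalises it. -/
lemma le_dihedral_of_card_upperGroup_eq_one (hy : Nonsplit (tr y)) (hT : torus y ≤ Γ)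
    (h : numOrbits Γ = 1) (hx : Nat.card (upperGroup Γ) = 1)
    (hq : Even (Fintype.card F) ∨ 9 ≤ Fintype.card F) : Γ ≤ dihedral y := by
  classical
  have hM := card_stabilizer_eq Γ
  rw [hx, one_mul] at hM
  have hcard := card_eq_of_numOrbits_eq_one h
  rw [hM] at hcard
  have hdvd := card_range_dvd (Γ := Γ)
  obtain ⟨d1, d2, d3⟩ := card_torus_dvd hy hT
  have hN := Subgroup.card_mul_index ((dihedral y ⊓ Γ).subgroupOf Γ)
  rw [Nat.card_congr (Subgroup.subgroupOfEquivOfLe inf_le_right).toEquiv,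
    Nat.card_eq_fintype_card (α := Γ), hcard] at hN
  set m := Nat.card (eigenvalueHom Γ).range
  set c := ((dihedral y ⊓ Γ).subgroupOf Γ).index with hc
  set q := Fintype.card F
  have hq2 : 2 ≤ q := Fintype.one_lt_card
  suffices c = 1 by
    rw [hc, Subgroup.index_eq_one, Subgroup.subgroupOf_eq_top] at this
    exact this.trans inf_le_left
  have hm : m ≤ q - 1 := Nat.le_of_dvd (by omega) hdvd
  have hm1 : 1 ≤ m := Nat.card_pos
  obtain ⟨l, hl⟩ := hdvd
  by_cases hev : Even q
  · have hd := d1 (numScalars_eq_one_iff.2 (neg_one_eq_one_iff_even.2 hev))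
    have hcm : c ≤ m := by
      rcases card_dihedral_inf_le hy hT with e | e
      · rw [e.1] at hN
        exact (Nat.eq_of_mul_eq_mul_left (by omega) hN).le
      · rw [e, mul_comm 2, mul_assoc] at hN
        have := Nat.eq_of_mul_eq_mul_left (by omega) hN
        omega
    have hc1 : 1 ≤ c := by
      rcases Nat.eq_zero_or_pos c with h0 | h0
      · rw [h0, mul_zero] at hN
        have : 0 < (q + 1) * m := Nat.mul_pos (by omega) (by omega)
        omega
      · exact h0
    have := Nat.eq_zero_of_dvd_of_lt hd (by omega)
    omega
  · have hq9 := hq.resolve_left hev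
    have hd := numScalars_eq_two_of_odd (F := F) (Nat.not_even_iff_odd.1 hev)
    rcases card_dihedral_inf_le hy hT with e | e
    · rw [e.1] at hN
      have hcm := Nat.eq_of_mul_eq_mul_left (by omega : 0 < q + 1) hN
      -- Since c = m ≤ q - 1, the multiple 2(c - 1) of q + 1 is 0 or q + 1.
      obtain ⟨k, hk⟩ := d2 hd e.2
      rw [hcm] at hk ⊢
      have hk2 : k < 2 := by
        by_contra hk2
        have : (q + 1) * 2 ≤ (q + 1) * k := Nat.mul_le_mul_left _ (by omega)
        omega
      interval_cases k
      · omega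
      -- Together with m ∣ q - 1 this is possible only for q = 5, the case of A₄ in PSL(2,5).
      · have h4 : 2 * m = q + 3 := by omega
        have : 2 * (q - 1) = (q + 3) * l := by rw [hl, ← h4]; ring
        rcases l with _ | _ | l
        · omega
        · omega
        · have := Nat.mul_le_mul_left (q + 3) (by omega : 2 ≤ l + 1 + 1)
          omega
    · rw [e, mul_comm 2, mul_assoc] at hN
      have hcm := Nat.eq_of_mul_eq_mul_left (by omega : 0 < q + 1) hN
      obtain ⟨k, hk⟩ := d3 hd
      have hk2 : k < 2 := by
        by_contra hk2
        have : (q + 1) * 2 ≤ (q + 1) * k := Nat.mul_le_mul_left _ (by omega)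
        omega
      interval_cases k
      · omega
      -- Together with m ∣ q - 1 this is possible only for q = 7, the case of S₄ in PSL(2,7).
      · have h4 : 2 * m = q + 5 := by omega
        have : 2 * (q - 1) = (q + 5) * l := by rw [hl, ← h4]; ring
        rcases l with _ | _ | l
        · omega
        · omega
        · have := Nat.mul_le_mul_left (q + 5) (by omega : 2 ≤ l + 1 + 1)
          omega

lemma eq_top_of_card_upperGroup (hy : Nonsplit (tr y)) (hyΓ : y ∈ Γ)
    (h : Nat.card (upperGroup Γ) = Fintype.card F) : Γ = ⊤ := by
  have : upperGroup Γ = ⊤ := by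
    refine AddSubgroup.eq_top_of_card_eq _ ?_
    rw [h, Nat.card_eq_fintype_card]
  exact eq_top_of_upper (fun b ↦ (this ▸ AddSubgroup.mem_top b : b ∈ upperGroup Γ)) hyΓ
    hy.entry_10_ne_zero

/-- The alternatives for a subgroup containing a nonsplit torus. -/
lemma overgroup_alternatives (hy : Nonsplit (tr y)) (hT : torus y ≤ Γ)
    (hq : Even (Fintype.card F) ∨ 9 ≤ Fintype.card F) :
    Γ ≤ dihedral y ∨ Γ = ⊤ ∨ (Fintype.card F = 9 ∧ numOrbits Γ = 1 ∧
      Nat.card (upperGroup Γ) = 3) := by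
  classical
  by_cases h1 : numOrbits Γ = 1
  swap
  · exact .inl (le_dihedral_of_numOrbits_ne_one hy hT h1)
  by_cases hx : Nat.card (upperGroup Γ) = 1
  · exact .inl (le_dihedral_of_card_upperGroup_eq_one hy hT h1 hx hq)
  have hx0 : 0 < Nat.card (upperGroup Γ) := Nat.card_pos
  have hx1 : 1 < Nat.card (upperGroup Γ) := by omega
  by_cases hxq : Nat.card (upperGroup Γ) = Fintype.card F
  · exact .inr (.inl (eq_top_of_card_upperGroup hy (hT (self_mem_torus y)) hxq))
  have hI := counting_inequality hy hT h1
  have hm := card_range_le hx1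
  have hdvd := card_upperGroup_dvd (Γ := Γ)
  have hbur := burnside ((center_le_torus y).trans hT)
  have hu := le_numUnipotent ((center_le_torus y).trans hT) h1
  have hcard := card_eq_of_numOrbits_eq_one h1
  rw [card_stabilizer_eq] at hcard
  rw [h1, one_mul] at hbur
  have hle := le_dihedral_of_numNonsplit_le hy hT
  set x := Nat.card (upperGroup Γ)
  set m := Nat.card (eigenvalueHom Γ).range
  set q := Fintype.card F
  obtain ⟨k, hk⟩ := hdvd
  have hq2 : 2 ≤ q := Fintype.one_lt_card
  by_cases hev : Even q
  · left
    have hd := numScalars_eq_one_iff.2 (neg_one_eq_one_iff_even.2 hev)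
    rw [hd] at hm hbur hu hle
    have hk2 : 2 ≤ k := by
      rcases k with _ | _ | k
      · omega
      · omega
      · omega
    -- With x < q and m ≤ x - 1 the counting inequality leaves only x = 2, m = 1. Then |Γ| = 2(q +
    -- 1), and Burnside's identity allows no more than q fixed-point-free elements.
    obtain ⟨z, hz⟩ : ∃ z, x = z + 2 := ⟨x - 2, by omega⟩
    have hm' : m ≤ z + 1 := by omega
    have hz0 : z = 0 := by
      by_contra hz0
      rw [hz, show z + 2 - 1 = z + 1 by omega] at hI
      have e1 : (z + 2) * m ≤ (z + 2) * (z + 1) := Nat.mul_le_mul_left _ hm'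
      have e2 : (q + 1) * (z + 1) + 1 ≤ (z + 2) * (z + 1) + q := by omega
      have e3 : q * z ≤ z * (z + 2) := by nlinarith
      have e4 : q ≤ z + 2 := Nat.le_of_mul_le_mul_left (by linarith) (Nat.pos_of_ne_zero hz0)
      nlinarith
    subst hz0
    rw [hz] at hcard hu
    have hm1 : m = 1 := le_antisymm hm' Nat.card_pos
    rw [hm1] at hcard
    exact hle (by omega)
  · have hq9 := hq.resolve_left hev
    have hd := numScalars_eq_two_of_odd (F := F) (Nat.not_even_iff_odd.1 hev)
    rw [hd] at hm
    have hodd : Odd q := Nat.not_even_iff_odd.1 hev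
    have hkodd : Odd k := by rw [hk] at hodd; exact (Nat.odd_mul.1 hodd).2
    have hxodd : Odd x := by rw [hk] at hodd; exact (Nat.odd_mul.1 hodd).1
    have hk3 : 3 ≤ k := by
      rcases hkodd with ⟨j, hj⟩
      rcases j with _ | j
      · exfalso; apply hxq; rw [hk, hj]; ring
      · omega
    have hx3 : 3 ≤ x := by rcases hxodd with ⟨j, hj⟩; omega
    -- With 3x ≤ q and m ≤ 2(x - 1) the counting inequality leaves only q = 9, x = 3, the case of A₅
    -- in PSL(2,9).
    obtain ⟨z, hz⟩ : ∃ z, x = z + 3 := ⟨x - 3, by omega⟩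
    have e1 : x * m ≤ x * (2 * (x - 1)) := Nat.mul_le_mul_left _ hm
    rw [hz, show z + 3 - 1 = z + 2 by omega] at e1 hI
    have e2 : (q + 1) * (z + 2) + 1 ≤ (z + 3) * (2 * (z + 2)) + q := by omega
    have e3 : 3 * (z + 3) ≤ q := by rw [hk, hz]; nlinarith
    have hq9' : q ≤ 9 := by
      by_contra hq10
      obtain ⟨w, hw⟩ : ∃ w, q = 3 * (z + 3) + w := ⟨q - 3 * (z + 3), by omega⟩
      rw [hw] at e2 hq10
      nlinarith [Nat.zero_le (w * z)]
    have hq9'' : q = 9 := by omega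
    refine .inr (.inr ⟨hq9'', h1, ?_⟩)
    omega

/-- A proper subgroup that contains a nonsplit torus normalises it. -/
theorem le_dihedral_or_eq_top (hy : Nonsplit (tr y)) (hT : torus y ≤ Γ)
    (hq : Even (Fintype.card F) ∨ 11 ≤ Fintype.card F) : Γ ≤ dihedral y ∨ Γ = ⊤ := by
  rcases overgroup_alternatives hy hT (hq.imp_right (by omega)) with h | h | h
  · exact .inl h
  · exact .inr h
  · exfalso
    rcases hq with hq | hq
    · rw [h.1] at hq; exact absurd hq (by decide)
    · omega

end overgroups

end SL2

namespace SL2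

open Matrix Matrix.SpecialLinearGroup OnePoint

/-! ### Subgroups containing a split torus -/

section split

variable {F : Type*} [Field F] [Fintype F] [DecidableEq F] {Γ : Subgroup SL(2, F)}

lemma isSquare_mul_of_not_isSquare {a b : F} (ha : ¬ IsSquare a) (hb : ¬ IsSquare b) :
    IsSquare (a * b) := by
  have hF : ringChar F ≠ 2 := fun h ↦ ha (FiniteField.isSquare_of_char_two h a)
  have ha0 : a ≠ 0 := by rintro rfl; exact ha (IsSquare.zero)
  have hb0 : b ≠ 0 := by rintro rfl; exact hb (IsSquare.zero)
  rw [← quadraticChar_one_iff_isSquare (mul_ne_zero ha0 hb0), map_mul,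
    quadraticChar_neg_one_iff_not_isSquare.2 ha, quadraticChar_neg_one_iff_not_isSquare.2 hb]
  norm_num

lemma exists_ne_zero_sq_notMem (L : Finset F) (hL : 2 * L.card + 1 < Fintype.card F) :
    ∃ s : F, s ≠ 0 ∧ s ^ 2 ∉ L := by
  have hroots : ∀ w : F, (Finset.univ.filter fun s : F ↦ s ^ 2 = w).card ≤ 2 := by
    intro w
    rcases Finset.eq_empty_or_nonempty (Finset.univ.filter fun s : F ↦ s ^ 2 = w) with h | ⟨r, hr⟩
    · rw [h]; simp
    · refine (Finset.card_le_card (t := {r, -r}) fun s hs ↦ ?_).trans Finset.card_le_two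
      simp only [Finset.mem_filter, Finset.mem_univ, true_and, Finset.mem_insert,
        Finset.mem_singleton] at *
      exact sq_eq_sq_iff_eq_or_eq_neg.1 (hs.trans hr.symm)
  have hcard : (insert 0 (L.biUnion fun w ↦ Finset.univ.filter fun s : F ↦ s ^ 2 = w)).card <
      (Finset.univ : Finset F).card := by
    refine (Finset.card_insert_le _ _).trans_lt ?_
    have := Finset.card_biUnion_le_card_mul L
      (fun w ↦ Finset.univ.filter fun s : F ↦ s ^ 2 = w) 2 fun w _ ↦ hroots w
    rw [Finset.card_univ]
    omega
  obtain ⟨s, -, hs⟩ := Finset.exists_mem_notMem_of_card_lt_card hcard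
  simp only [Finset.mem_insert, Finset.mem_biUnion, Finset.mem_filter, Finset.mem_univ, true_and,
    not_or, not_exists, not_and] at hs
  exact ⟨s, hs.1, fun h ↦ hs.2 _ h rfl⟩

lemma exists_sq_add_sq (hF : Odd (Fintype.card F)) (c : F) : ∃ s t : F, s ^ 2 + t ^ 2 = c := by
  obtain ⟨s, t, h⟩ := FiniteField.exists_root_sum_quadratic (R := F) (f := Polynomial.X ^ 2)
    (g := Polynomial.X ^ 2 - Polynomial.C c) (Polynomial.degree_X_pow 2)
    (Polynomial.degree_X_pow_sub_C (by norm_num) c) (Nat.odd_iff.1 hF)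
  refine ⟨s, t, ?_⟩
  simp at h
  linear_combination h

/-- Conjugation by diagonal matrices multiplies b by arbitrary nonzero squares, and every element of
a finite field of odd order is a sum of two squares. -/
lemma forall_upper_mem_of_diag (hF : Odd (Fintype.card F))
    (hdiag : ∀ s hs, diag s hs ∈ Γ) {b : F} (hb : b ≠ 0) (hbΓ : upper b ∈ Γ) (c : F) :
    upper c ∈ Γ := by
  have hsq : ∀ s : F, upper (s ^ 2 * b) ∈ Γ := by
    intro s
    by_cases hs : s = 0
    · rw [hs]
      have : upper ((0 : F) ^ 2 * b) = 1 := by apply ext_entries <;> simp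
      rw [this]; exact Γ.one_mem
    · have : upper (s ^ 2 * b) = diag s hs * upper b * (diag s hs)⁻¹ := by
        apply ext_entries <;> simp [hs]
        ring
      rw [this]
      exact Γ.mul_mem (Γ.mul_mem (hdiag s hs) hbΓ) (Γ.inv_mem (hdiag s hs))
  obtain ⟨s, t, h⟩ := exists_sq_add_sq hF (c / b)
  have : c = s ^ 2 * b + t ^ 2 * b := by
    rw [← add_mul, h]; field_simp
  rw [this, ← upper_mul]
  exact Γ.mul_mem (hsq s) (hsq t)

/-- A split torus and an involution that neither fixes nor interchanges its fixed points generate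
`SL(2, F)`. -/
theorem eq_top_of_diag_of_tr_eq_zero (hF : Fintype.card F % 4 = 3) (hF' : 19 ≤ Fintype.card F)
    (hdiag : ∀ s hs, diag s hs ∈ Γ) {x : SL(2, F)} (hx : x ∈ Γ) (hx0 : tr x = 0)
    (hx1 : x 0 0 ≠ 0) : Γ = ⊤ := by
  have hodd : Odd (Fintype.card F) := Nat.odd_iff.2 (by omega)
  have hd := det_eq x
  have hx11 : x 1 1 = -x 0 0 := by simp only [tr] at hx0; linear_combination hx0
  set a := x 0 0 with ha
  set b := x 0 1 with hb
  set c := x 1 0 with hc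
  have hbc : b * c = -(a ^ 2 + 1) := by rw [hx11] at hd; linear_combination -hd
  have ha1 : a ^ 2 + 1 ≠ 0 := by
    intro h
    have : IsSquare (-1 : F) := ⟨a, by linear_combination -h⟩
    rw [FiniteField.isSquare_neg_one_iff] at this
    exact this hF
  have hc0 : c ≠ 0 := by
    rintro h; rw [h, mul_zero] at hbc; exact ha1 (by linear_combination hbc)
  -- Either a unipotent element produces all of them, or the stabiliser of ∞ in Γ is just the
  -- diagonal group. The second case is refuted by too many points in the orbit of ∞.
  by_cases hU : ∃ u : F, u ≠ 0 ∧ upper u ∈ Γ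
  · obtain ⟨u, hu, hu'⟩ := hU
    exact eq_top_of_upper (forall_upper_mem_of_diag hodd hdiag hu hu') hx (by rwa [← hc])
  exfalso
  push Not at hU
  have hborel : ∀ g ∈ Γ, g 1 0 = 0 → g 0 1 = 0 := by
    intro g hg h10
    have hdg := det_eq g
    rw [h10] at hdg
    have h00 : g 0 0 ≠ 0 := by intro h; rw [h] at hdg; simp at hdg
    by_contra h01
    refine hU (g 0 0 * g 0 1) (mul_ne_zero h00 h01) ?_
    have : upper (g 0 0 * g 0 1) = g * (diag (g 0 0) h00)⁻¹ := by
      apply ext_entries <;> simp [h10, h00]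
      · ring
      · linear_combination -hdg
    rw [this]
    exact Γ.mul_mem hg (Γ.inv_mem (hdiag _ _))
  -- elements moving `∞` into the same orbit of the torus
  have same : ∀ g ∈ Γ, ∀ h ∈ Γ, ∀ r : F, r ≠ 0 → g 0 0 * h 1 0 = r ^ 2 * (g 1 0 * h 0 0) →
      g 0 0 * g 1 1 = h 0 0 * h 1 1 := by
    intro g hg h hh r hr e
    -- The hypothesis says g∞ = r² · h∞, so k fixes ∞ and is diagonal. Consequently the product of
    -- the diagonal entries is an invariant of the torus orbit.
    set k := g⁻¹ * diag r hr * h with hk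
    have hkΓ : k ∈ Γ := Γ.mul_mem (Γ.mul_mem (Γ.inv_mem hg) (hdiag r hr)) hh
    have hk10 : k 1 0 = 0 := by
      simp [hk]; field_simp; linear_combination e
    have hk01 := hborel k hkΓ hk10
    have hkd := det_eq k
    rw [hk10, hk01] at hkd
    have hgk : g * k = diag r hr * h := by rw [hk]; group
    have e0 : (g * k) 0 0 = (diag r hr * h) 0 0 := by rw [hgk]
    have e1 : (g * k) 1 1 = (diag r hr * h) 1 1 := by rw [hgk]
    simp [hk10, hk01] at e0 e1
    have e2 : (g 0 0 * k 0 0) * (g 1 1 * k 1 1) = (r * h 0 0) * (r⁻¹ * h 1 1) := by rw [e0, e1]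
    have e3 : r * r⁻¹ = 1 := mul_inv_cancel₀ hr
    linear_combination e2 - g 0 0 * g 1 1 * hkd + h 0 0 * h 1 1 * e3
  -- conjugates of torus elements
  have hconj : ∀ s : F, ∃ g : s ≠ 0 → SL(2, F), ∀ hs : s ≠ 0, g hs ∈ Γ ∧
      g hs 0 0 * s = -(a ^ 2 * s ^ 2) + (a ^ 2 + 1) ∧ g hs 1 0 * s = -(a * c * (s ^ 2 - 1)) ∧
      g hs 0 0 * g hs 1 1 * s ^ 2 = s ^ 2 + a ^ 2 * (a ^ 2 + 1) * (s ^ 2 - 1) ^ 2 * (-1) := by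
    intro s
    refine ⟨fun hs ↦ x * diag s hs * x⁻¹, fun hs ↦ ?_⟩
    have e0 : (x * diag s hs * x⁻¹) 0 0 * s = -(a ^ 2 * s ^ 2) + (a ^ 2 + 1) := by
      simp [hx11, ← hb, ← hc]; field_simp; linear_combination -hbc
    have e1 : (x * diag s hs * x⁻¹) 1 1 * s = (a ^ 2 + 1) * s ^ 2 - a ^ 2 := by
      simp [hx11, ← hb, ← hc]; field_simp; linear_combination -s ^ 2 * hbc
    refine ⟨Γ.mul_mem (Γ.mul_mem hx (hdiag s hs)) (Γ.inv_mem hx), e0, ?_, ?_⟩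
    · change (x * diag s hs * x⁻¹) 1 0 * s = _
      simp [hx11, ← hc]; field_simp; ring
    · change (x * diag s hs * x⁻¹) 0 0 * (x * diag s hs * x⁻¹) 1 1 * s ^ 2 = _
      linear_combination (x * diag s hs * x⁻¹) 1 1 * s * e0 +
        (-(a ^ 2 * s ^ 2) + (a ^ 2 + 1)) * e1
  choose g hg using hconj
  -- Excluding 1 and (a² + 1)/a² keeps x·diag(s)·x⁻¹ from mapping ∞ to ∞ or 0; the other exclusions
  -- make the three invariants distinct. The longest list has six values, which needs 13 < q.
  obtain ⟨s₁, h1, h1'⟩ := exists_ne_zero_sq_notMem ({1, (a ^ 2 + 1) / a ^ 2} : Finset F) (by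
    have := Finset.card_le_two (a := (1 : F)) (b := (a ^ 2 + 1) / a ^ 2); omega)
  obtain ⟨s₂, h2, h2'⟩ := exists_ne_zero_sq_notMem
    ({1, (a ^ 2 + 1) / a ^ 2, s₁ ^ 2, (s₁ ^ 2)⁻¹} : Finset F) (by
      have := Finset.card_le_four (a := (1 : F)) (b := (a ^ 2 + 1) / a ^ 2) (c := s₁ ^ 2)
        (d := (s₁ ^ 2)⁻¹); omega)
  obtain ⟨s₃, h3, h3'⟩ := exists_ne_zero_sq_notMem
    ({1, (a ^ 2 + 1) / a ^ 2, s₁ ^ 2, (s₁ ^ 2)⁻¹, s₂ ^ 2, (s₂ ^ 2)⁻¹} : Finset F) (by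
      have := Finset.card_le_six (a := (1 : F)) (b := (a ^ 2 + 1) / a ^ 2) (c := s₁ ^ 2)
        (d := (s₁ ^ 2)⁻¹) (e := s₂ ^ 2) (f := (s₂ ^ 2)⁻¹); omega)
  simp only [Finset.mem_insert, Finset.mem_singleton, not_or] at h1' h2' h3'
  have ne0 : ∀ s (hs : s ≠ 0), s ^ 2 ≠ 1 → s ^ 2 ≠ (a ^ 2 + 1) / a ^ 2 →
      g s hs 0 0 ≠ 0 ∧ g s hs 1 0 ≠ 0 := by
    intro s hs hs1 hs2
    obtain ⟨-, e1, e2, -⟩ := hg s hs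
    constructor
    · intro h
      rw [h, zero_mul] at e1
      exact hs2 (by field_simp; linear_combination e1)
    · intro h
      rw [h, zero_mul] at e2
      have : a * c * (s ^ 2 - 1) = 0 := by linear_combination e2
      exact (mul_ne_zero (mul_ne_zero hx1 hc0) (sub_ne_zero.2 hs1)) this
  -- Points in one square class would share the invariant 1 - a²(a² + 1)(s - s⁻¹)², which forces t²
  -- = s² or t² = s⁻².
  have pair : ∀ s (hs : s ≠ 0) t (ht : t ≠ 0), s ^ 2 ≠ 1 → s ^ 2 ≠ (a ^ 2 + 1) / a ^ 2 →
      t ^ 2 ≠ 1 → t ^ 2 ≠ (a ^ 2 + 1) / a ^ 2 → t ^ 2 ≠ s ^ 2 → t ^ 2 ≠ (s ^ 2)⁻¹ →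
      ¬ IsSquare ((g s hs 0 0 / g s hs 1 0) / (g t ht 0 0 / g t ht 1 0)) := by
    rintro s hs t ht hs1 hs2 ht1 ht2 hst hst' ⟨r, hr⟩
    obtain ⟨n1, n2⟩ := ne0 s hs hs1 hs2
    obtain ⟨n3, n4⟩ := ne0 t ht ht1 ht2
    have hr0 : r ≠ 0 := by
      rintro rfl
      rw [mul_zero] at hr
      exact (div_ne_zero (div_ne_zero n1 n2) (div_ne_zero n3 n4)) hr
    have e := same _ (hg s hs).1 _ (hg t ht).1 r hr0 (by
      field_simp at hr; linear_combination hr)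
    have e1 := (hg s hs).2.2.2
    have e2 := (hg t ht).2.2.2
    rw [e] at e1
    have e3 : a ^ 2 * (a ^ 2 + 1) * ((t ^ 2 - s ^ 2) * (s ^ 2 * t ^ 2 - 1)) = 0 := by
      linear_combination s ^ 2 * e2 - t ^ 2 * e1
    have e4 := (mul_eq_zero.1 e3).resolve_left (mul_ne_zero (pow_ne_zero 2 hx1) ha1)
    rcases mul_eq_zero.1 e4 with h | h
    · exact hst (sub_eq_zero.1 h)
    · exact hst' (by field_simp; linear_combination h)
  have p12 := pair s₁ h1 s₂ h2 h1'.1 h1'.2 h2'.1 h2'.2.1 h2'.2.2.1 h2'.2.2.2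
  have p23 := pair s₂ h2 s₃ h3 h2'.1 h2'.2.1 h3'.1 h3'.2.1 h3'.2.2.2.2.1 h3'.2.2.2.2.2
  -- There are three points but only two square classes: the product of the two nonsquare ratios is
  -- the ratio for s₁ and s₃, and it is a square.
  refine pair s₁ h1 s₃ h3 h1'.1 h1'.2 h3'.1 h3'.2.1 h3'.2.2.1 h3'.2.2.2.1 ?_
  have := isSquare_mul_of_not_isSquare p12 p23
  obtain ⟨n3, n4⟩ := ne0 s₂ h2 h2'.1 h2'.2.1
  rwa [div_mul_div_cancel₀ (div_ne_zero n3 n4)] at this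

end split

end SL2

namespace SL2

open Matrix Matrix.SpecialLinearGroup OnePoint

/-! ### Generators of nonsplit tori -/

section classes

variable {F : Type*} [Field F] [Fintype F] [DecidableEq F]

/-- `y` generates a nonsplit torus. -/
def IsTorusGenerator (y : SL(2, F)) : Prop := Nonsplit (tr y) ∧ torus y ≤ Subgroup.zpowers y

/-- A polynomial x² - τx + 1 with a root c has τ = c + c⁻¹, and this takes at most q - 1 values. -/
lemma exists_nonsplit : ∃ τ : F, Nonsplit τ := by
  have h : ((Finset.univ.erase (0 : F)).image fun c ↦ c + c⁻¹).card < Fintype.card F := by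
    refine Finset.card_image_le.trans_lt ?_
    rw [Finset.card_erase_of_mem (Finset.mem_univ _), Finset.card_univ]
    have := Fintype.card_pos (α := F)
    omega
  obtain ⟨τ, hτ⟩ := Finset.exists_mem_notMem_of_card_lt_card
    (s := (Finset.univ.erase (0 : F)).image fun c ↦ c + c⁻¹) (t := Finset.univ)
    (by rwa [Finset.card_univ])
  refine ⟨τ, fun c hc ↦ hτ.2 ?_⟩
  have hc0 : c ≠ 0 := by rintro rfl; simp at hc
  refine Finset.mem_image.2 ⟨c, by simp [hc0], ?_⟩
  field_simp
  linear_combination hc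

lemma IsTorusGenerator.conj {y : SL(2, F)} (h : IsTorusGenerator y) (g : SL(2, F)) :
    IsTorusGenerator (g * y * g⁻¹) := by
  refine ⟨by rw [tr_conj]; exact h.1, fun t ht ↦ ?_⟩
  rw [mem_torus] at ht
  have h1 : g⁻¹ * t * g ∈ torus y := by
    rw [mem_torus, Commute, SemiconjBy]
    have := ht.eq
    calc g⁻¹ * t * g * y = g⁻¹ * (t * (g * y * g⁻¹)) * g := by group
      _ = g⁻¹ * ((g * y * g⁻¹) * t) * g := by rw [this]
      _ = _ := by group
  obtain ⟨n, hn⟩ := Subgroup.mem_zpowers_iff.1 (h.2 h1)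
  refine Subgroup.mem_zpowers_iff.2 ⟨n, ?_⟩
  rw [conj_zpow, hn]; group

lemma IsTorusGenerator.of_tr_eq {y z : SL(2, F)} (h : IsTorusGenerator y) (hz : tr z = tr y) :
    IsTorusGenerator z := by
  obtain ⟨g, rfl⟩ := exists_conj_of_tr_eq h.1 hz
  exact h.conj g

lemma exists_mem_torus_generator {y : SL(2, F)} (hy : Nonsplit (tr y)) :
    ∃ z ∈ torus y, IsTorusGenerator z := by
  have := isCyclic_torus hy
  obtain ⟨⟨z, hz⟩, hgen⟩ := IsCyclic.exists_generator (α := torus y)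
  have hgen' : torus y ≤ Subgroup.zpowers z := fun t ht ↦ by
    obtain ⟨n, hn⟩ := Subgroup.mem_zpowers_iff.1 (hgen ⟨t, ht⟩)
    exact Subgroup.mem_zpowers_iff.2 ⟨n, congrArg Subtype.val hn⟩
  have hs : ¬ IsScalar z := by
    intro hs
    have h1 : torus y ≤ Subgroup.center SL(2, F) :=
      hgen'.trans (Subgroup.zpowers_le.2 (mem_center_iff_isScalar.2 hs))
    exact hy.not_isScalar (mem_center_iff_isScalar.1 (h1 (self_mem_torus y)))
  refine ⟨z, hz, nonsplit_of_mem_torus hy hz hs, ?_⟩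
  rwa [torus_eq_of_mem hy hz hs]

lemma exists_isTorusGenerator : ∃ y : SL(2, F), IsTorusGenerator y := by
  obtain ⟨τ, hτ⟩ := exists_nonsplit (F := F)
  have : tr (companion τ) = τ := by simp [tr, companion]
  obtain ⟨z, -, hz⟩ := exists_mem_torus_generator (y := companion τ) (by rwa [this])
  exact ⟨z, hz⟩

/-- Trace 0 gives y² = -1, so y has order dividing 4, while the torus has q + 1 ≥ 5 elements. -/
lemma IsTorusGenerator.tr_ne_zero {y : SL(2, F)} (h : IsTorusGenerator y)
    (hF : 4 ≤ Fintype.card F) : tr y ≠ 0 := by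
  intro h0
  have h2 : y ^ 4 = 1 := by
    have hd := det_eq y
    have h11 : y 1 1 = -y 0 0 := by simp only [tr] at h0; linear_combination h0
    rw [h11] at hd
    have : y ^ 2 = -1 := by
      rw [pow_two]
      apply ext_entries <;> simp [h11]
      · linear_combination -hd
      · ring
      · ring
      · linear_combination -hd
    rw [show 4 = 2 * 2 from rfl, pow_mul, this]
    simp
  have h3 := card_torus h.1
  have h4 : Nat.card (torus y) ≤ Nat.card (Subgroup.zpowers y) :=
    Nat.card_mono (Set.toFinite _) h.2
  rw [Nat.card_zpowers, h3, Nat.card_eq_fintype_card] at h4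
  have := Nat.le_of_dvd (by norm_num) (orderOf_dvd_of_pow_eq_one h2)
  omega

lemma Generates.notMem_dihedral {x y : SL(2, F)} (h : Generates x y) (hF : 3 ≤ Fintype.card F)
    (hy : ¬ IsScalar y) : x ∉ dihedral y := fun hx ↦
  not_generates_of_mem (center_le_dihedral y) hx (torus_le_dihedral y (self_mem_torus y))
    (dihedral_ne_top (by rwa [Nat.card_eq_fintype_card]) hy) h

/-- An element generating a nonsplit torus generates the group together with everything outside
the normaliser of the torus. -/
lemma IsTorusGenerator.generates {x y : SL(2, F)} (hy : IsTorusGenerator y)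
    (hq : Even (Fintype.card F) ∨ 11 ≤ Fintype.card F) (hx : x ∉ dihedral y) : Generates x y := by
  refine generates_iff.2 fun Γ _ hxΓ hyΓ ↦ ?_
  rcases le_dihedral_or_eq_top hy.1 (hy.2.trans (Subgroup.zpowers_le.2 hyΓ)) hq with h | h
  · exact absurd (h hxΓ) hx
  · exact h

/-! ### Elements of given trace -/

/-- The elements of trace `τ`. -/
noncomputable def traceClass (τ : F) : Finset SL(2, F) := by
  classical exact Finset.univ.filter fun A ↦ tr A = τ

@[simp] lemma mem_traceClass {τ : F} {A : SL(2, F)} : A ∈ traceClass τ ↔ tr A = τ := by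
  simp [traceClass]

/-- Given the trace, the matrices with A 0 1 ≠ 0 are parametrised by A 0 0 and A 0 1. In a nonsplit
class there are no others. -/
lemma le_card_traceClass (τ : F) :
    Fintype.card F * (Fintype.card F - 1) ≤ (traceClass τ).card := by
  have h : ((Finset.univ : Finset F) ×ˢ (Finset.univ : Finset Fˣ)).card =
      Fintype.card F * (Fintype.card F - 1) := by
    rw [Finset.card_product, Finset.card_univ, Finset.card_univ, Fintype.card_units]
  rw [← h]
  refine Finset.card_le_card_of_injOn
    (fun p ↦ ofEntries p.1 p.2 ((p.1 * (τ - p.1) - 1) / p.2) (τ - p.1) (by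
      have := p.2.ne_zero; field_simp; ring)) ?_ ?_
  · rintro ⟨a, b⟩ -
    simp [tr]
  · rintro ⟨a, b⟩ - ⟨a', b'⟩ - e
    have h0 := congrArg (fun A : SL(2, F) ↦ A 0 0) e
    have h1 := congrArg (fun A : SL(2, F) ↦ A 0 1) e
    simp only [ofEntries_00, ofEntries_01] at h0 h1
    rw [Prod.mk_inj]
    exact ⟨h0, Units.ext h1⟩

lemma card_traceClass {τ : F} (hτ : Nonsplit τ) :
    (traceClass τ).card = Fintype.card F * (Fintype.card F - 1) := by
  refine le_antisymm ?_ (le_card_traceClass τ)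
  rw [← Fintype.card_units, ← Finset.card_univ, ← Finset.card_univ, ← Finset.card_product]
  have h01 : ∀ A : SL(2, F), tr A = τ → A 0 1 ≠ 0 := by
    rintro A rfl h
    have hd := det_eq A
    rw [h] at hd
    exact hτ (A 0 0) (by simp only [tr]; linear_combination -hd)
  refine Finset.card_le_card_of_injOn
    (fun A ↦ (A 0 0, if h : A 0 1 = 0 then 1 else Units.mk0 (A 0 1) h)) (by simp) ?_
  intro A hA B hB e
  rw [Finset.mem_coe, mem_traceClass] at hA hB
  have hA1 := h01 A hA
  have hB1 := h01 B hB
  simp only [hA1, hB1, dite_false, Prod.mk_inj] at e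
  obtain ⟨e0, e1⟩ := e
  have e1 : A 0 1 = B 0 1 := by simpa using congrArg Units.val e1
  have e3 : A 1 1 = B 1 1 := by simp only [tr] at hA hB; linear_combination hA - hB - e0
  have hdA := det_eq A
  have hdB := det_eq B
  refine ext_entries e0 e1 (mul_left_cancel₀ hA1 ?_) e3
  rw [← e0, ← e3, ← e1] at hdB
  linear_combination hdB - hdA

/-- The elements of trace `τ` that are orthogonal to `x` for the trace form. -/
noncomputable def orthClass (τ : F) (x : SL(2, F)) : Finset SL(2, F) := by
  classical exact (traceClass τ).filter fun A ↦ tr (x * A) = 0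

lemma mem_orthClass {τ : F} {x A : SL(2, F)} :
    A ∈ orthClass τ x ↔ tr A = τ ∧ tr (x * A) = 0 := by simp [orthClass]

lemma card_orthClass_conj (τ : F) (x g : SL(2, F)) :
    (orthClass τ (g * x * g⁻¹)).card = (orthClass τ x).card := by
  refine (Finset.card_bij (fun A _ ↦ g * A * g⁻¹) ?_ ?_ ?_).symm
  · intro A hA
    rw [mem_orthClass] at hA ⊢
    rw [show g * x * g⁻¹ * (g * A * g⁻¹) = g * (x * A) * g⁻¹ by group, tr_conj, tr_conj]
    exact hA
  · intro A _ B _ e; simpa using e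
  · intro B hB
    rw [mem_orthClass] at hB
    refine ⟨g⁻¹ * B * g, ?_, by group⟩
    rw [mem_orthClass, ← tr_conj g (g⁻¹ * B * g), ← tr_conj g (x * (g⁻¹ * B * g)),
      show g * (x * (g⁻¹ * B * g)) * g⁻¹ = g * x * g⁻¹ * B by group,
      show g * (g⁻¹ * B * g) * g⁻¹ = B by group]
    exact hB

/-- A matrix with an eigenvector is conjugate to a triangular one. -/
lemma exists_conj_triangular {x : SL(2, F)} (h : ¬ Nonsplit (tr x)) :
    ∃ g : SL(2, F), (g * x * g⁻¹) 1 0 = 0 := by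
  obtain ⟨p, hp⟩ := exists_smul_eq_of_not_nonsplit h
  obtain ⟨g, rfl⟩ := exists_smul_infty_eq p
  refine ⟨g⁻¹, smul_infty_eq_self_iff.1 ?_⟩
  rw [inv_inv, mul_smul, mul_smul, hp, inv_smul_smul]

lemma exists_conj_diag {x : SL(2, F)} {s : F} (hs : s ≠ 0) (hs1 : s ^ 2 ≠ 1)
    (hx : tr x = s + s⁻¹) : ∃ g : SL(2, F), g * x * g⁻¹ = diag s hs := by
  have hns : ¬ Nonsplit (tr x) := fun h ↦ h s (by rw [hx]; field_simp; ring)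
  obtain ⟨g, hg⟩ := exists_conj_triangular hns
  have key : ∀ (A : SL(2, F)), A 1 0 = 0 → A 0 0 ^ 2 ≠ 1 → ∀ h0, 
      ∃ g : SL(2, F), g * A * g⁻¹ = diag (A 0 0) h0 := by
    intro A h10 h00 h0
    have hd := det_eq A
    rw [h10] at hd
    have h11 : A 1 1 = (A 0 0)⁻¹ := by field_simp; linear_combination hd
    have h2 : A 0 0 - A 1 1 ≠ 0 := by
      rw [h11]; intro h; apply h00; field_simp at h; linear_combination h
    refine ⟨upper (A 0 1 / (A 0 0 - A 1 1)), ?_⟩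
    apply ext_entries <;> simp [h10]
    · field_simp; ring
    · exact h11
  set A := g * x * g⁻¹ with hA
  have htA : tr A = s + s⁻¹ := by rw [hA, tr_conj, hx]
  have hd := det_eq A
  rw [hg] at hd
  have hA0 : A 0 0 ≠ 0 := by intro h; rw [h] at hd; simp at hd
  have hroot : (A 0 0 - s) * (A 0 0 - s⁻¹) = 0 := by
    have : s * s⁻¹ = 1 := mul_inv_cancel₀ hs
    simp only [tr] at htA
    linear_combination A 0 0 * htA - hd + this
  rcases mul_eq_zero.1 hroot with h | h
  · have h : A 0 0 = s := sub_eq_zero.1 h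
    obtain ⟨k, hk⟩ := key A hg (h ▸ hs1) hA0
    refine ⟨k * g, ?_⟩
    rw [show k * g * x * (k * g)⁻¹ = k * A * k⁻¹ by rw [hA]; group, hk]
    apply ext_entries <;> simp [h]
  · have h : A 0 0 = s⁻¹ := sub_eq_zero.1 h
    obtain ⟨k, hk⟩ := key A hg (by
      rw [h, inv_pow]; exact fun e ↦ hs1 (inv_eq_one.1 e)) hA0
    -- The diagonal form has its eigenvalues in the wrong order; the Weyl element exchanges them.
    refine ⟨ofEntries 0 (-1) 1 0 (by ring) * k * g, ?_⟩
    rw [show ofEntries 0 (-1) 1 0 (by ring) * k * g * x * (ofEntries 0 (-1) 1 0 (by ring) * k * g)⁻¹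
      = ofEntries 0 (-1) 1 0 (by ring) * (k * A * k⁻¹) * (ofEntries 0 (-1) 1 0 (by ring))⁻¹ by
        rw [hA]; group, hk]
    apply ext_entries <;> simp [h]

/-- With x = diag(i, -i) the two trace conditions make both diagonal entries τ/2, and the rest is
determined by the nonzero entry A 0 1. -/
lemma card_orthClass_of_split {τ : F} (hτ : Nonsplit τ) (h2 : (2 : F) ≠ 0) {x : SL(2, F)}
    (hx : tr x = 0) {i : F} (hi : i ^ 2 = -1) :
    (orthClass τ x).card ≤ Fintype.card F - 1 := by
  have hi0 : i ≠ 0 := by rintro rfl; simp at hi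
  obtain ⟨g, hg⟩ := exists_conj_diag (x := x) hi0 (by
    rw [hi]; intro h; apply h2; linear_combination -h)
    (by rw [hx]; field_simp; linear_combination -hi)
  rw [← card_orthClass_conj τ x g, hg, ← Fintype.card_units, ← Finset.card_univ]
  have hi' : i⁻¹ = -i := by field_simp; linear_combination hi
  have key : ∀ A ∈ orthClass τ (diag i hi0), A 0 0 = τ / 2 ∧ A 1 1 = τ / 2 ∧ A 0 1 ≠ 0 := by
    intro A hA
    rw [mem_orthClass] at hA
    obtain ⟨h1, h3⟩ := hA
    simp [tr, hi'] at h1 h3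
    have h4 : A 0 0 - A 1 1 = 0 := by
      refine (mul_eq_zero.1 (?_ : i * (A 0 0 - A 1 1) = 0)).resolve_left hi0
      linear_combination h3
    have h0 : A 0 0 = τ / 2 := by field_simp; linear_combination h1 + h4
    refine ⟨h0, by field_simp; linear_combination h1 - h4, fun h ↦ ?_⟩
    have hd := det_eq A
    rw [h] at hd
    exact hτ (A 0 0) (by rw [← h1]; linear_combination -hd)
  refine Finset.card_le_card_of_injOn
    (fun A ↦ if h : A 0 1 = 0 then 1 else Units.mk0 (A 0 1) h) (by simp) ?_
  intro A hA B hB e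
  obtain ⟨a0, a1, a2⟩ := key A hA
  obtain ⟨b0, b1, b2⟩ := key B hB
  simp only [a2, b2, dite_false] at e
  have e1 : A 0 1 = B 0 1 := by simpa using congrArg Units.val e
  have hdA := det_eq A
  have hdB := det_eq B
  refine ext_entries (a0.trans b0.symm) e1 (mul_left_cancel₀ a2 ?_) (a1.trans b1.symm)
  rw [b0, b1, ← e1] at hdB
  rw [a0, a1] at hdA
  linear_combination hdB - hdA

/-- In characteristic 2 such an x is conjugate to a unitriangular matrix. Orthogonality then fixes
the lower left entry of B at a nonzero value, so B is determined by B 0 0. -/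
lemma card_orthClass_of_even {τ : F} (h2 : (2 : F) = 0) (hτ : τ ≠ 0) {x : SL(2, F)}
    (hxs : ¬ IsScalar x) (hx : tr x = 0) : (orthClass τ x).card ≤ Fintype.card F := by
  obtain ⟨g, hg⟩ := exists_conj_triangular (x := x) (fun h ↦ h 1 (by
    rw [hx]; linear_combination h2))
  rw [← card_orthClass_conj τ x g, ← Finset.card_univ]
  set A := g * x * g⁻¹ with hA
  have htA : tr A = 0 := by rw [hA, tr_conj, hx]
  have hdA := det_eq A
  simp only [tr] at htA
  have h00 : A 0 0 = 1 := by
    have : (A 0 0 - 1) ^ 2 = 0 := by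
      linear_combination A 0 0 * htA - hdA - A 0 1 * hg - A 0 0 * h2
    exact sub_eq_zero.1 (pow_eq_zero_iff two_ne_zero |>.1 this)
  have h11 : A 1 1 = 1 := by linear_combination htA - h00 - h2
  have h01 : A 0 1 ≠ 0 := by
    intro h
    have h1 : A = 1 := by apply ext_entries <;> simp [h, h00, h11, hg]
    rw [hA, conj_eq_one_iff] at h1
    exact hxs (isScalar_iff_eq.2 (.inl h1))
  have key : ∀ B ∈ orthClass τ A, B 0 0 + B 1 1 = τ ∧ B 1 0 = -τ / A 0 1 := by
    intro B hB
    rw [mem_orthClass] at hB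
    obtain ⟨h1, h3⟩ := hB
    simp [tr, h00, h11, hg] at h1 h3
    exact ⟨h1, by field_simp; linear_combination h3 - h1⟩
  refine Finset.card_le_card_of_injOn (fun B ↦ B 0 0) (by simp) ?_
  intro B hB C hC (e : B 0 0 = C 0 0)
  obtain ⟨b1, b2⟩ := key B hB
  obtain ⟨c1, c2⟩ := key C hC
  have e3 : B 1 1 = C 1 1 := by linear_combination b1 - c1 - e
  have e2 : B 1 0 = C 1 0 := b2.trans c2.symm
  have hB0 : B 1 0 ≠ 0 := by rw [b2]; exact div_ne_zero (neg_ne_zero.2 hτ) h01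
  refine ext_entries e (mul_right_cancel₀ hB0 ?_) e2 e3
  have hdB := det_eq B
  have hdC := det_eq C
  rw [← e, ← e3, ← e2] at hdC
  linear_combination hdC - hdB

/-- For nonsplit `x` of trace zero, an orthogonality class is a conic. -/
lemma card_orthClass_of_nonsplit {τ : F} (h2 : (2 : F) ≠ 0) (h0 : Nonsplit (0 : F)) {x : SL(2, F)}
    (hx : tr x = 0) : (orthClass τ x).card ≤ Fintype.card F + 1 := by
  obtain ⟨g, hg⟩ := exists_conj_companion (A := x) (hx ▸ h0)
  rw [← hg, card_orthClass_conj, hx]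
  refine le_trans ?_ (card_conic_le h0 (r := τ ^ 2 / 4 - 1))
  have h4 : (4 : F) ≠ 0 := by
    rw [show (4 : F) = 2 * 2 by norm_num]; exact mul_ne_zero h2 h2
  refine Finset.card_le_card_of_injOn (fun A ↦ (A 0 0 - τ / 2, A 0 1)) ?_ ?_
  · intro A hA
    rw [Finset.mem_coe, mem_orthClass] at hA
    have hd := det_eq A
    simp [tr] at hA
    rw [Finset.mem_coe, mem_conic]
    have e : τ / 2 * 2 = τ := div_mul_cancel₀ τ h2
    have e4 : τ ^ 2 / 4 = (τ / 2) ^ 2 := by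
      rw [div_pow, show (2 : F) ^ 2 = 4 by norm_num]
    simp only [e4]
    linear_combination -hd + A 0 0 * hA.1 + A 0 1 * hA.2 - A 0 0 * e
  · intro A hA B hB e
    rw [Finset.mem_coe, mem_orthClass] at hA hB
    simp [tr] at hA hB
    rw [Prod.mk_inj] at e
    obtain ⟨e0, e1⟩ := e
    have e0 : A 0 0 = B 0 0 := by linear_combination e0
    exact ext_entries e0 e1 (by linear_combination e1 - hA.2 + hB.2) 
      (by linear_combination hA.1 - hB.1 - e0)

/-- The elements of trace `τ` whose normaliser contains `x`. -/
noncomputable def badClass (τ : F) (x : SL(2, F)) : Finset SL(2, F) := by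
  classical exact (traceClass τ).filter fun A ↦ x ∈ dihedral A

lemma mem_badClass {τ : F} {x A : SL(2, F)} :
    A ∈ badClass τ x ↔ tr A = τ ∧ x ∈ dihedral A := by simp [badClass]

/-- The elements of trace `τ` commuting with `x`. -/
noncomputable def commClass (τ : F) (x : SL(2, F)) : Finset SL(2, F) := by
  classical exact (traceClass τ).filter fun A ↦ Commute x A

lemma mem_commClass {τ : F} {x A : SL(2, F)} :
    A ∈ commClass τ x ↔ tr A = τ ∧ Commute x A := by simp [commClass]

/-- All such A lie in the torus that contains x, where the trace determines an element up to
inversion. -/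
lemma card_commClass {τ : F} (hτ : Nonsplit τ) {x : SL(2, F)} (hx : ¬ IsScalar x) :
    (commClass τ x).card ≤ 2 := by
  classical
  rcases (commClass τ x).eq_empty_or_nonempty with h | ⟨A, hA⟩
  · simp [h]
  · refine (Finset.card_le_card (t := {A, A⁻¹}) ?_).trans Finset.card_le_two
    rw [mem_commClass] at hA
    obtain ⟨rfl, hA⟩ := hA
    intro B hB
    rw [mem_commClass] at hB
    have h1 := torus_eq_of_mem hτ (mem_torus.2 hA) hx
    have h2 : B ∈ torus A := by rw [← h1, mem_torus]; exact hB.2.symm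
    simpa using tr_eq_of_mem_torus hτ h2 hB.1

lemma commClass_eq_empty {τ : F} (hτ : Nonsplit τ) {x : SL(2, F)} (hx : ¬ IsScalar x)
    (hx' : ¬ Nonsplit (tr x)) : commClass τ x = ∅ := by
  refine Finset.eq_empty_of_forall_notMem fun A hA ↦ ?_
  rw [mem_commClass] at hA
  obtain ⟨rfl, hA⟩ := hA
  exact hx' (nonsplit_of_mem_torus hτ (mem_torus.2 hA) hx)

lemma card_badClass_le {τ : F} (hτ : Nonsplit τ) {x : SL(2, F)} :
    (badClass τ x).card ≤ (commClass τ x).card + (orthClass τ x).card := by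
  classical
  refine (Finset.card_le_card (t := commClass τ x ∪ orthClass τ x) ?_).trans
    (Finset.card_union_le _ _)
  intro A hA
  rw [mem_badClass] at hA
  obtain ⟨rfl, hA⟩ := hA
  rw [mem_dihedral_iff_tr hτ.not_isScalar] at hA
  rw [Finset.mem_union, mem_commClass, mem_orthClass]
  exact hA.imp (⟨rfl, ·⟩) (⟨rfl, ·.2⟩)

lemma card_badClass_of_tr_ne_zero {τ : F} (hτ : Nonsplit τ) {x : SL(2, F)} (hx : ¬ IsScalar x)
    (hx0 : tr x ≠ 0) : (badClass τ x).card ≤ 2 := by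
  refine (Finset.card_le_card fun A hA ↦ ?_).trans (card_commClass hτ hx)
  rw [mem_badClass] at hA
  obtain ⟨rfl, hA⟩ := hA
  rw [mem_dihedral_iff_tr hτ.not_isScalar] at hA
  rw [mem_commClass]
  exact ⟨rfl, hA.resolve_right fun h ↦ hx0 h.1⟩

/-- If few elements of a class are excluded, then some element of it avoids all normalisers. -/
lemma exists_forall_notMem_dihedral {τ : F} {X : Finset SL(2, F)}
    (h : ∑ x ∈ X, (badClass τ x).card < Fintype.card F * (Fintype.card F - 1)) :
    ∃ A, tr A = τ ∧ ∀ x ∈ X, x ∉ dihedral A := by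
  classical
  have h1 : (X.biUnion (badClass τ)).card < (traceClass τ).card :=
    (Finset.card_biUnion_le.trans_lt h).trans_le (le_card_traceClass τ)
  obtain ⟨A, hA, hA'⟩ := Finset.exists_mem_notMem_of_card_lt_card h1
  rw [mem_traceClass] at hA
  refine ⟨A, hA, fun x hx hxA ↦ hA' (Finset.mem_biUnion.2 ⟨x, hx, mem_badClass.2 ⟨hA, hxA⟩⟩)⟩

end classes

end SL2

namespace SL2

open Matrix Matrix.SpecialLinearGroup OnePoint

/-! ### Spread in terms of matrices -/

section spread

variable {F : Type*} [Field F]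

lemma exists_lift (x : PSL(2, F)) : ∃ A : SL(2, F), (A : PSL(2, F)) = x := QuotientGroup.mk_surjective x

/-- Finitely many nonscalar matrices have a common mate satisfying `P`. -/
def HasMate (P : SL(2, F) → Prop) (k : ℕ) : Prop :=
  ∀ X : Finset SL(2, F), X.card ≤ k → (∀ x ∈ X, ¬ IsScalar x) → ∃ y, P y ∧ ∀ x ∈ X, Generates x y

lemma HasMate.mono {P Q : SL(2, F) → Prop} {k l : ℕ} (h : HasMate P k) (hPQ : ∀ y, P y → Q y)
    (hl : l ≤ k) : HasMate Q l := fun X hX hs ↦ by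
  obtain ⟨y, hy, h'⟩ := h X (hX.trans hl) hs
  exact ⟨y, hPQ y hy, h'⟩

/-- Translation between tuples in the quotient and sets of matrices. -/
lemma forall_tuple_iff (P : SL(2, F) → Prop) (Q : PSL(2, F) → Prop)
    (hP : ∀ y, Q y ↔ ∃ A : SL(2, F), P A ∧ (A : PSL(2, F)) = y) (k : ℕ) :
    (∀ x : Fin k → PSL(2, F), (∀ i, x i ≠ 1) →
      ∃ y, Q y ∧ ∀ i, Subgroup.closure {x i, y} = ⊤) ↔ HasMate P k := by
  classical
  constructor
  · intro h X hX hs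
    rcases X.eq_empty_or_nonempty with rfl | ⟨a, ha⟩
    -- An empty X still requires some y with `P y`; for k > 0 it is supplied by a constant tuple of
    -- a nontrivial element.
    · rcases Nat.eq_zero_or_pos k with rfl | hk
      · obtain ⟨y, hy, -⟩ := h (fun i ↦ i.elim0) (fun i ↦ i.elim0)
        obtain ⟨A, hA, -⟩ := (hP y).1 hy
        exact ⟨A, hA, by simp⟩
      · by_cases hne : ∃ x : PSL(2, F), x ≠ 1
        · obtain ⟨x, hx⟩ := hne
          obtain ⟨y, hy, -⟩ := h (fun _ ↦ x) (fun _ ↦ hx)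
          obtain ⟨A, hA, -⟩ := (hP y).1 hy
          exact ⟨A, hA, by simp⟩
        · push Not at hne
          exfalso
          have h1 := hne ((upper 1 : SL(2, F)) : PSL(2, F))
          rw [mk_eq_one_iff] at h1
          exact one_ne_zero h1.1
    -- The set is enumerated and padded with repetitions of a to length k.
    · let f : Fin k → SL(2, F) := fun i ↦
        if hi : i.1 < X.card then (X.equivFin.symm ⟨i.1, hi⟩).1 else a
      have hf : ∀ i, f i ∈ X := by
        intro i; simp only [f]; split_ifs
        · exact Subtype.property _
        · exact ha
      obtain ⟨y, hy, h'⟩ := h (fun i ↦ (f i : PSL(2, F))) (fun i ↦ by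
        rw [Ne, mk_eq_one_iff]; exact hs _ (hf i))
      obtain ⟨A, hA, rfl⟩ := (hP y).1 hy
      refine ⟨A, hA, fun x hx ↦ ?_⟩
      have hlt := (X.equivFin ⟨x, hx⟩).2
      have := h' ⟨(X.equivFin ⟨x, hx⟩).1, hlt.trans_le hX⟩
      unfold Generates
      simpa [f, hlt] using this
  · intro h x hx
    choose f hf using fun i ↦ exists_lift (x i)
    obtain ⟨y, hy, h'⟩ := h (Finset.univ.image f) (Finset.card_image_le.trans (by simp)) (by
      intro a ha
      obtain ⟨i, -, rfl⟩ := Finset.mem_image.1 ha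
      rw [← mk_eq_one_iff, hf]; exact hx i)
    refine ⟨y, (hP y).2 ⟨y, hy, rfl⟩, fun i ↦ ?_⟩
    have := h' (f i) (Finset.mem_image_of_mem _ (Finset.mem_univ i))
    unfold Generates at this
    rwa [hf] at this

lemma hasSpread_iff {k : ℕ} : HasSpread PSL(2, F) k ↔ HasMate (fun _ : SL(2, F) ↦ True) k := by
  rw [← forall_tuple_iff (fun _ ↦ True) (fun _ ↦ True)
    (fun y ↦ by simpa using exists_lift y)]
  simp [HasSpread]

/-- The elements conjugate to `s`. -/
def ConjTo (s y : SL(2, F)) : Prop := ∃ g, g * s * g⁻¹ = y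

lemma isConj_mk_iff {s : SL(2, F)} {y : PSL(2, F)} :
    IsConj (s : PSL(2, F)) y ↔ ∃ A, ConjTo s A ∧ (A : PSL(2, F)) = y := by
  rw [isConj_iff]
  constructor
  · rintro ⟨c, rfl⟩
    obtain ⟨g, rfl⟩ := exists_lift c
    exact ⟨g * s * g⁻¹, ⟨g, rfl⟩, rfl⟩
  · rintro ⟨A, ⟨g, rfl⟩, rfl⟩
    exact ⟨(g : PSL(2, F)), rfl⟩

lemma hasUniformSpread_iff {k : ℕ} :
    HasUniformSpread PSL(2, F) k ↔ ∃ s : SL(2, F), HasMate (ConjTo s) k := by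
  have key : ∀ s : SL(2, F), (∀ x : Fin k → PSL(2, F), (∀ i, x i ≠ 1) →
      ∃ y ∈ (ConjClasses.mk (s : PSL(2, F))).carrier, ∀ i, Subgroup.closure {x i, y} = ⊤) ↔
      HasMate (ConjTo s) k := fun s ↦
    forall_tuple_iff (ConjTo s) (fun y ↦ y ∈ (ConjClasses.mk (s : PSL(2, F))).carrier)
      (fun y ↦ by rw [ConjClasses.mem_carrier_iff_mk_eq, ConjClasses.mk_eq_mk_iff_isConj,
        isConj_comm, isConj_mk_iff]) k
  constructor
  · rintro ⟨C, hC⟩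
    obtain ⟨c, rfl⟩ := ConjClasses.mk_surjective C
    obtain ⟨s, rfl⟩ := exists_lift c
    exact ⟨s, (key s).1 hC⟩
  · rintro ⟨s, hs⟩
    exact ⟨_, (key s).2 hs⟩

lemma HasSpread.mono {k l : ℕ} (h : HasSpread PSL(2, F) k) (hl : l ≤ k) :
    HasSpread PSL(2, F) l := by
  rw [hasSpread_iff] at *; exact h.mono (fun _ h ↦ h) hl

lemma HasUniformSpread.hasSpread {k : ℕ} (h : HasUniformSpread PSL(2, F) k) :
    HasSpread PSL(2, F) k := by
  rw [hasUniformSpread_iff] at h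
  rw [hasSpread_iff]
  obtain ⟨s, h⟩ := h
  exact h.mono (fun _ _ ↦ trivial) le_rfl

variable [Finite F]

/-- The list of all nontrivial elements has no mate. -/
lemma not_hasSpread_card : ¬ HasSpread PSL(2, F) (Nat.card SL(2, F)) := by
  classical
  have := Fintype.ofFinite F
  have := Fintype.ofFinite SL(2, F)
  intro h
  rw [hasSpread_iff] at h
  obtain ⟨y, -, hy⟩ := h (Finset.univ.filter fun x ↦ ¬ IsScalar x) (by
    rw [Nat.card_eq_fintype_card]; exact Finset.card_le_univ _) (by simp)
  have hcomm : ∀ x : SL(2, F), ¬ IsScalar x → Commute x y → False := fun x hx hxy ↦ by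
    have h1 := hy x (by simpa using hx)
    have h2 := generates_iff.1 h1 (torus x) (center_le_torus x) (self_mem_torus x)
      (mem_torus.2 hxy.symm)
    have : x ∈ Subgroup.center SL(2, F) := by
      rw [Subgroup.mem_center_iff]
      intro g
      exact (mem_torus.1 (h2 ▸ Subgroup.mem_top g : g ∈ torus x)).eq
    exact hx (mem_center_iff_isScalar.1 this)
  by_cases hys : IsScalar y
  · refine hcomm (upper 1) (fun h ↦ one_ne_zero h.1) ?_
    exact ((Subgroup.mem_center_iff.1 (mem_center_iff_isScalar.2 hys)) _)
  · exact hcomm y hys (Commute.refl y)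

lemma bddAbove_spread : BddAbove {k | HasSpread PSL(2, F) k} :=
  ⟨Nat.card SL(2, F), fun k hk ↦ by
    by_contra! h; exact not_hasSpread_card (HasSpread.mono hk h.le)⟩

lemma bddAbove_uniformSpread : BddAbove {k | HasUniformSpread PSL(2, F) k} :=
  bddAbove_spread.mono fun _ h ↦ HasUniformSpread.hasSpread h

lemma le_spread {k : ℕ} (h : HasSpread PSL(2, F) k) : k ≤ spread PSL(2, F) :=
  le_csSup bddAbove_spread h

lemma le_uniformSpread {k : ℕ} (h : HasUniformSpread PSL(2, F) k) :
    k ≤ uniformSpread PSL(2, F) := le_csSup bddAbove_uniformSpread h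

lemma spread_lt {k : ℕ} (h : ¬ HasSpread PSL(2, F) (k + 1)) : spread PSL(2, F) ≤ k :=
  csSup_le' fun l hl ↦ by
    by_contra! hlt; exact h (HasSpread.mono hl hlt)

lemma uniformSpread_le_spread : uniformSpread PSL(2, F) ≤ spread PSL(2, F) :=
  csSup_le' fun _ hl ↦ le_spread (HasUniformSpread.hasSpread hl)

end spread

/-! ### Spread via the class generating a nonsplit torus -/

section bounds

variable {F : Type*} [Field F] [Fintype F] [DecidableEq F]

/-- Mates for finite sets exist in the class of a torus generator when the exclusion sets are
small. -/
lemma IsTorusGenerator.exists_mate {s : SL(2, F)} (hs : IsTorusGenerator s)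
    (hq : Even (Fintype.card F) ∨ 11 ≤ Fintype.card F) {X : Finset SL(2, F)}
    (h : ∑ x ∈ X, (badClass (tr s) x).card < Fintype.card F * (Fintype.card F - 1)) :
    ∃ y, ConjTo s y ∧ ∀ x ∈ X, Generates x y := by
  obtain ⟨A, hA, h'⟩ := exists_forall_notMem_dihedral h
  exact ⟨A, exists_conj_of_tr_eq hs.1 hA, fun x hx ↦ (hs.of_tr_eq hA).generates hq (h' x hx)⟩

lemma IsTorusGenerator.hasMate {s : SL(2, F)} (hs : IsTorusGenerator s)
    (hq : Even (Fintype.card F) ∨ 11 ≤ Fintype.card F) {b k : ℕ}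
    (hb : ∀ x, ¬ IsScalar x → (badClass (tr s) x).card ≤ b)
    (h : k * b < Fintype.card F * (Fintype.card F - 1)) : HasMate (ConjTo s) k := by
  intro X hX hXs
  refine hs.exists_mate hq (lt_of_le_of_lt ?_ h)
  calc ∑ x ∈ X, (badClass (tr s) x).card ≤ ∑ x ∈ X, b :=
        Finset.sum_le_sum fun x hx ↦ hb x (hXs x hx)
    _ = X.card * b := by simp
    _ ≤ _ := Nat.mul_le_mul_right _ hX

lemma two_ne_zero_iff_odd : (2 : F) ≠ 0 ↔ Odd (Fintype.card F) := by
  rw [← Nat.not_even_iff_odd, ← neg_one_eq_one_iff_even, not_iff_not]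
  constructor <;> intro h
  · linear_combination -h
  · linear_combination -h

lemma exists_sq_eq_neg_one (hF : Fintype.card F % 4 = 1) : ∃ i : F, i ^ 2 = -1 := by
  have := (FiniteField.isSquare_neg_one_iff (F := F)).2 (by omega)
  obtain ⟨i, hi⟩ := this
  exact ⟨i, by rw [pow_two, hi]⟩

lemma nonsplit_zero (hF : Fintype.card F % 4 = 3) : Nonsplit (0 : F) := fun c hc ↦ by
  have := (FiniteField.isSquare_neg_one_iff (F := F)).1 ⟨c, by linear_combination -hc⟩
  omega

lemma not_nonsplit_zero (hF : Fintype.card F % 4 ≠ 3) : ¬ Nonsplit (0 : F) := fun h ↦ by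
  obtain ⟨i, hi⟩ := (FiniteField.isSquare_neg_one_iff (F := F)).2 hF
  exact h i (by linear_combination -hi)

/-! ### Spread for q ≡ 1 mod 4. -/

section one_mod_four

/-- Since -1 is a square, elements of trace 0 have eigenvectors and commute with nothing in a
nonsplit class; only the orthogonality class counts. -/
lemma card_badClass_of_one_mod_four (hF : Fintype.card F % 4 = 1) (hF' : 11 ≤ Fintype.card F)
    {τ : F} (hτ : Nonsplit τ) {x : SL(2, F)} (hx : ¬ IsScalar x) :
    (badClass τ x).card ≤ Fintype.card F - 1 := by
  by_cases hx0 : tr x = 0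
  · obtain ⟨i, hi⟩ := exists_sq_eq_neg_one hF
    have h2 := two_ne_zero_iff_odd.2 (Nat.odd_iff.2 (by omega) : Odd (Fintype.card F))
    refine (card_badClass_le hτ).trans ?_
    rw [commClass_eq_empty hτ hx (by rw [hx0]; exact not_nonsplit_zero (by omega)),
      Finset.card_empty, zero_add]
    exact card_orthClass_of_split hτ h2 hx0 hi
  · exact (card_badClass_of_tr_ne_zero hτ hx hx0).trans (by omega)

/-- A set of involutions without common mate. -/
lemma not_hasSpread_of_one_mod_four (hF : Fintype.card F % 4 = 1) :
    ¬ HasSpread PSL(2, F) (Fintype.card F) := by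
  obtain ⟨i, hi⟩ := exists_sq_eq_neg_one hF
  have hi0 : i ≠ 0 := by rintro rfl; simp at hi
  have h2 := two_ne_zero_iff_odd.2 (Nat.odd_iff.2 (by omega) : Odd (Fintype.card F))
  have hF3 : 3 ≤ Fintype.card F := by
    have := Fintype.one_lt_card (α := F); omega
  rw [hasSpread_iff]
  intro h
  classical
  -- This is the involution fixing ∞ and b.
  let f : F → SL(2, F) := fun b ↦ ofEntries i (-2 * i * b) 0 (-i) (by linear_combination -hi)
  have hf : ∀ b, ¬ IsScalar (f b) := by
    rintro b ⟨-, -, h3⟩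
    simp only [f, ofEntries_00, ofEntries_11] at h3
    exact (mul_ne_zero h2 hi0) (by linear_combination h3)
  obtain ⟨y, -, hy⟩ := h (Finset.univ.image f) (Finset.card_image_le.trans (by simp)) (by
    intro x hx
    obtain ⟨b, -, rfl⟩ := Finset.mem_image.1 hx
    exact hf b)
  replace hy : ∀ b, Generates (f b) y := fun b ↦ hy _ (Finset.mem_image_of_mem _ (Finset.mem_univ b))
  by_cases h10 : y 1 0 = 0
  · exact not_generates_of_smul_eq (smul_infty_eq_self_iff.2 rfl)
      (smul_infty_eq_self_iff.2 h10) (hy 0)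
  -- For this b the involution is orthogonal to y and hence inverts it.
  · set b := (y 0 0 - y 1 1) / (2 * y 1 0) with hb
    have hys : ¬ IsScalar y := fun h ↦ h10 h.2.1
    refine (hy b).notMem_dihedral hF3 hys ((mem_dihedral_iff_tr hys).2 (.inr ⟨?_, ?_⟩))
    · simp [tr, f]
    · simp only [tr, mul_00, mul_11, f, ofEntries_00, ofEntries_01, ofEntries_10, ofEntries_11]
      have : 2 * y 1 0 * b = y 0 0 - y 1 1 := by rw [hb]; field_simp
      linear_combination -i * this

theorem spread_of_one_mod_four (hF : Fintype.card F % 4 = 1) (hF' : 11 ≤ Fintype.card F) :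
    spread PSL(2, F) = Fintype.card F - 1 ∧ uniformSpread PSL(2, F) = Fintype.card F - 1 := by
  obtain ⟨s, hs⟩ := exists_isTorusGenerator (F := F)
  have h1 : HasUniformSpread PSL(2, F) (Fintype.card F - 1) :=
    hasUniformSpread_iff.2 ⟨s, hs.hasMate (.inr hF')
      (fun x hx ↦ card_badClass_of_one_mod_four hF hF' hs.1 hx)
      (Nat.mul_lt_mul_of_pos_right (by omega) (by omega))⟩
  have h2 : spread PSL(2, F) ≤ Fintype.card F - 1 := spread_lt (by
    rw [Nat.sub_add_cancel (by omega)]; exact not_hasSpread_of_one_mod_four hF)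
  have h3 := le_uniformSpread h1
  have h4 := uniformSpread_le_spread (F := F)
  omega

end one_mod_four

/-! ### Spread for q even. -/

section even

lemma card_badClass_of_even (hF : Even (Fintype.card F)) (hF' : 4 ≤ Fintype.card F)
    {s : SL(2, F)} (hs : IsTorusGenerator s) {x : SL(2, F)} (hx : ¬ IsScalar x) :
    (badClass (tr s) x).card ≤ Fintype.card F := by
  by_cases hx0 : tr x = 0
  · have h2 : (2 : F) = 0 := by
      by_contra h; exact (Nat.not_even_iff_odd.2 (two_ne_zero_iff_odd.1 h)) hF
    refine (card_badClass_le hs.1).trans ?_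
    rw [commClass_eq_empty hs.1 hx (by
      rw [hx0]; obtain ⟨k, hk⟩ := hF; exact not_nonsplit_zero (by omega)),
      Finset.card_empty, zero_add]
    exact card_orthClass_of_even h2 (hs.tr_ne_zero hF') hx hx0
  · exact (card_badClass_of_tr_ne_zero hs.1 hx hx0).trans (by omega)

lemma not_hasSpread_of_even (hF : Even (Fintype.card F)) (hF' : 4 ≤ Fintype.card F) :
    ¬ HasSpread PSL(2, F) (Fintype.card F - 1) := by
  have h2 : (2 : F) = 0 := by
    by_contra h; exact (Nat.not_even_iff_odd.2 (two_ne_zero_iff_odd.1 h)) hF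
  rw [hasSpread_iff]
  intro h
  classical
  -- The q - 1 involutions fixing ∞ have no common mate: y fixes ∞, or is an involution itself, or
  -- is inverted by one of them.
  obtain ⟨y, -, hy⟩ := h ((Finset.univ.erase (0 : F)).image upper) (Finset.card_image_le.trans (by
      rw [Finset.card_erase_of_mem (Finset.mem_univ _), Finset.card_univ])) (by
    intro x hx
    obtain ⟨b, hb, rfl⟩ := Finset.mem_image.1 hx
    exact fun h ↦ (Finset.mem_erase.1 hb).1 h.1)
  replace hy : ∀ b ≠ 0, Generates (upper b) y := fun b hb ↦
    hy _ (Finset.mem_image_of_mem _ (by simp [hb]))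
  by_cases h10 : y 1 0 = 0
  · exact not_generates_of_smul_eq (smul_infty_eq_self_iff.2 rfl)
      (smul_infty_eq_self_iff.2 h10) (hy 1 one_ne_zero)
  have hys : ¬ IsScalar y := fun h ↦ h10 h.2.1
  have htr : ∀ b : F, tr (upper b) = 0 := fun b ↦ by simp [tr]; linear_combination h2
  by_cases h0 : tr y = 0
  · -- two involutions: their product is inverted by both
    have hyy : tr (y * y) = 0 := by
      have hd := det_eq y
      simp only [tr, mul_00, mul_11] at h0 ⊢
      linear_combination (y 0 0 + y 1 1) * h0 - 2 * hd - h2 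
    have hprod : ¬ IsScalar (upper 1 * y) := by
      rintro ⟨-, h, -⟩
      simp at h; exact h10 h
    refine not_generates_of_mem (center_le_dihedral (upper 1 * y)) (A := upper 1) (B := y) ?_ ?_
      (dihedral_ne_top (by rw [Nat.card_eq_fintype_card]; omega) hprod) (hy 1 one_ne_zero)
    · refine .inr (inverts_of_tr (htr 1) ?_)
      rw [← mul_assoc, upper_mul]
      simp [tr] at h0 ⊢
      linear_combination h0 + y 1 0 * h2
    · refine .inr (inverts_of_tr h0 ?_)
      rw [← mul_assoc, mul_assoc, tr_mul_comm, mul_assoc]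
      simp only [tr, mul_00, mul_11, upper_00, upper_01, upper_10, upper_11, mul_10] at h0 hyy ⊢
      linear_combination hyy + y 1 0 * h0
  -- This b solves tr (`upper b` * y) = 0 in characteristic 2, and it is nonzero because tr y is.
  · set b := tr y / y 1 0 with hb
    have hb0 : b ≠ 0 := div_ne_zero h0 h10
    refine (hy b hb0).notMem_dihedral (by omega) hys ((mem_dihedral_iff_tr hys).2 (.inr ⟨htr b, ?_⟩))
    have : b * y 1 0 = y 0 0 + y 1 1 := by rw [hb, div_mul_cancel₀ _ h10, tr]
    simp [tr]
    linear_combination this + (y 0 0 + y 1 1) * h2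

theorem spread_of_even (hF : Even (Fintype.card F)) (hF' : 4 ≤ Fintype.card F) :
    spread PSL(2, F) = Fintype.card F - 2 ∧ uniformSpread PSL(2, F) = Fintype.card F - 2 := by
  obtain ⟨s, hs⟩ := exists_isTorusGenerator (F := F)
  have h1 : HasUniformSpread PSL(2, F) (Fintype.card F - 2) :=
    hasUniformSpread_iff.2 ⟨s, hs.hasMate (.inl hF)
      (fun x hx ↦ card_badClass_of_even hF hF' hs hx) (by
        rw [mul_comm]; exact Nat.mul_lt_mul_of_pos_left (by omega) (by omega))⟩
  have h2 : spread PSL(2, F) ≤ Fintype.card F - 2 := spread_lt (by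
    rw [show Fintype.card F - 2 + 1 = Fintype.card F - 1 by omega]
    exact not_hasSpread_of_even hF hF')
  have h3 := le_uniformSpread h1
  have h4 := uniformSpread_le_spread (F := F)
  omega

end even

end bounds

end SL2

/-! ### Lower bounds for q ≡ 3 mod 4. -/

namespace SL2

open Matrix Matrix.SpecialLinearGroup OnePoint

section three_mod_four

variable {F : Type*} [Field F] [Fintype F] [DecidableEq F]

lemma card_badClass_of_three_mod_four (hF : Fintype.card F % 4 = 3)
    {τ : F} (hτ : Nonsplit τ) {x : SL(2, F)} (hx : ¬ IsScalar x) :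
    (badClass τ x).card ≤ Fintype.card F + 3 := by
  by_cases hx0 : tr x = 0
  · have h2 := two_ne_zero_iff_odd.2 (Nat.odd_iff.2 (by omega) : Odd (Fintype.card F))
    have h1 := card_badClass_le hτ (x := x)
    have h3 := card_commClass hτ hx
    have h4 := card_orthClass_of_nonsplit (τ := τ) h2 (nonsplit_zero hF) hx0
    omega
  · exact (card_badClass_of_tr_ne_zero hτ hx hx0).trans (by omega)

lemma IsTorusGenerator.hasMate_of_three_mod_four (hF : Fintype.card F % 4 = 3)
    (hF' : 11 ≤ Fintype.card F) {s : SL(2, F)} (hs : IsTorusGenerator s) :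
    HasMate (ConjTo s) (Fintype.card F - 4) := by
  -- The union bound works because (q - 4)(q + 3) = q(q - 1) - 12.
  refine hs.hasMate (.inr hF') (fun x hx ↦ card_badClass_of_three_mod_four hF hs.1 hx) ?_
  obtain ⟨n, hn⟩ := Nat.exists_eq_add_of_le hF'
  rw [hn, show 11 + n - 4 = 7 + n by omega, show 11 + n - 1 = 10 + n by omega]
  nlinarith

lemma le_uniformSpread_of_three_mod_four (hF : Fintype.card F % 4 = 3)
    (hF' : 11 ≤ Fintype.card F) : Fintype.card F - 4 ≤ uniformSpread PSL(2, F) := by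
  obtain ⟨s, hs⟩ := exists_isTorusGenerator (F := F)
  exact le_uniformSpread (hasUniformSpread_iff.2 ⟨s, hs.hasMate_of_three_mod_four hF hF'⟩)

/-- A generator of a split torus and an involution in general position generate the group. -/
lemma generates_of_split (hF : Fintype.card F % 4 = 3) (hF' : 19 ≤ Fintype.card F) {s : Fˣ}
    (hs : ∀ t : Fˣ, t ∈ Subgroup.zpowers s) {x A : SL(2, F)} (hx : tr x = 0)
    (hA : tr A = s + (s : F)⁻¹) (hxA : tr (x * A) ≠ 0) : Generates x A := by
  have hs2 : (s : F) ^ 2 ≠ 1 := by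
    intro h
    have h1 : s ^ 2 = 1 := Units.ext (by simpa using h)
    have h2 := Nat.le_of_dvd (by norm_num) (orderOf_dvd_of_pow_eq_one h1)
    rw [orderOf_eq_card_of_forall_mem_zpowers hs, Nat.card_eq_fintype_card,
      Fintype.card_units] at h2
    omega
  obtain ⟨g, hg⟩ := exists_conj_diag s.ne_zero hs2 hA
  have key : Generates (g * x * g⁻¹) (diag s s.ne_zero) := by
    refine generates_iff.2 fun Γ _ hxΓ hsΓ ↦ ?_
    refine eq_top_of_diag_of_tr_eq_zero hF hF' (fun t ht ↦ ?_) hxΓ (by rw [tr_conj, hx]) ?_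
    · let Δ : Subgroup Fˣ :=
        { carrier := {u | diag (u : F) u.ne_zero ∈ Γ}
          one_mem' := by
            rw [Set.mem_ofPred_eq]
            convert Γ.one_mem using 1
            apply ext_entries <;> simp
          mul_mem' := fun {a b} ha hb ↦ by
            rw [Set.mem_ofPred_eq] at *
            convert Γ.mul_mem ha hb using 1
            apply ext_entries <;> simp [mul_comm]
          inv_mem' := fun {a} ha ↦ by
            rw [Set.mem_ofPred_eq] at *
            convert Γ.inv_mem ha using 1
            apply ext_entries <;> simp }
      exact (Subgroup.zpowers_le.2 (show s ∈ Δ from hsΓ) : _ ≤ Δ) (hs (Units.mk0 t ht))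
    · intro h
      have ht : tr (g * x * g⁻¹) = 0 := by rw [tr_conj, hx]
      apply hxA
      rw [← tr_conj g, show g * (x * A) * g⁻¹ = (g * x * g⁻¹) * (g * A * g⁻¹) by group, hg]
      generalize g * x * g⁻¹ = z at *
      simp only [tr, mul_00, mul_11, diag_00, diag_01, diag_10, diag_11] at ht ⊢
      linear_combination ((s : F) - (s : F)⁻¹) * h + (s : F)⁻¹ * ht
  have := key.conj g⁻¹
  rw [← hg] at this
  simpa [mul_assoc] using this

/-- If X consists of involutions, generators of a split torus serve as mates, with at most q + 1
exclusions per involution and (q - 3)(q + 1) < q(q - 1). Otherwise some member of X excludes at most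
two torus generators, and 2 + (q - 4)(q + 3) < q(q - 1). -/
lemma hasSpread_of_three_mod_four (hF : Fintype.card F % 4 = 3) (hF' : 19 ≤ Fintype.card F) :
    HasSpread PSL(2, F) (Fintype.card F - 3) := by
  classical
  have h2 := two_ne_zero_iff_odd.2 (Nat.odd_iff.2 (by omega) : Odd (Fintype.card F))
  rw [hasSpread_iff]
  intro X hX hXs
  obtain ⟨n, hn⟩ := Nat.exists_eq_add_of_le hF'
  by_cases h0 : ∀ x ∈ X, tr x = 0
  · obtain ⟨s, hs⟩ := IsCyclic.exists_generator (α := Fˣ)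
    have h1 : (X.biUnion (orthClass ((s : F) + (s : F)⁻¹))).card <
        (traceClass ((s : F) + (s : F)⁻¹)).card := by
      refine lt_of_lt_of_le ?_ (le_card_traceClass _)
      calc _ ≤ ∑ x ∈ X, (orthClass ((s : F) + (s : F)⁻¹) x).card := Finset.card_biUnion_le
        _ ≤ ∑ x ∈ X, (Fintype.card F + 1) := Finset.sum_le_sum fun x hx ↦
          card_orthClass_of_nonsplit h2 (nonsplit_zero hF) (h0 x hx)
        _ = X.card * (Fintype.card F + 1) := by simp
        _ ≤ (Fintype.card F - 3) * (Fintype.card F + 1) := Nat.mul_le_mul_right _ hX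
        _ < _ := by
          rw [hn, show 19 + n - 3 = 16 + n by omega, show 19 + n - 1 = 18 + n by omega]
          nlinarith
    obtain ⟨A, hA, hA'⟩ := Finset.exists_mem_notMem_of_card_lt_card h1
    rw [mem_traceClass] at hA
    refine ⟨A, trivial, fun x hx ↦ generates_of_split hF hF' hs (h0 x hx) hA fun h ↦ hA' ?_⟩
    exact Finset.mem_biUnion.2 ⟨x, hx, mem_orthClass.2 ⟨hA, h⟩⟩
  · push Not at h0
    obtain ⟨x, hx, hx0⟩ := h0
    obtain ⟨s, hs⟩ := exists_isTorusGenerator (F := F)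
    obtain ⟨y, -, hy⟩ := hs.exists_mate (X := X) (.inr (by omega)) (by
      rw [← Finset.add_sum_erase X _ hx]
      have h3 := card_badClass_of_tr_ne_zero hs.1 (hXs x hx) hx0
      have h4 : ∑ z ∈ X.erase x, (badClass (tr s) z).card ≤ (Fintype.card F - 4) *
          (Fintype.card F + 3) := by
        calc _ ≤ ∑ z ∈ X.erase x, (Fintype.card F + 3) := Finset.sum_le_sum fun z hz ↦
              card_badClass_of_three_mod_four hF hs.1 (hXs z (Finset.mem_of_mem_erase hz))
          _ = (X.card - 1) * (Fintype.card F + 3) := by simp [Finset.card_erase_of_mem hx]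
          _ ≤ _ := Nat.mul_le_mul_right _ (by omega)
      refine lt_of_le_of_lt (add_le_add h3 h4) ?_
      rw [hn, show 19 + n - 4 = 15 + n by omega, show 19 + n - 1 = 18 + n by omega]
      nlinarith)
    exact ⟨y, trivial, hy⟩

end three_mod_four

/-! ### Covering the projective line by fixed points -/

section cover

variable {F : Type*} [Field F] [Fintype F] [DecidableEq F]

lemma exists_sq_ne_one (hF : 4 ≤ Fintype.card F) : ∃ t : F, t ≠ 0 ∧ t ^ 2 ≠ 1 := by
  have : ({0, 1, -1} : Finset F).card < (Finset.univ : Finset F).card := by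
    rw [Finset.card_univ]; exact Finset.card_le_three.trans_lt hF
  obtain ⟨t, -, ht⟩ := Finset.exists_mem_notMem_of_card_lt_card this
  simp only [Finset.mem_insert, Finset.mem_singleton, not_or] at ht
  exact ⟨t, ht.1, fun h ↦ by
    rcases mul_eq_zero.1 (by linear_combination h : (t - 1) * (t + 1) = 0) with h | h
    · exact ht.2.1 (sub_eq_zero.1 h)
    · exact ht.2.2 (eq_neg_of_add_eq_zero_left h)⟩

lemma not_isScalar_conj {x : SL(2, F)} (h : ¬ IsScalar x) (g : SL(2, F)) :
    ¬ IsScalar (g * x * g⁻¹) := by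
  rw [← mem_center_iff_isScalar] at h ⊢
  exact fun h' ↦ h (by
    have := (inferInstance : (Subgroup.center SL(2, F)).Normal).conj_mem _ h' g⁻¹
    simpa [mul_assoc] using this)

lemma exists_fix_two (hF : 4 ≤ Fintype.card F) (p r : OnePoint F) :
    ∃ x : SL(2, F), ¬ IsScalar x ∧ x • p = p ∧ x • r = r := by
  obtain ⟨g, rfl⟩ := exists_smul_infty_eq p
  obtain ⟨t, ht0, ht⟩ := exists_sq_ne_one hF
  have key : ∀ r : OnePoint F, ∃ x : SL(2, F), ¬ IsScalar x ∧ x • (∞ : OnePoint F) = ∞ ∧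
      x • r = r := by
    intro r
    have hd : ¬ IsScalar (diag t ht0) := by
      rintro ⟨-, -, h⟩
      simp at h
      exact ht (by field_simp at h; linear_combination h)
    induction r using OnePoint.rec with
    | infty => exact ⟨diag t ht0, hd, smul_infty_eq_self_iff.2 rfl, smul_infty_eq_self_iff.2 rfl⟩
    | coe k =>
      refine ⟨upper k * diag t ht0 * (upper k)⁻¹, not_isScalar_conj hd _,
        smul_infty_eq_self_iff.2 (by simp), smul_coe_eq_self_iff.2 (by simp; ring)⟩
  obtain ⟨x, h1, h2, h3⟩ := key (g⁻¹ • r)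
  refine ⟨g * x * g⁻¹, not_isScalar_conj h1 g, ?_, ?_⟩
  · rw [mul_smul, mul_smul, inv_smul_smul, h2]
  · rw [mul_smul, mul_smul, h3, smul_inv_smul]

/-- Half as many elements as points suffice to fix every point. -/
lemma exists_cover (hF : 4 ≤ Fintype.card F) (n : ℕ) (hn : Fintype.card F + 1 ≤ 2 * n) :
    ∃ Y : Finset SL(2, F), Y.card ≤ n ∧ (∀ x ∈ Y, ¬ IsScalar x) ∧
      ∀ p : OnePoint F, ∃ x ∈ Y, x • p = p := by
  classical
  have hc : Fintype.card (OnePoint F) ≤ 2 * n := by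
    rw [← Nat.card_eq_fintype_card, card_onePoint, Nat.card_eq_fintype_card]; exact hn
  let e := Fintype.equivFin (OnePoint F)
  let f : ℕ → OnePoint F := fun i ↦ if h : i < Fintype.card (OnePoint F) then e.symm ⟨i, h⟩ else ∞
  choose x hx hx1 hx2 using fun i : ℕ ↦ exists_fix_two hF (f (2 * i)) (f (2 * i + 1))
  refine ⟨(Finset.range n).image x, Finset.card_image_le.trans (by simp), ?_, fun p ↦ ?_⟩
  · intro a ha
    obtain ⟨i, -, rfl⟩ := Finset.mem_image.1 ha
    exact hx i
  · have hp : f (e p) = p := by simp [f]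
    have hlt := (e p).2
    refine ⟨x ((e p).1 / 2), Finset.mem_image_of_mem _ (Finset.mem_range.2 (by omega)), ?_⟩
    rcases Nat.even_or_odd' (e p).1 with ⟨m, hm | hm⟩
    · have := hx1 m
      rw [← hm, hp] at this
      rwa [hm, Nat.mul_div_cancel_left _ two_pos]
    · have := hx2 m
      rw [← hm, hp] at this
      rwa [hm, show (2 * m + 1) / 2 = m by omega]

end cover

/-! ### The case of a prime field -/

section odd

variable {F : Type*} [Field F] [Fintype F] [DecidableEq F]

lemma Nonsplit.not_isSquare (h2 : (2 : F) ≠ 0) {τ : F} (h : Nonsplit τ) : ¬ IsSquare (τ ^ 2 - 4) := by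
  rintro ⟨r, hr⟩
  refine h ((τ + r) / 2) ?_
  field_simp
  linear_combination -hr

/-- Every nonsplit torus meets every nonsplit trace class. -/
lemma exists_mem_torus_tr_eq (h2 : (2 : F) ≠ 0) {y : SL(2, F)} (hy : Nonsplit (tr y)) {τ : F}
    (hτ : Nonsplit τ) : ∃ z ∈ torus y, tr z = τ := by
  have h1 := hy.not_isSquare h2
  have hne : tr y ^ 2 - 4 ≠ 0 := fun h ↦ h1 (by rw [h]; exact ⟨0, by simp⟩)
  -- Both discriminants are nonsquares, so their quotient is a square b². The element a + by has
  -- discriminant b² times that of y, and a is adjusted to give trace τ.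
  obtain ⟨b, hb⟩ := isSquare_mul_of_not_isSquare (hτ.not_isSquare h2)
    (b := (tr y ^ 2 - 4)⁻¹) (by rwa [isSquare_inv])
  have hb' : τ ^ 2 - 4 = b ^ 2 * (tr y ^ 2 - 4) := by
    field_simp at hb; linear_combination hb
  refine ⟨linComb y ((τ - b * tr y) / 2) b (by field_simp; linear_combination hb'),
    (mem_torus_iff hy.entry_10_ne_zero).2 ⟨_, _, _, rfl⟩, ?_⟩
  simp only [tr, linComb, ofEntries_00, ofEntries_11]
  field_simp
  ring

/-- A nonsplit mate may be replaced by one in a given class of torus generators. -/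
lemma IsTorusGenerator.exists_conjTo (h2 : (2 : F) ≠ 0) {s : SL(2, F)} (hs : IsTorusGenerator s)
    {y : SL(2, F)} (hy : Nonsplit (tr y)) : ∃ z, ConjTo s z ∧ ∀ x, Generates x y → Generates x z := by
  obtain ⟨z, hz, hzs⟩ := exists_mem_torus_tr_eq h2 hy hs.1
  have hzg := hs.of_tr_eq hzs
  refine ⟨z, exists_conj_of_tr_eq hs.1 hzs, fun x hx ↦ hx.of_mem_zpowers (hzg.2 ?_)⟩
  exact mem_torus.2 (mem_torus.1 hz).symm

end odd

section prime

variable {F : Type*} [Field F] [Fintype F] [DecidableEq F]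

/-- Over a prime field a unipotent element generates the group together with everything that moves
its fixed point. -/
lemma generates_upper_one (hp : (Fintype.card F).Prime) {x : SL(2, F)} (hx : x 1 0 ≠ 0) :
    Generates x (upper 1) := by
  refine generates_iff.2 fun Γ _ hxΓ hu ↦ eq_top_of_upper (fun b ↦ ?_) hxΓ hx
  have : b ∈ AddSubgroup.zmultiples (1 : F) :=
    mem_zmultiples_of_prime_card (p := Fintype.card F) (hp := ⟨hp⟩) Nat.card_eq_fintype_card
      one_ne_zero
  exact (AddSubgroup.zmultiples_le.2 (show (1 : F) ∈ upperGroup Γ from hu) :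
    _ ≤ upperGroup Γ) this

lemma generates_conj_upper_one (hp : (Fintype.card F).Prime) {x g : SL(2, F)}
    (hx : x • g • (∞ : OnePoint F) ≠ g • (∞ : OnePoint F)) : Generates x (g * upper 1 * g⁻¹) := by
  have h1 : (g⁻¹ * x * g) 1 0 ≠ 0 := by
    rw [Ne, ← smul_infty_eq_self_iff, mul_smul, mul_smul, inv_smul_eq_iff]; exact hx
  have := (generates_upper_one hp h1).conj g
  simpa [mul_assoc] using this

/-- Adding (q + 1)/2 elements that together fix every point forces a mate to be nonsplit.
Conversely, if some point is fixed by no element of X, a unipotent element fixing it is a mate;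
otherwise X has at least (q + 1)/2 elements with eigenvectors. These are mates of every torus
generator, since for q ≡ 3 mod 4 the nonscalar elements of a torus normaliser have no eigenvectors.
-/
lemma IsTorusGenerator.hasMate_iff_hasSpread (hF : Fintype.card F % 4 = 3)
    (hF' : 11 ≤ Fintype.card F) (hp : (Fintype.card F).Prime) {s : SL(2, F)}
    (hs : IsTorusGenerator s) (k : ℕ) :
    HasSpread PSL(2, F) (k + (Fintype.card F + 1) / 2) ↔ HasMate (ConjTo s) k := by
  classical
  have h2 := two_ne_zero_iff_odd.2 (Nat.odd_iff.2 (by omega) : Odd (Fintype.card F))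
  rw [hasSpread_iff]
  constructor
  · intro h X hX hXs
    obtain ⟨Y, hY, hYs, hcov⟩ := exists_cover (F := F) (by omega) ((Fintype.card F + 1) / 2)
      (by omega)
    obtain ⟨y, -, hy⟩ := h (X ∪ Y) ((Finset.card_union_le _ _).trans (add_le_add hX hY)) (by
      intro x hx
      rcases Finset.mem_union.1 hx with h | h
      exacts [hXs x h, hYs x h])
    have hyns : Nonsplit (tr y) := by
      rw [nonsplit_iff_smul_ne]
      intro p hyp
      obtain ⟨x, hx, hxp⟩ := hcov p
      exact not_generates_of_smul_eq hxp hyp (hy x (Finset.mem_union_right _ hx))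
    obtain ⟨z, hz, hzg⟩ := hs.exists_conjTo h2 hyns
    exact ⟨z, hz, fun x hx ↦ hzg x (hy x (Finset.mem_union_left _ hx))⟩
  · intro h X hX hXs
    by_cases hcov : ∀ p : OnePoint F, ∃ x ∈ X, x • p = p
    · set J := X.filter fun x ↦ ¬ Nonsplit (tr x) with hJ
      have h1 : Fintype.card F + 1 ≤ J.card * 2 := by
        rw [← Nat.card_eq_fintype_card, ← card_onePoint, Nat.card_eq_fintype_card,
          ← Finset.card_univ]
        refine le_trans (Finset.card_le_card ?_ : _ ≤ (J.biUnion fixedPts).card)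
          (Finset.card_biUnion_le_card_mul _ _ _ fun x hx ↦
            card_fixedPts_le_two (hXs x (Finset.mem_filter.1 hx).1))
        intro p _
        obtain ⟨x, hx, hxp⟩ := hcov p
        exact Finset.mem_biUnion.2 ⟨x, Finset.mem_filter.2 ⟨hx, fun h ↦ h.smul_ne p hxp⟩,
          mem_fixedPts.2 hxp⟩
      have h3 : (X.filter fun x ↦ Nonsplit (tr x)).card + J.card = X.card :=
        Finset.card_filter_add_card_filter_not _
      obtain ⟨y, hy, hyX⟩ := h (X.filter fun x ↦ Nonsplit (tr x)) (by omega)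
        (fun x hx ↦ hXs x (Finset.mem_filter.1 hx).1)
      refine ⟨y, trivial, fun x hx ↦ ?_⟩
      by_cases hxn : Nonsplit (tr x)
      · exact hyX x (Finset.mem_filter.2 ⟨hx, hxn⟩)
      · obtain ⟨g, rfl⟩ := hy
        have hy' := hs.conj g
        refine hy'.generates (.inr hF') fun hd ↦ ?_
        rw [mem_dihedral_iff_tr hy'.1.not_isScalar] at hd
        rcases hd with hd | hd
        · exact hxn (nonsplit_of_mem_torus hy'.1 (mem_torus.2 hd) (hXs x hx))
        · exact hxn (hd.1 ▸ nonsplit_zero hF)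
    · push Not at hcov
      obtain ⟨p, hp'⟩ := hcov
      obtain ⟨g, rfl⟩ := exists_smul_infty_eq p
      exact ⟨_, trivial, fun x hx ↦ generates_conj_upper_one hp (hp' x hx)⟩

/-- A nonsplit class may be replaced by that of s. Any other class is defeated by (q + 1)/2 elements
covering the projective line, so there k is at most q - 4, and the general bound for s applies. -/
lemma IsTorusGenerator.hasMate_iff_hasUniformSpread (hF : Fintype.card F % 4 = 3)
    (hF' : 11 ≤ Fintype.card F) {s : SL(2, F)} (hs : IsTorusGenerator s) (k : ℕ) :
    HasUniformSpread PSL(2, F) k ↔ HasMate (ConjTo s) k := by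
  have h2 := two_ne_zero_iff_odd.2 (Nat.odd_iff.2 (by omega) : Odd (Fintype.card F))
  rw [hasUniformSpread_iff]
  refine ⟨?_, fun h ↦ ⟨s, h⟩⟩
  rintro ⟨t, ht⟩
  by_cases htn : Nonsplit (tr t)
  · intro X hX hXs
    obtain ⟨y, ⟨g, rfl⟩, hy⟩ := ht X hX hXs
    obtain ⟨z, hz, hzg⟩ := hs.exists_conjTo h2 (y := g * t * g⁻¹) (by rwa [tr_conj])
    exact ⟨z, hz, fun x hx ↦ hzg x (hy x hx)⟩
  · refine (hs.hasMate_of_three_mod_four hF hF').mono (fun _ h ↦ h) ?_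
    by_contra! hk
    obtain ⟨Y, hY, hYs, hcov⟩ := exists_cover (F := F) (by omega) ((Fintype.card F + 1) / 2)
      (by omega)
    obtain ⟨y, ⟨g, rfl⟩, hy⟩ := ht Y (by omega) hYs
    obtain ⟨p, hp⟩ := exists_smul_eq_of_not_nonsplit (A := g * t * g⁻¹) (by rwa [tr_conj])
    obtain ⟨x, hx, hxp⟩ := hcov p
    exact not_generates_of_smul_eq hxp hp (hy x hx)

theorem spread_of_prime (hF : Fintype.card F % 4 = 3) (hF' : 11 ≤ Fintype.card F)
    (hp : (Fintype.card F).Prime) :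
    spread PSL(2, F) = uniformSpread PSL(2, F) + (Fintype.card F + 1) / 2 := by
  obtain ⟨s, hs⟩ := exists_isTorusGenerator (F := F)
  apply le_antisymm
  · refine csSup_le' fun m hm ↦ ?_
    by_contra! hlt
    have h1 : HasSpread PSL(2, F) (uniformSpread PSL(2, F) + 1 + (Fintype.card F + 1) / 2) :=
      HasSpread.mono hm (by omega)
    rw [hs.hasMate_iff_hasSpread hF hF' hp, ← hs.hasMate_iff_hasUniformSpread hF hF'] at h1
    have := le_uniformSpread h1
    omega
  · refine le_spread ?_
    rw [hs.hasMate_iff_hasSpread hF hF' hp, ← hs.hasMate_iff_hasUniformSpread hF hF']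
    refine Nat.sSup_mem ⟨0, ?_⟩ bddAbove_uniformSpread
    refine hasUniformSpread_iff.2 ⟨s, fun X hX _ ↦ ⟨s, ⟨1, by simp⟩, ?_⟩⟩
    rw [Nat.le_zero, Finset.card_eq_zero] at hX
    simp [hX]

theorem le_spread_of_prime (hF : Fintype.card F % 4 = 3) (hF' : 11 ≤ Fintype.card F)
    (hp : (Fintype.card F).Prime) :
    Fintype.card F - 4 + (Fintype.card F + 1) / 2 ≤ spread PSL(2, F) := by
  rw [spread_of_prime hF hF' hp]
  exact Nat.add_le_add_right (le_uniformSpread_of_three_mod_four hF hF') _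

theorem le_spread_of_three_mod_four (hF : Fintype.card F % 4 = 3) (hF' : 11 ≤ Fintype.card F) :
    Fintype.card F - 3 ≤ spread PSL(2, F) := by
  by_cases h : 19 ≤ Fintype.card F
  · exact le_spread (hasSpread_of_three_mod_four hF h)
  -- Below 19 only 11 and 15 are congruent to 3 mod 4, and 15 is no prime power; 11 is covered by
  -- the bound for primes.
  · have h15 : Fintype.card F ≠ 15 := by
      intro h
      have := FiniteField.card' F
      obtain ⟨p, _, n, hp, hn⟩ := this
      have h3 : 3 ∣ p ^ (n : ℕ) := by rw [← hn, h]; norm_num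
      have h5 : 5 ∣ p ^ (n : ℕ) := by rw [← hn, h]; norm_num
      have h3' := (Nat.prime_dvd_prime_iff_eq (by norm_num) hp).1
        (Nat.Prime.dvd_of_dvd_pow (by norm_num) h3)
      have h5' := (Nat.prime_dvd_prime_iff_eq (by norm_num) hp).1
        (Nat.Prime.dvd_of_dvd_pow (by norm_num) h5)
      omega
    have h11 : Fintype.card F = 11 := by omega
    have := le_spread_of_prime hF hF' (by rw [h11]; norm_num)
    omega

end prime

end SL2

namespace SL2

open Matrix Matrix.SpecialLinearGroup OnePoint

/-! ### Pairs of nonsplit tori -/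

section pairs

variable {F : Type*} [Field F] [Fintype F] [DecidableEq F]

/-- The determinant of the commutator `A B - B A` of matrices of trace `τ`, in terms of
`σ = tr (A B)`. -/
def commDet (τ σ : F) : F := (σ - 2) * (τ ^ 2 - 2 - σ)

/-- No nonscalar matrix normalises the centralisers of both `A` and `B`. -/
def Independent (A B : SL(2, F)) : Prop := ∀ x, x ∈ dihedral A → x ∈ dihedral B → IsScalar x

lemma conj_mem_dihedral_conj {x y : SL(2, F)} (g : SL(2, F)) (h : x ∈ dihedral y) :
    g * x * g⁻¹ ∈ dihedral (g * y * g⁻¹) := by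
  rw [mem_dihedral] at *
  have e : g * x * g⁻¹ * (g * y * g⁻¹) * (g * x * g⁻¹)⁻¹ = g * (x * y * x⁻¹) * g⁻¹ := by group
  rw [e]
  rcases h with h | h
  · exact .inl (by rw [h])
  · exact .inr (by rw [h]; group)

lemma Independent.conj {A B : SL(2, F)} (h : Independent A B) (g : SL(2, F)) :
    Independent (g * A * g⁻¹) (g * B * g⁻¹) := by
  intro x hA hB
  by_contra hx
  have h1 := conj_mem_dihedral_conj g⁻¹ hA
  have h2 := conj_mem_dihedral_conj g⁻¹ hB
  have e : ∀ A : SL(2, F), g⁻¹ * (g * A * g⁻¹) * g⁻¹⁻¹ = A := fun A ↦ by group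
  rw [e] at h1 h2
  exact not_isScalar_conj hx g⁻¹ (h _ h1 h2)

lemma tr_mul_companion {x : SL(2, F)} {τ : F} (h : tr x = 0) :
    tr (x * companion τ) = 0 ↔ x 0 1 = x 1 0 + τ * x 0 0 := by
  simp [tr] at h ⊢
  constructor
  · intro e; linear_combination e - τ * h
  · intro e; linear_combination e + τ * h

/-- The coordinates in which `x` of trace zero, inverting the companion matrix, has to be
proportional to `(commU A, commV τ A)` in order to invert `A`. -/
def commU (A : SL(2, F)) : F := A 0 1 + A 1 0
/-- See `commU`. -/
def commV (τ : F) (A : SL(2, F)) : F := τ - 2 * A 0 0 - τ * A 1 0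

/-- With respect to the trace-zero matrices inverting the companion matrix, whose determinant is
minus the norm form, the commutator has coordinates (`commU A`, `commV τ A`). -/
lemma commDet_tr_mul {τ : F} {A : SL(2, F)} (hA : tr A = τ) :
    commDet τ (tr (companion τ * A)) =
      -(commU A ^ 2 + τ * commU A * commV τ A + commV τ A ^ 2) := by
  have hd := det_eq A
  have h11 : A 1 1 = τ - A 0 0 := by simp only [tr] at hA; linear_combination hA
  simp [tr, commDet, commU, commV]
  rw [h11] at hd ⊢
  linear_combination (τ ^ 2 - 4) * hd

lemma tr_mul_eq_zero_iff {τ : F} {A x : SL(2, F)} (hA : tr A = τ) (hx : tr x = 0)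
    (hx' : x 0 1 = x 1 0 + τ * x 0 0) :
    tr (x * A) = 0 ↔ x 0 0 * commV τ A = x 1 0 * commU A := by
  simp [tr, commU, commV] at hA hx ⊢
  have h11 : x 1 1 = -x 0 0 := by linear_combination hx
  have hA11 : A 1 1 = τ - A 0 0 := by linear_combination hA
  rw [h11, hx', hA11]
  constructor
  · intro e; linear_combination -e
  · intro e; linear_combination -e

lemma commU_commV_eq_zero_iff {τ : F} {A : SL(2, F)} (hA : tr A = τ) :
    commU A = 0 ∧ commV τ A = 0 ↔ Commute A (companion τ) := by
  rw [commute_iff (by simp), commU, commV]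
  simp only [tr] at hA
  constructor
  · rintro ⟨h1, h2⟩
    exact ⟨A 0 0, A 1 0, by simp, by simp; linear_combination h1, by simp, by
      simp; linear_combination hA + h2⟩
  · rintro ⟨a, b, h0, h1, h2, h3⟩
    simp at h0 h1 h2 h3
    rw [h0, h1, h2]
    rw [h0, h3] at hA
    exact ⟨by ring, by linear_combination -hA⟩

lemma exists_of_form_eq {τ p t : F} (h : -(p ^ 2 + τ * p * t + t ^ 2) = 1) :
    ∃ x : SL(2, F), tr x = 0 ∧ x 0 0 = p ∧ x 1 0 = t ∧ x 0 1 = t + τ * p :=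
  ⟨ofEntries p (t + τ * p) t (-p) (by linear_combination h), by simp [tr], rfl, rfl, rfl⟩

lemma form_eq_of_tr {τ : F} {x : SL(2, F)} (hx : tr x = 0) (hx' : x 0 1 = x 1 0 + τ * x 0 0) :
    -(x 0 0 ^ 2 + τ * x 0 0 * x 1 0 + x 1 0 ^ 2) = 1 := by
  have hd := det_eq x
  simp only [tr] at hx
  have h11 : x 1 1 = -x 0 0 := by linear_combination hx
  rw [h11, hx'] at hd
  linear_combination hd

/-- If `x` of trace zero commutes with `y` and inverts `z`, then `tr (y z)` is special. -/
lemma two_mul_tr_mul {x y z : SL(2, F)} (hy : Nonsplit (tr y)) (hz : tr z = tr y)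
    (hx : x ∈ torus y) (hx' : ¬ IsScalar x) (hx0 : tr x = 0) (hxz : tr (x * z) = 0) :
    2 * tr (y * z) = tr y ^ 2 := by
  obtain ⟨a, b, hab, rfl⟩ := (mem_torus_iff hy.entry_10_ne_zero).1 hx
  have hb : b ≠ 0 := by
    rintro rfl
    exact hx' ⟨by simp [linComb], by simp [linComb], by simp [linComb]⟩
  simp only [tr, linComb, mul_00, mul_11, ofEntries_00, ofEntries_01, ofEntries_10,
    ofEntries_11] at *
  apply mul_left_cancel₀ hb
  linear_combination 2 * hxz - (y 0 0 + y 1 1) * hx0 - 2 * a * hz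

/-- Independence of tori in terms of the trace of a product. -/
lemma independent_companion_iff (h2 : (2 : F) ≠ 0) {τ : F} (hτ : Nonsplit τ) {A : SL(2, F)}
    (hA : tr A = τ) :
    Independent (companion τ) A ↔ ¬ IsSquare (commDet τ (tr (companion τ * A))) := by
  have hC : Nonsplit (tr (companion τ)) := by rwa [tr_companion]
  have hA' : Nonsplit (tr A) := by rwa [hA]
  constructor
  · rintro h ⟨l, hl⟩
    -- Determinant 0 makes both coordinates vanish by anisotropy. Then A commutes with the companion
    -- matrix, which itself violates independence.
    by_cases hl0 : l = 0
    · rw [hl0, mul_zero, commDet_tr_mul hA, neg_eq_zero] at hl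
      have h1 := (commU_commV_eq_zero_iff hA).1 (hτ.form_eq_zero hl)
      exact hC.not_isScalar (h _ (torus_le_dihedral _ (self_mem_torus _))
        (torus_le_dihedral _ (mem_torus.2 h1.symm)))
    -- Division by l normalises the commutator to determinant 1, and the result inverts both
    -- matrices.
    · rw [commDet_tr_mul hA] at hl
      obtain ⟨x, hx, h00, h10, h01⟩ := exists_of_form_eq (τ := τ) (p := commU A / l)
        (t := commV τ A / l) (by field_simp; linear_combination hl)
      have hx' : x 0 1 = x 1 0 + τ * x 0 0 := by rw [h01, h10, h00]
      have h3 := h x ((mem_dihedral_iff_tr hC.not_isScalar).2 (.inr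
          ⟨hx, (tr_mul_companion hx).2 hx'⟩))
        ((mem_dihedral_iff_tr hA'.not_isScalar).2 (.inr ⟨hx, (tr_mul_eq_zero_iff hA hx hx').2 (by
          rw [h00, h10]; field_simp)⟩))
      have hdx := det_eq x
      simp only [tr] at hx
      rw [← h3.2.2] at hx
      have : x 0 0 = 0 := by
        refine (mul_eq_zero.1 (?_ : 2 * x 0 0 = 0)).resolve_left h2
        linear_combination hx
      rw [h3.1, ← h3.2.2, this] at hdx
      simp at hdx
  · intro h x hx1 hx2
    by_contra hx
    rw [mem_dihedral_iff_tr hC.not_isScalar] at hx1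
    rw [mem_dihedral_iff_tr hA'.not_isScalar] at hx2
    apply h
    -- Under this relation the two factors of `commDet` coincide. It covers the x that centralise
    -- one torus and invert the other.
    have special : 2 * tr (companion τ * A) = τ ^ 2 → IsSquare (commDet τ (tr (companion τ * A))) :=
      fun e ↦ ⟨tr (companion τ * A) - 2, by rw [commDet, ← e]; ring⟩
    rcases hx1 with hx1 | ⟨hx0, hx1⟩ <;> rcases hx2 with hx2 | ⟨hx0', hx2⟩
    · have h3 := torus_eq_of_mem hC (mem_torus.2 hx1) hx
      have h4 : A ∈ torus (companion τ) := h3 ▸ mem_torus.2 hx2.symm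
      rw [commDet_tr_mul hA]
      obtain ⟨h5, h6⟩ := (commU_commV_eq_zero_iff hA).2 (mem_torus.1 h4)
      exact ⟨0, by rw [h5, h6]; ring⟩
    · refine special ?_
      have := two_mul_tr_mul hC (by rw [tr_companion, hA]) (mem_torus.2 hx1) hx hx0' hx2
      rwa [tr_companion] at this
    · refine special ?_
      have := two_mul_tr_mul hA' (by rw [tr_companion, hA]) (mem_torus.2 hx2) hx hx0 hx1
      rwa [hA, tr_mul_comm] at this
    · have hx' := (tr_mul_companion hx0).1 hx1
      have h3 := form_eq_of_tr hx0 hx'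
      have h4 := (tr_mul_eq_zero_iff hA hx0 hx').1 hx2
      rw [commDet_tr_mul hA]
      by_cases hp : x 0 0 = 0
      · have ht : x 1 0 ≠ 0 := by intro ht; rw [hp, ht] at h3; simp at h3
        have hu : commU A = 0 := by
          rw [hp, zero_mul] at h4; exact (mul_eq_zero.1 h4.symm).resolve_left ht
        rw [hp] at h3
        refine ⟨commV τ A / x 1 0, ?_⟩
        rw [hu]; field_simp; linear_combination commV τ A ^ 2 * h3
      · refine ⟨commU A / x 0 0, ?_⟩
        have hv : commV τ A = x 1 0 * commU A / x 0 0 := by field_simp; linear_combination h4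
        rw [hv]; field_simp; linear_combination commU A ^ 2 * h3

/-- The elements of trace `τ` with given trace of the product with the companion matrix. -/
noncomputable def productClass (τ σ : F) : Finset SL(2, F) := by
  classical exact (traceClass τ).filter fun A ↦ tr (companion τ * A) = σ

lemma mem_productClass {τ σ : F} {A : SL(2, F)} :
    A ∈ productClass τ σ ↔ tr A = τ ∧ tr (companion τ * A) = σ := by simp [productClass]

lemma card_productClass (h2 : (2 : F) ≠ 0) {τ : F} (hτ : Nonsplit τ) {σ : F}
    (hσ : commDet τ σ ≠ 0) : (productClass τ σ).card = Fintype.card F + 1 := by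
  have hD : 4 - τ ^ 2 ≠ 0 := fun h ↦ hτ.not_isSquare h2 ⟨0, by linear_combination -h⟩
  -- The two trace conditions leave the coordinates A 0 1 and A 1 1, in which determinant 1 is a
  -- conic with centre (b₀, d₀). After translation its value r satisfies r(4 - τ²) = -`commDet τ σ`.
  set b₀ := (2 * σ - τ ^ 2) / (4 - τ ^ 2) with hb₀
  set d₀ := τ * (2 - σ) / (4 - τ ^ 2) with hd₀
  have e1 : 2 * b₀ + τ * d₀ = σ := by rw [hb₀, hd₀]; field_simp; ring
  have e2 : τ * b₀ + 2 * d₀ = τ := by rw [hb₀, hd₀]; field_simp; ring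
  set r := b₀ ^ 2 + τ * b₀ * d₀ + d₀ ^ 2 - 1 with hr
  have hr0 : r ≠ 0 := by
    intro h
    apply hσ
    have : r * (4 - τ ^ 2) = -commDet τ σ := by
      rw [hr, hb₀, hd₀, commDet]; field_simp; ring
    rw [h, zero_mul] at this
    exact neg_eq_zero.1 this.symm
  rw [← card_conic hτ hr0]
  refine Finset.card_bij (fun A _ ↦ (A 0 1 - b₀, A 1 1 - d₀)) ?_ ?_ ?_
  · intro A hA
    rw [mem_productClass] at hA
    obtain ⟨h1, h3⟩ := hA
    have hd := det_eq A
    simp [tr] at h1 h3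
    have h00 : A 0 0 = τ - A 1 1 := by linear_combination h1
    have h10 : A 1 0 = A 0 1 + τ * A 1 1 - σ := by linear_combination -h3
    rw [h00, h10] at hd
    rw [mem_conic]
    linear_combination -hd - A 0 1 * e1 - A 1 1 * e2
  · intro A hA B hB e
    rw [mem_productClass] at hA hB
    simp [tr] at hA hB
    rw [Prod.mk_inj] at e
    obtain ⟨e3, e4⟩ := e
    have e3 : A 0 1 = B 0 1 := by linear_combination e3
    have e4 : A 1 1 = B 1 1 := by linear_combination e4
    exact ext_entries (by linear_combination hA.1 - hB.1 - e4) e3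
      (by linear_combination hB.2 - hA.2 + e3 + τ * e4) e4
  · rintro ⟨b, d⟩ h
    rw [mem_conic] at h
    refine ⟨ofEntries (τ - (d + d₀)) (b + b₀) (b + b₀ + τ * (d + d₀) - σ) (d + d₀) ?_, ?_, ?_⟩
    · linear_combination -h - (b + b₀) * e1 - (d + d₀) * e2
    · rw [mem_productClass]
      simp [tr]
    · simp

lemma card_nonsquare (h2 : (2 : F) ≠ 0) :
    2 * (Finset.univ.filter fun a : F ↦ ¬ IsSquare a).card + 1 = Fintype.card F := by
  classical
  obtain ⟨n, hn⟩ := FiniteField.exists_nonsquare (F := F) (fun h ↦ h2 (by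
    have := ringChar.spec F 2
    rw [h] at this
    exact_mod_cast this.2 dvd_rfl))
  have hn0 : n ≠ 0 := by rintro rfl; exact hn (IsSquare.zero)
  have h1 : (Finset.univ.filter fun a : F ↦ ¬ IsSquare a).card =
      (Finset.univ.filter fun a : F ↦ IsSquare a ∧ a ≠ 0).card := by
    refine Finset.card_bij (fun a _ ↦ n * a) ?_ ?_ ?_
    · intro a ha
      simp only [Finset.mem_filter, Finset.mem_univ, true_and] at ha ⊢
      refine ⟨isSquare_mul_of_not_isSquare hn ha, mul_ne_zero hn0 ?_⟩
      rintro rfl; exact ha (IsSquare.zero)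
    · intro a _ b _ e; exact mul_left_cancel₀ hn0 e
    · intro b hb
      simp only [Finset.mem_filter, Finset.mem_univ, true_and] at hb
      refine ⟨b / n, ?_, mul_div_cancel₀ _ hn0⟩
      simp only [Finset.mem_filter, Finset.mem_univ, true_and]
      intro h
      apply hn
      have := hb.1.div h
      rwa [div_div_cancel₀ hb.2] at this
  have h3 : (Finset.univ.filter fun a : F ↦ IsSquare a).card =
      (Finset.univ.filter fun a : F ↦ IsSquare a ∧ a ≠ 0).card + 1 := by
    rw [← Finset.card_erase_add_one (a := (0 : F)) (by simp)]
    congr 2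
    ext a; simp [and_comm]
  have h4 := Finset.card_filter_add_card_filter_not (s := (Finset.univ : Finset F))
    (fun a : F ↦ IsSquare a)
  rw [Finset.card_univ] at h4
  omega

/-- The traces of products that make two tori independent. -/
noncomputable def goodTraces (τ : F) : Finset F := by
  classical exact Finset.univ.filter fun σ ↦ ¬ IsSquare (commDet τ σ)

lemma mem_goodTraces {τ σ : F} : σ ∈ goodTraces τ ↔ ¬ IsSquare (commDet τ σ) := by
  simp [goodTraces]

/-- With u = σ - 2 and D = τ² - 4 the product u(D - u) is a square exactly when D/u - 1 is. As σ
varies, D/u - 1 takes every value except -1 once, so the good σ correspond to the nonsquares other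
than -1. -/
lemma card_goodTraces (h2 : (2 : F) ≠ 0) {τ : F} (hτ : Nonsplit τ) :
    2 * (goodTraces τ).card + (if IsSquare (-1 : F) then 0 else 2) + 1 = Fintype.card F := by
  classical
  set D := τ ^ 2 - 4 with hD
  have hDs : ¬ IsSquare D := hτ.not_isSquare h2
  have hD0 : D ≠ 0 := fun h ↦ hDs (h ▸ IsSquare.zero)
  have hf : ∀ σ, commDet τ σ = (σ - 2) * (D - (σ - 2)) := fun σ ↦ by rw [commDet, hD]; ring
  have h1 : (goodTraces τ).card =
      (Finset.univ.filter fun a : F ↦ ¬ IsSquare a ∧ a ≠ -1).card := by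
    have key : ∀ u : F, u ≠ 0 → (IsSquare (u * (D - u)) ↔ IsSquare (D / u - 1)) := by
      intro u hu
      rw [show u * (D - u) = (u * u) * (D / u - 1) by field_simp]
      constructor
      · intro h
        have := h.div (IsSquare.mul_self u)
        rwa [mul_div_cancel_left₀ _ (mul_ne_zero hu hu)] at this
      · exact fun h ↦ (IsSquare.mul_self u).mul h
    refine Finset.card_bij (fun σ _ ↦ D / (σ - 2) - 1) ?_ ?_ ?_
    · intro σ hσ
      rw [mem_goodTraces, hf] at hσ
      have hu : σ - 2 ≠ 0 := by intro h; rw [h, zero_mul] at hσ; exact hσ IsSquare.zero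
      rw [key _ hu] at hσ
      simp only [Finset.mem_filter, Finset.mem_univ, true_and]
      refine ⟨hσ, fun h ↦ ?_⟩
      have : D / (σ - 2) = 0 := by linear_combination h
      exact div_ne_zero hD0 hu this
    · intro σ hσ ρ hρ e
      rw [mem_goodTraces, hf] at hσ hρ
      have hu : σ - 2 ≠ 0 := by intro h; rw [h, zero_mul] at hσ; exact hσ IsSquare.zero
      have hv : ρ - 2 ≠ 0 := by intro h; rw [h, zero_mul] at hρ; exact hρ IsSquare.zero
      have e : D / (σ - 2) = D / (ρ - 2) := by linear_combination e
      rw [div_eq_div_iff hu hv] at e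
      linear_combination -mul_left_cancel₀ hD0 e
    · intro w hw
      simp only [Finset.mem_filter, Finset.mem_univ, true_and] at hw
      have hw1 : w + 1 ≠ 0 := fun h ↦ hw.2 (eq_neg_of_add_eq_zero_left h)
      have hu : D / (w + 1) ≠ 0 := div_ne_zero hD0 hw1
      have e : D / (D / (w + 1)) - 1 = w := by field_simp; ring
      refine ⟨D / (w + 1) + 2, ?_, by rw [add_sub_cancel_right, e]⟩
      rw [mem_goodTraces, hf, add_sub_cancel_right, key _ hu, e]
      exact hw.1
  have h3 := card_nonsquare h2
  rw [h1]
  split_ifs with h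
  · rw [← h3, add_zero]
    congr 3
    ext a
    simp only [Finset.mem_filter, Finset.mem_univ, true_and, and_iff_left_iff_imp]
    rintro ha rfl; exact ha h
  · have h4 : (Finset.univ.filter fun a : F ↦ ¬ IsSquare a) =
        insert (-1) (Finset.univ.filter fun a : F ↦ ¬ IsSquare a ∧ a ≠ -1) := by
      ext a
      by_cases ha : a = -1
      · simp [ha, h]
      · simp [ha]
    rw [h4, Finset.card_insert_of_notMem (by simp)] at h3
    omega

/-- The elements of trace `τ` independent of `A`. -/
noncomputable def indepClass (τ : F) (A : SL(2, F)) : Finset SL(2, F) := by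
  classical exact (traceClass τ).filter fun B ↦ Independent A B

lemma mem_indepClass {τ : F} {A B : SL(2, F)} :
    B ∈ indepClass τ A ↔ tr B = τ ∧ Independent A B := by simp [indepClass]

/-- After conjugating A to companion form, the independent B are sorted by the trace of the product;
each good value contributes a conic of q + 1 points. -/
lemma card_indepClass (h2 : (2 : F) ≠ 0) {τ : F} (hτ : Nonsplit τ) {A : SL(2, F)} (hA : tr A = τ) :
    (indepClass τ A).card = (goodTraces τ).card * (Fintype.card F + 1) := by
  classical
  have h1 : (indepClass τ A).card = (indepClass τ (companion τ)).card := by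
    obtain ⟨g, hg⟩ := exists_conj_companion (A := A) (hA ▸ hτ)
    rw [hA] at hg
    rw [← hg]
    have e : ∀ A : SL(2, F), g⁻¹ * (g * A * g⁻¹) * g⁻¹⁻¹ = A := fun A ↦ by group
    refine (Finset.card_bij (fun B _ ↦ g * B * g⁻¹) ?_ ?_ ?_).symm
    · intro B hB
      rw [mem_indepClass] at *
      rw [tr_conj]
      exact ⟨hB.1, hB.2.conj g⟩
    · intro B _ C _ e; simpa using e
    · intro B hB
      rw [mem_indepClass] at hB
      refine ⟨g⁻¹ * B * g⁻¹⁻¹, ?_, by group⟩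
      rw [mem_indepClass, tr_conj]
      refine ⟨hB.1, ?_⟩
      have := hB.2.conj g⁻¹
      rwa [e] at this
  rw [h1]
  have h3 : indepClass τ (companion τ) = (goodTraces τ).biUnion (productClass τ) := by
    ext B
    simp only [mem_indepClass, Finset.mem_biUnion, mem_productClass, mem_goodTraces]
    constructor
    · rintro ⟨hB, hi⟩
      exact ⟨_, (independent_companion_iff h2 hτ hB).1 hi, hB, rfl⟩
    · rintro ⟨σ, hσ, hB, rfl⟩
      exact ⟨hB, (independent_companion_iff h2 hτ hB).2 hσ⟩
  rw [h3, Finset.card_biUnion]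
  · rw [Finset.sum_congr rfl fun σ hσ ↦ card_productClass h2 hτ (σ := σ) fun h ↦ by
      rw [mem_goodTraces, h] at hσ; exact hσ IsSquare.zero]
    simp
  · intro σ _ ρ _ hne
    rw [Function.onFun, Finset.disjoint_left]
    intro B hB hB'
    rw [mem_productClass] at hB hB'
    exact hne (hB.2.symm.trans hB'.2)

/-- In even characteristic any two nonsplit tori are inverted by a common involution. -/
lemma exists_common_of_even (h2 : (2 : F) = 0) {A B : SL(2, F)} (hA : Nonsplit (tr A))
    (hB : tr B = tr A) : ¬ Independent A B := by
  intro hi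
  obtain ⟨g, hg⟩ := exists_conj_companion hA
  have e : ∀ A : SL(2, F), g⁻¹ * (g * A * g⁻¹) * g⁻¹⁻¹ = A := fun A ↦ by group
  have hi' := hi.conj g⁻¹
  nth_rw 1 [← hg] at hi'
  rw [e] at hi'
  set τ := tr A with hτ
  set D := g⁻¹ * B * g⁻¹⁻¹ with hD
  have hDτ : tr D = τ := by rw [hD, tr_conj, hB]
  have hτ0 : τ ≠ 0 := by
    intro h
    exact hA 1 (by rw [h]; linear_combination h2)
  have hneg : ∀ a : F, -a = a := fun a ↦ by linear_combination -a * h2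
  obtain ⟨p, t, h1, h3⟩ : ∃ p t : F, -(p ^ 2 + τ * p * t + t ^ 2) = 1 ∧
      p * commV τ D = t * commU D := by
    by_cases h0 : commU D = 0 ∧ commV τ D = 0
    · exact ⟨1, 0, by linear_combination -h2, by rw [h0.1, h0.2]; ring⟩
    -- In characteristic 2 the determinant of the commutator is always a square, so normalisation
    -- never fails.
    · obtain ⟨l, hl⟩ := FiniteField.isSquare_of_char_two (F := F) (by
        refine (Nat.prime_dvd_prime_iff_eq (CharP.char_is_prime F _) Nat.prime_two).1 ?_
        exact (ringChar.spec F 2).1 (by exact_mod_cast h2))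
        (-(commU D ^ 2 + τ * commU D * commV τ D + commV τ D ^ 2))
      have hl0 : l ≠ 0 := by
        rintro rfl
        exact h0 (hA.form_eq_zero (by linear_combination -hl))
      exact ⟨commU D / l, commV τ D / l, by field_simp; linear_combination hl, by field_simp⟩
  obtain ⟨x, hx, h00, h10, h01⟩ := exists_of_form_eq h1
  have hx' : x 0 1 = x 1 0 + τ * x 0 0 := by rw [h01, h10, h00]
  have hC : Nonsplit (tr (companion τ)) := by rwa [tr_companion]
  have h4 := hi' x ((mem_dihedral_iff_tr hC.not_isScalar).2 (.inr
      ⟨hx, (tr_mul_companion hx).2 hx'⟩))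
    ((mem_dihedral_iff_tr (hDτ ▸ hA : Nonsplit (tr D)).not_isScalar).2 (.inr ⟨hx,
      (tr_mul_eq_zero_iff hDτ hx hx').2 (by rw [h00, h10, h3])⟩))
  have h5 : t = 0 := by rw [← h10]; exact h4.2.1
  have h6 : τ * p = 0 := by rw [← h00]; linear_combination h4.1 - hx' - h4.2.1
  rw [h5, (mul_eq_zero.1 h6).resolve_left hτ0] at h1
  simp at h1

/-- In characteristic 2 a trace-zero element has eigenvalue 1, so it cannot be a nonscalar torus
element. Hence no x centralises one torus and inverts another, and centralising both would make A
and B commute. -/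
lemma inverts_of_mem_of_even (h2 : (2 : F) = 0) {A B x : SL(2, F)} (hA : Nonsplit (tr A))
    (hB : tr B = tr A) (hAB : ¬ Commute B A)
    (hx : ¬ IsScalar x) (hxA : x ∈ dihedral A) (hxB : x ∈ dihedral B) :
    tr x = 0 ∧ tr (x * A) = 0 ∧ tr (x * B) = 0 := by
  have hB' : Nonsplit (tr B) := hB ▸ hA
  have h0 : ∀ C : SL(2, F), Nonsplit (tr C) → Commute x C → tr x ≠ 0 := fun C hC hxC h ↦ by
    have := nonsplit_of_mem_torus hC (mem_torus.2 hxC) hx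
    rw [h] at this
    exact this 1 (by linear_combination h2)
  rw [mem_dihedral_iff_tr hA.not_isScalar] at hxA
  rw [mem_dihedral_iff_tr hB'.not_isScalar] at hxB
  rcases hxA with hxA | hxA <;> rcases hxB with hxB | hxB
  · have h3 := torus_eq_of_mem hA (mem_torus.2 hxA) hx
    have h4 : B ∈ torus A := h3 ▸ mem_torus.2 hxB.symm
    exact absurd (mem_torus.1 h4) hAB
  · exact absurd hxB.1 (h0 A hA hxA)
  · exact absurd hxA.1 (h0 B hB' hxB)
  · exact ⟨hxA.1, hxA.2, hxB.2⟩

/-- In even characteristic distinct nonsplit tori are inverted by a unique involution. -/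
lemma unique_common_of_even (h2 : (2 : F) = 0) {A B : SL(2, F)} (hA : Nonsplit (tr A))
    (hB : tr B = tr A) (hAB : ¬ Commute B A) {x z : SL(2, F)}
    (hx : ¬ IsScalar x) (hxA : x ∈ dihedral A) (hxB : x ∈ dihedral B)
    (hz : ¬ IsScalar z) (hzA : z ∈ dihedral A) (hzB : z ∈ dihedral B) : x = z := by
  obtain ⟨g, hg⟩ := exists_conj_companion hA
  set τ := tr A with hτ
  obtain ⟨D, rfl⟩ : ∃ D, g * D * g⁻¹ = B := ⟨g⁻¹ * B * g, by group⟩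
  obtain ⟨X, rfl⟩ : ∃ X, g * X * g⁻¹ = x := ⟨g⁻¹ * x * g, by group⟩
  obtain ⟨Z, rfl⟩ : ∃ Z, g * Z * g⁻¹ = z := ⟨g⁻¹ * z * g, by group⟩
  have hcm : ∀ X Y : SL(2, F), g * X * g⁻¹ * (g * Y * g⁻¹) = g * (X * Y) * g⁻¹ := fun X Y ↦ by group
  rw [tr_conj] at hB
  have hDC : ¬ Commute D (companion τ) := fun h ↦ hAB (by
    rw [← hg, Commute, SemiconjBy, hcm, hcm, h.eq])
  have coord : ∀ X : SL(2, F), ¬ IsScalar (g * X * g⁻¹) → g * X * g⁻¹ ∈ dihedral A →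
      g * X * g⁻¹ ∈ dihedral (g * D * g⁻¹) → tr X = 0 ∧ X 0 1 = X 1 0 + τ * X 0 0 ∧
      -(X 0 0 ^ 2 + τ * X 0 0 * X 1 0 + X 1 0 ^ 2) = 1 ∧
      X 0 0 * commV τ D = X 1 0 * commU D := by
    intro X h1 h3 h4
    obtain ⟨h5, h6, h7⟩ := inverts_of_mem_of_even h2 (by rwa [← hτ]) (by rw [tr_conj, hB]) hAB
      h1 h3 h4
    rw [tr_conj] at h5
    rw [show tr (g * X * g⁻¹ * A) = tr (g * X * g⁻¹ * (g * companion τ * g⁻¹)) by rw [hg]] at h6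
    rw [hcm, tr_conj] at h6 h7
    have h8 := (tr_mul_companion h5).1 h6
    exact ⟨h5, h8, form_eq_of_tr h5 h8, (tr_mul_eq_zero_iff hB h5 h8).1 h7⟩
  obtain ⟨x1, x2, x3, x4⟩ := coord X hx hxA hxB
  obtain ⟨z1, z2, z3, z4⟩ := coord Z hz hzA hzB
  -- The coordinates of x are fixed up to a factor and that factor up to its square; squaring is
  -- injective in characteristic 2.
  have sq : ∀ a b : F, a ^ 2 = b ^ 2 → a = b := fun a b h ↦ by
    have : (a - b) ^ 2 = 0 := by linear_combination h + (b ^ 2 - a * b) * h2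
    exact sub_eq_zero.1 (pow_eq_zero_iff two_ne_zero |>.1 this)
  have huv : ¬ (commU D = 0 ∧ commV τ D = 0) := fun h ↦ hDC ((commU_commV_eq_zero_iff hB).1 h)
  have hpt : X 0 0 = Z 0 0 ∧ X 1 0 = Z 1 0 := by
    by_cases hu : commU D = 0
    · have hv : commV τ D ≠ 0 := fun h ↦ huv ⟨hu, h⟩
      rw [hu, mul_zero] at x4 z4
      have x5 := (mul_eq_zero.1 x4).resolve_right hv
      have z5 := (mul_eq_zero.1 z4).resolve_right hv
      refine ⟨x5.trans z5.symm, sq _ _ ?_⟩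
      rw [x5] at x3; rw [z5] at z3
      linear_combination -x3 + z3
    · set k := commV τ D / commU D with hk
      have hkx : X 1 0 = X 0 0 * k := by rw [hk]; field_simp; linear_combination -x4
      have hkz : Z 1 0 = Z 0 0 * k := by rw [hk]; field_simp; linear_combination -z4
      rw [hkx] at x3
      rw [hkz] at z3
      have hq : 1 + τ * k + k ^ 2 ≠ 0 := by
        intro h
        have : X 0 0 ^ 2 * (1 + τ * k + k ^ 2) = -1 := by linear_combination -x3
        rw [h, mul_zero] at this
        exact one_ne_zero (neg_eq_zero.1 this.symm)
      have h00 : X 0 0 = Z 0 0 := sq _ _ (mul_right_cancel₀ hq (by linear_combination -x3 + z3))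
      exact ⟨h00, by rw [hkx, hkz, h00]⟩
  have : X = Z := by
    simp only [tr] at x1 z1
    exact ext_entries hpt.1 (by rw [x2, z2, hpt.1, hpt.2]) hpt.2
      (by linear_combination x1 - z1 - hpt.1)
  rw [this]

end pairs

end SL2

namespace SL2

open Matrix Matrix.SpecialLinearGroup OnePoint

/-! ### Uniform dominating sets in terms of matrices -/

section uds

variable {F : Type*} [Field F]

/-- Every nonscalar matrix generates the group modulo scalars together with some member of the
tuple. -/
def Dominates {n : ℕ} (y : Fin n → SL(2, F)) : Prop := ∀ x, ¬ IsScalar x → ∃ i, Generates x (y i)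

lemma ConjTo.not_isScalar {s y : SL(2, F)} (h : ConjTo s y) (hs : ¬ IsScalar s) : ¬ IsScalar y := by
  obtain ⟨g, rfl⟩ := h
  rw [← mem_center_iff_isScalar] at hs ⊢
  exact fun h' ↦ hs (by
    have := (inferInstance : (Subgroup.center SL(2, F)).Normal).conj_mem _ h' g⁻¹
    simpa [mul_assoc] using this)

lemma ConjTo.isConj {s y : SL(2, F)} (h : ConjTo s y) : IsConj (s : PSL(2, F)) (y : PSL(2, F)) :=
  isConj_mk_iff.2 ⟨y, h, rfl⟩

lemma ConjTo.tr_eq {s y : SL(2, F)} (h : ConjTo s y) : tr y = tr s := by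
  obtain ⟨g, rfl⟩ := h; exact tr_conj _ _

lemma IsUniformDominatingSet.dominates {n : ℕ} {y : Fin n → SL(2, F)}
    (h : IsUniformDominatingSet (Set.range fun i ↦ (y i : PSL(2, F)))) : Dominates y := by
  intro x hx
  obtain ⟨_, ⟨i, rfl⟩, hi⟩ := h.1.2 (x : PSL(2, F)) (by rwa [Ne, mk_eq_one_iff])
  exact ⟨i, hi⟩

lemma Dominates.isUniformDominatingSet {n : ℕ} {s : SL(2, F)} (hs : ¬ IsScalar s)
    {y : Fin n → SL(2, F)} (hy : ∀ i, ConjTo s (y i)) (h : Dominates y) :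
    IsUniformDominatingSet (Set.range fun i ↦ (y i : PSL(2, F))) := by
  refine ⟨⟨?_, fun x hx ↦ ?_⟩, ?_⟩
  · rintro _ ⟨i, rfl⟩
    rw [Ne, mk_eq_one_iff]
    exact (hy i).not_isScalar hs
  · obtain ⟨A, rfl⟩ := exists_lift x
    obtain ⟨i, hi⟩ := h A (by rwa [Ne, mk_eq_one_iff] at hx)
    exact ⟨_, ⟨i, rfl⟩, hi⟩
  · rintro _ ⟨i, rfl⟩ _ ⟨j, rfl⟩
    exact (hy i).isConj.symm.trans (hy j).isConj

/-- There is a dominating tuple of `n` conjugate nonscalar matrices. -/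
def HasUDS (F : Type*) [Field F] (n : ℕ) : Prop :=
  ∃ s : SL(2, F), ¬ IsScalar s ∧ ∃ y : Fin n → SL(2, F), (∀ i, ConjTo s (y i)) ∧ Dominates y

lemma HasUDS.exists_finset {n : ℕ} (h : HasUDS F n) :
    ∃ S : Finset PSL(2, F), IsUniformDominatingSet (S : Set PSL(2, F)) ∧ S.card ≤ n := by
  classical
  obtain ⟨s, hs, y, hy, hd⟩ := h
  refine ⟨Finset.univ.image fun i ↦ (y i : PSL(2, F)), ?_, Finset.card_image_le.trans (by simp)⟩
  have := hd.isUniformDominatingSet hs hy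
  simpa using this

lemma hasUDS_of_finset {n : ℕ} {S : Finset PSL(2, F)}
    (hS : IsUniformDominatingSet (S : Set PSL(2, F))) (hn : S.card ≤ n) : HasUDS F n := by
  obtain ⟨y₀, hy₀, -⟩ := hS.1.2 ((upper 1 : SL(2, F)) : PSL(2, F)) (by
    rw [Ne, mk_eq_one_iff]; exact fun h ↦ one_ne_zero h.1)
  obtain ⟨s, rfl⟩ := exists_lift y₀
  have hlift : ∀ z ∈ S, ∃ A, ConjTo s A ∧ (A : PSL(2, F)) = z := fun z hz ↦
    isConj_mk_iff.1 (hS.2 _ hy₀ _ hz)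
  choose! f hf hfz using hlift
  let e : Fin n → PSL(2, F) := fun i ↦
    if hi : i.1 < S.card then (S.equivFin.symm ⟨i.1, hi⟩).1 else s
  have he : ∀ i, e i ∈ S := by
    intro i; simp only [e]; split_ifs
    · exact Subtype.property _
    · exact hy₀
  refine ⟨s, ?_, fun i ↦ f (e i), fun i ↦ hf _ (he i), fun x hx ↦ ?_⟩
  · rw [← mk_eq_one_iff]; exact hS.1.1 _ hy₀
  · obtain ⟨y, hy, hg⟩ := hS.1.2 (x : PSL(2, F)) (by rwa [Ne, mk_eq_one_iff])
    have hlt := (S.equivFin ⟨y, hy⟩).2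
    refine ⟨⟨(S.equivFin ⟨y, hy⟩).1, hlt.trans_le hn⟩, ?_⟩
    have : e ⟨(S.equivFin ⟨y, hy⟩).1, hlt.trans_le hn⟩ = y := by simp [e, hlt]
    change Generates x (f (e _))
    rw [this]
    unfold Generates
    rwa [hfz y hy]

/-- Tuples may repeat entries, so `HasUDS F n` means the existence of a uniform dominating set of
size at most n. -/
lemma uniformDominationNumber_eq {n : ℕ} (h : HasUDS F (n + 1)) (h' : ¬ HasUDS F n) :
    uniformDominationNumber PSL(2, F) = n + 1 := by
  obtain ⟨S, hS, hc⟩ := h.exists_finset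
  apply le_antisymm
  · refine le_trans (Nat.sInf_le ?_) hc
    exact ⟨S, hS, rfl⟩
  · have hne : {m | ∃ S : Finset PSL(2, F), IsUniformDominatingSet (S : Set PSL(2, F)) ∧
        S.card = m}.Nonempty := ⟨_, S, hS, rfl⟩
    obtain ⟨T, hT, hc⟩ := Nat.sInf_mem hne
    by_contra! hlt
    refine h' (hasUDS_of_finset hT ?_)
    rw [hc]
    exact Nat.lt_succ_iff.1 hlt

variable [Finite F]

lemma Generates.not_commute {x y : SL(2, F)} (h : Generates x y) (hx : ¬ IsScalar x) :
    ¬ Commute x y := fun hxy ↦ by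
  have h2 := generates_iff.1 h (torus x) (center_le_torus x) (self_mem_torus x)
    (mem_torus.2 hxy.symm)
  refine hx (mem_center_iff_isScalar.1 (Subgroup.mem_center_iff.2 fun g ↦ ?_))
  exact (mem_torus.1 (h2 ▸ Subgroup.mem_top g : g ∈ torus x)).eq

end uds

section uds

variable {F : Type*} [Field F] [Fintype F] [DecidableEq F]

lemma not_hasUDS_one : ¬ HasUDS F 1 := by
  rintro ⟨s, hs, y, hy, hd⟩
  have h0 := (hy 0).not_isScalar hs
  obtain ⟨i, hi⟩ := hd (y 0) h0
  rw [Subsingleton.elim i 0] at hi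
  exact hi.not_commute h0 (Commute.refl _)

/-- A pair of elements with eigenvectors does not dominate. -/
lemma Dominates.exists_nonsplit (hF : 4 ≤ Fintype.card F) {y : Fin 2 → SL(2, F)} (h : Dominates y) :
    Nonsplit (tr (y 0)) ∨ Nonsplit (tr (y 1)) := by
  by_contra! hc
  obtain ⟨p, hp⟩ := exists_smul_eq_of_not_nonsplit hc.1
  obtain ⟨r, hr⟩ := exists_smul_eq_of_not_nonsplit hc.2
  obtain ⟨x, hx, hxp, hxr⟩ := exists_fix_two hF p r
  obtain ⟨i, hi⟩ := h x hx
  fin_cases i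
  · exact not_generates_of_smul_eq hxp hp hi
  · exact not_generates_of_smul_eq hxr hr hi

/-- Two involutions do not generate. -/
lemma not_generates_of_tr_eq_zero (hF : 3 ≤ Fintype.card F) {x y : SL(2, F)} (hx : ¬ IsScalar x)
    (hx0 : tr x = 0) (hy0 : tr y = 0) : ¬ Generates x y := by
  intro h
  by_cases hs : IsScalar (x * y)
  · refine h.not_commute hx ?_
    have h1 := Subgroup.mem_center_iff.1 (mem_center_iff_isScalar.2 hs) x
    rw [Commute, SemiconjBy]
    apply mul_left_cancel (a := x)
    rw [h1, mul_assoc]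
  · have hc : ∀ z : SL(2, F), tr z = 0 → z * z = -1 := fun z hz ↦ by
      have hd := det_eq z
      simp only [tr] at hz
      apply ext_entries <;> simp
      · linear_combination z 0 0 * hz - hd
      · linear_combination z 0 1 * hz
      · linear_combination z 1 0 * hz
      · linear_combination z 1 1 * hz - hd
    refine not_generates_of_mem (center_le_dihedral (x * y)) (A := x) (B := y) ?_ ?_
      (dihedral_ne_top (by rwa [Nat.card_eq_fintype_card]) hs) h
    · refine .inr (inverts_of_tr hx0 ?_)
      rw [← mul_assoc, hc x hx0, neg_one_mul, tr_neg, hy0, neg_zero]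
    · refine .inr (inverts_of_tr hy0 ?_)
      rw [tr_mul_comm, mul_assoc, hc y hy0, mul_neg, mul_one, tr_neg, hx0, neg_zero]

lemma Dominates.independent (hF : 3 ≤ Fintype.card F) {A B : SL(2, F)} (hA : ¬ IsScalar A)
    (hB : ¬ IsScalar B) (h : Dominates ![A, B]) : Independent A B := by
  intro x hxA hxB
  by_contra hx
  obtain ⟨i, hi⟩ := h x hx
  fin_cases i
  · exact hi.notMem_dihedral hF hA hxA
  · exact hi.notMem_dihedral hF hB hxB

lemma Independent.dominates {A B : SL(2, F)} (hA : IsTorusGenerator A)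
    (hB : IsTorusGenerator B) (hq : Even (Fintype.card F) ∨ 11 ≤ Fintype.card F)
    (h : Independent A B) : Dominates ![A, B] := by
  intro x hx
  by_cases hxA : x ∈ dihedral A
  · exact ⟨1, hB.generates hq fun hxB ↦ hx (h x hxA hxB)⟩
  · exact ⟨0, hA.generates hq hxA⟩

/-- Two tori always share an involution. For two distinct ones it is the only obstruction, and fewer
than q(q - 1) generators of the given trace have it in their normaliser, so a third generator avoids
it. -/
theorem uniformDominationNumber_of_even (hF : Even (Fintype.card F)) (hF' : 4 ≤ Fintype.card F) :
    uniformDominationNumber PSL(2, F) = 3 := by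
  classical
  have h2 : (2 : F) = 0 := by
    by_contra h; exact (Nat.not_even_iff_odd.2 (two_ne_zero_iff_odd.1 h)) hF
  refine uniformDominationNumber_eq ?_ ?_
  · obtain ⟨s, hs⟩ := exists_isTorusGenerator (F := F)
    have hbig : 3 * 4 ≤ Fintype.card F * (Fintype.card F - 1) := by
      rw [mul_comm (Fintype.card F)]; exact Nat.mul_le_mul (by omega) hF'
    have hlt : Fintype.card F < Fintype.card F * (Fintype.card F - 1) := by
      nlinarith [Nat.sub_add_cancel (by omega : 1 ≤ Fintype.card F)]
    obtain ⟨B, hB, hB'⟩ := Finset.exists_mem_notMem_of_card_lt_card (s := {s, s⁻¹})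
      (t := traceClass (tr s)) (Finset.card_le_two.trans_lt (by rw [card_traceClass hs.1]; omega))
    rw [mem_traceClass] at hB
    have hBs : ¬ Commute B s := fun h ↦ hB' (by
      simpa using tr_eq_of_mem_torus hs.1 (mem_torus.2 h) hB)
    obtain ⟨C, hC, hC'⟩ : ∃ C, tr C = tr s ∧ ∀ x, ¬ IsScalar x → x ∈ dihedral s →
        x ∈ dihedral B → x ∉ dihedral C := by
      by_cases hx : ∃ x, ¬ IsScalar x ∧ x ∈ dihedral s ∧ x ∈ dihedral B
      · obtain ⟨x, hx, hxs, hxB⟩ := hx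
        obtain ⟨C, hC, hC'⟩ := Finset.exists_mem_notMem_of_card_lt_card (s := badClass (tr s) x)
          (t := traceClass (tr s)) (by
            rw [card_traceClass hs.1]
            exact (card_badClass_of_even hF hF' hs hx).trans_lt hlt)
        rw [mem_traceClass] at hC
        refine ⟨C, hC, fun z hz hzs hzB hzC ↦ hC' ?_⟩
        rw [mem_badClass, unique_common_of_even h2 hs.1 hB hBs hx hxs hxB hz hzs hzB]
        exact ⟨hC, hzC⟩
      · push Not at hx
        exact ⟨s, rfl, fun x h1 h3 h4 ↦ absurd h4 (hx x h1 h3)⟩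
    refine ⟨s, hs.1.not_isScalar, ![s, B, C], ?_, ?_⟩
    · intro i
      fin_cases i
      · exact exists_conj_of_tr_eq hs.1 rfl
      · exact exists_conj_of_tr_eq hs.1 hB
      · exact exists_conj_of_tr_eq hs.1 hC
    · intro x hx
      by_cases h1 : x ∈ dihedral s
      · by_cases h3 : x ∈ dihedral B
        · exact ⟨2, (hs.of_tr_eq hC).generates (.inl hF) (hC' x hx h1 h3)⟩
        · exact ⟨1, (hs.of_tr_eq hB).generates (.inl hF) h3⟩
      · exact ⟨0, hs.generates (.inl hF) h1⟩
  · rintro ⟨s, hs, y, hy, hd⟩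
    have hns : Nonsplit (tr s) := by
      rcases hd.exists_nonsplit hF' with h | h <;> rwa [(hy _).tr_eq] at h
    have hns' : ∀ i, Nonsplit (tr (y i)) := fun i ↦ by rwa [(hy i).tr_eq]
    refine exists_common_of_even h2 (hns' 0) ((hy 1).tr_eq.trans (hy 0).tr_eq.symm)
      (Dominates.independent (by omega) (hns' 0).not_isScalar (hns' 1).not_isScalar ?_)
    intro x hx
    obtain ⟨i, hi⟩ := hd x hx
    refine ⟨i, ?_⟩
    fin_cases i <;> exact hi

/-! ### Dominating pairs for q odd. -/

section odd

lemma goodTraces_nonempty (hF : 5 ≤ Fintype.card F) (h2 : (2 : F) ≠ 0) {τ : F} (hτ : Nonsplit τ) :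
    0 < (goodTraces τ).card := by
  have := card_goodTraces h2 hτ
  split_ifs at this <;> omega

theorem uniformDominationNumber_of_odd (hF : Odd (Fintype.card F)) (hF' : 11 ≤ Fintype.card F) :
    uniformDominationNumber PSL(2, F) = 2 := by
  refine uniformDominationNumber_eq ?_ not_hasUDS_one
  obtain ⟨s, hs⟩ := exists_isTorusGenerator (F := F)
  have h2 := two_ne_zero_iff_odd.2 hF
  have hc : 0 < (indepClass (tr s) s).card := by
    rw [card_indepClass h2 hs.1 rfl]
    exact Nat.mul_pos (goodTraces_nonempty (by omega) h2 hs.1) (by omega)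
  obtain ⟨B, hB⟩ := Finset.card_pos.1 hc
  rw [mem_indepClass] at hB
  refine ⟨s, hs.1.not_isScalar, ![s, B], ?_, hB.2.dominates hs (hs.of_tr_eq hB.1) (.inr hF')⟩
  intro i
  fin_cases i
  · exact exists_conj_of_tr_eq hs.1 rfl
  · exact exists_conj_of_tr_eq hs.1 hB.1

/-! ### Probabilities -/

open Classical in
/-- The dominating pairs in a trace class. -/
noncomputable def dominatingPairs (τ : F) : Finset (SL(2, F) × SL(2, F)) :=
  (traceClass τ ×ˢ traceClass τ).filter fun p ↦ Dominates ![p.1, p.2]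

open Classical in
/-- The independent pairs in a trace class. -/
noncomputable def independentPairs (τ : F) : Finset (SL(2, F) × SL(2, F)) :=
  (traceClass τ ×ˢ traceClass τ).filter fun p ↦ Independent p.1 p.2

lemma card_independentPairs (h2 : (2 : F) ≠ 0) {τ : F} (hτ : Nonsplit τ) :
    (independentPairs τ).card = Fintype.card F * (Fintype.card F - 1) *
      ((goodTraces τ).card * (Fintype.card F + 1)) := by
  classical
  rw [independentPairs, Finset.card_filter, Finset.sum_product]
  have : ∀ A ∈ traceClass τ, ∑ B ∈ traceClass τ, (if Independent A B then 1 else 0) =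
      (goodTraces τ).card * (Fintype.card F + 1) := by
    intro A hA
    rw [← card_indepClass h2 hτ (mem_traceClass.1 hA), ← Finset.card_filter]
    congr 1
  rw [Finset.sum_congr rfl this, Finset.sum_const, card_traceClass hτ, smul_eq_mul]

lemma dominatingPairs_subset (hF : 3 ≤ Fintype.card F) {τ : F} (hτ : Nonsplit τ) :
    dominatingPairs τ ⊆ independentPairs τ := by
  intro p hp
  simp only [dominatingPairs, independentPairs, Finset.mem_filter, Finset.mem_product,
    mem_traceClass] at *
  exact ⟨hp.1, hp.2.independent hF (hp.1.1 ▸ hτ : Nonsplit _).not_isScalar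
    (hp.1.2 ▸ hτ : Nonsplit _).not_isScalar⟩

lemma dominatingPairs_eq (hF : 11 ≤ Fintype.card F) {s : SL(2, F)} (hs : IsTorusGenerator s) :
    dominatingPairs (tr s) = independentPairs (tr s) := by
  refine (dominatingPairs_subset (by omega) hs.1).antisymm fun p hp ↦ ?_
  simp only [dominatingPairs, independentPairs, Finset.mem_filter, Finset.mem_product,
    mem_traceClass] at *
  exact ⟨hp.1, hp.2.dominates (hs.of_tr_eq hp.1.1) (hs.of_tr_eq hp.1.2) (.inr hF)⟩

/-- Lifts differ by a sign, which would change the trace from τ to -τ ≠ τ. So classes in the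
quotient can be counted in SL(2,q). -/
lemma mk_injOn_trace (h2 : (2 : F) ≠ 0) {τ : F} (hτ : τ ≠ 0) {A B : SL(2, F)} (hA : tr A = τ)
    (hB : tr B = τ) (h : (A : PSL(2, F)) = B) : A = B := by
  rcases mk_eq_mk_iff.1 h with h | h
  · exact h
  · exfalso
    rw [h, tr_neg, hB] at hA
    exact (mul_ne_zero h2 hτ) (by linear_combination -hA)

lemma mem_conjugatesOf_iff {y : SL(2, F)} (hy : Nonsplit (tr y)) {z : PSL(2, F)} :
    z ∈ conjugatesOf (y : PSL(2, F)) ↔ ∃ A : SL(2, F), tr A = tr y ∧ (A : PSL(2, F)) = z := by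
  change IsConj _ _ ↔ _
  rw [isConj_mk_iff]
  exact exists_congr fun A ↦ and_congr_left fun _ ↦
    ⟨ConjTo.tr_eq, exists_conj_of_tr_eq hy⟩

lemma card_conjugatesOf (h2 : (2 : F) ≠ 0) {y : SL(2, F)} (hy : Nonsplit (tr y))
    (h0 : tr y ≠ 0) :
    Nat.card (conjugatesOf (y : PSL(2, F))) = Fintype.card F * (Fintype.card F - 1) := by
  rw [← card_traceClass hy]
  symm
  rw [← Fintype.card_coe, ← Nat.card_eq_fintype_card]
  refine Nat.card_congr (Equiv.ofBijective
    (fun A : traceClass (tr y) ↦ (⟨((A : SL(2, F)) : PSL(2, F)),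
      (mem_conjugatesOf_iff hy).2 ⟨A.1, mem_traceClass.1 A.2, rfl⟩⟩ :
        conjugatesOf (y : PSL(2, F)))) ⟨?_, ?_⟩)
  · rintro ⟨A, hA⟩ ⟨B, hB⟩ e
    rw [mem_traceClass] at hA hB
    exact Subtype.ext (mk_injOn_trace h2 h0 hA hB (congrArg Subtype.val e))
  · rintro ⟨z, hz⟩
    obtain ⟨A, hA, rfl⟩ := (mem_conjugatesOf_iff hy).1 hz
    exact ⟨⟨A, mem_traceClass.2 hA⟩, rfl⟩

lemma card_uds_pairs (h2 : (2 : F) ≠ 0) {y : SL(2, F)} (hy : Nonsplit (tr y)) (h0 : tr y ≠ 0) :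
    Nat.card {x : Fin 2 → PSL(2, F) // (∀ i, x i ∈ conjugatesOf (y : PSL(2, F))) ∧
      IsUniformDominatingSet (Set.range x)} = (dominatingPairs (tr y)).card := by
  symm
  rw [← Fintype.card_coe, ← Nat.card_eq_fintype_card]
  have hmem : ∀ p ∈ dominatingPairs (tr y), tr p.1 = tr y ∧ tr p.2 = tr y ∧
      Dominates ![p.1, p.2] := fun p hp ↦ by
    simpa [dominatingPairs, and_assoc] using hp
  refine Nat.card_congr (Equiv.ofBijective
    (fun p : dominatingPairs (tr y) ↦ ⟨fun i ↦ ((![p.1.1, p.1.2] i : SL(2, F)) : PSL(2, F)),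
      ?_, ?_⟩) ⟨?_, ?_⟩)
  · intro i
    rw [mem_conjugatesOf_iff hy]
    obtain ⟨h1, h3, -⟩ := hmem _ p.2
    fin_cases i
    exacts [⟨_, h1, rfl⟩, ⟨_, h3, rfl⟩]
  · obtain ⟨h1, h3, h4⟩ := hmem _ p.2
    refine h4.isUniformDominatingSet hy.not_isScalar fun i ↦ ?_
    fin_cases i
    exacts [exists_conj_of_tr_eq hy h1, exists_conj_of_tr_eq hy h3]
  · rintro ⟨p, hp⟩ ⟨r, hr⟩ e
    obtain ⟨h1, h3, -⟩ := hmem _ hp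
    obtain ⟨h5, h6, -⟩ := hmem _ hr
    have e' := congrArg Subtype.val e
    exact Subtype.ext (Prod.ext (mk_injOn_trace h2 h0 h1 h5 (congrFun e' 0))
      (mk_injOn_trace h2 h0 h3 h6 (congrFun e' 1)))
  · rintro ⟨x, hx, hu⟩
    obtain ⟨A, hA, hA'⟩ := (mem_conjugatesOf_iff hy).1 (hx 0)
    obtain ⟨B, hB, hB'⟩ := (mem_conjugatesOf_iff hy).1 (hx 1)
    have hAB : (fun i ↦ ((![A, B] i : SL(2, F)) : PSL(2, F))) = x := by
      funext i
      fin_cases i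
      exacts [hA', hB']
    refine ⟨⟨(A, B), ?_⟩, Subtype.ext hAB⟩
    have hd : Dominates ![A, B] := IsUniformDominatingSet.dominates (by rwa [hAB])
    simpa [dominatingPairs, hA, hB] using hd

lemma udsProb_of_nonsplit (h2 : (2 : F) ≠ 0) {y : SL(2, F)} (hy : Nonsplit (tr y))
    (h0 : tr y ≠ 0) : udsProb PSL(2, F) (y : PSL(2, F)) 2 =
      (dominatingPairs (tr y)).card / ((Fintype.card F : ℝ) * (Fintype.card F - 1)) ^ 2 := by
  rw [udsProb, card_uds_pairs h2 hy h0, card_conjugatesOf h2 hy h0, Nat.cast_mul,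
    Nat.cast_sub Fintype.card_pos, Nat.cast_one]

/-- Two elements with eigenvectors have fixed points p and r, and some nonscalar matrix fixes both.
In a class of involutions no two members generate the group. -/
lemma udsProb_eq_zero (hF : 4 ≤ Fintype.card F) {y : SL(2, F)}
    (h : ¬ Nonsplit (tr y) ∨ tr y = 0) : udsProb PSL(2, F) (y : PSL(2, F)) 2 = 0 := by
  rw [udsProb, div_eq_zero_iff]
  left
  rw [Nat.cast_eq_zero, Nat.card_eq_zero]
  left
  refine ⟨fun ⟨x, hx, hu⟩ ↦ ?_⟩
  have hlift : ∀ i, ∃ A, ConjTo y A ∧ (A : PSL(2, F)) = x i := fun i ↦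
    isConj_mk_iff.1 (hx i)
  choose A hA hAx using hlift
  have hd : Dominates A := IsUniformDominatingSet.dominates (by simpa only [hAx] using hu)
  have hns : Nonsplit (tr y) := by
    rcases hd.exists_nonsplit hF with h | h <;> rwa [(hA _).tr_eq] at h
  have h0 := h.resolve_left (not_not.2 hns)
  have hs : ¬ IsScalar (A 0) := (hA 0).not_isScalar hns.not_isScalar
  obtain ⟨i, hi⟩ := hd (A 0) hs
  exact not_generates_of_tr_eq_zero (by omega) hs ((hA 0).tr_eq.trans h0) ((hA i).tr_eq.trans h0) hi

/-- Every dominating pair is independent, and the number of independent pairs is the same for all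
nonsplit traces. A class of torus generators attains it. -/
theorem maxUdsProb_eq (hF : Odd (Fintype.card F)) (hF' : 11 ≤ Fintype.card F) {g : ℕ}
    (hg : ∀ τ : F, Nonsplit τ → (goodTraces τ).card = g) :
    maxUdsProb PSL(2, F) 2 = (g * ((Fintype.card F : ℝ) + 1)) /
      (Fintype.card F * (Fintype.card F - 1)) := by
  have h2 := two_ne_zero_iff_odd.2 hF
  have hq : (11 : ℝ) ≤ Fintype.card F := by exact_mod_cast hF'
  have hpos : 0 < (Fintype.card F : ℝ) * (Fintype.card F - 1) := by nlinarith
  have hval : ∀ τ : F, Nonsplit τ → ((independentPairs τ).card : ℝ) /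
      ((Fintype.card F : ℝ) * (Fintype.card F - 1)) ^ 2 = (g * ((Fintype.card F : ℝ) + 1)) /
      (Fintype.card F * (Fintype.card F - 1)) := by
    intro τ hτ
    rw [card_independentPairs h2 hτ, hg τ hτ]
    push_cast [Nat.cast_sub (Fintype.card_pos (α := F))]
    field_simp
  have hle : ∀ s : PSL(2, F), udsProb PSL(2, F) s 2 ≤ (g * ((Fintype.card F : ℝ) + 1)) /
      (Fintype.card F * (Fintype.card F - 1)) := by
    intro s
    obtain ⟨y, rfl⟩ := exists_lift s
    by_cases h : Nonsplit (tr y) ∧ tr y ≠ 0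
    · rw [udsProb_of_nonsplit h2 h.1 h.2, ← hval _ h.1]
      gcongr
      exact dominatingPairs_subset (by omega) h.1
    · rw [udsProb_eq_zero (by omega) (by tauto)]
      positivity
  apply le_antisymm
  · exact ciSup_le hle
  · obtain ⟨s, hs⟩ := exists_isTorusGenerator (F := F)
    refine le_trans (le_of_eq ?_) (le_ciSup (f := fun s : PSL(2, F) ↦ udsProb PSL(2, F) s 2)
      ⟨_, Set.forall_mem_range.2 hle⟩ (s : PSL(2, F)))
    rw [udsProb_of_nonsplit h2 hs.1 (hs.tr_ne_zero (by omega)), dominatingPairs_eq hF' hs,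
      hval _ hs.1]

theorem maxUdsProb_of_one_mod_four (hF : Fintype.card F % 4 = 1) (hF' : 11 ≤ Fintype.card F) :
    maxUdsProb PSL(2, F) 2 = 1 / 2 * (1 + 1 / (Fintype.card F : ℝ)) := by
  have hodd : Odd (Fintype.card F) := Nat.odd_iff.2 (by omega)
  have hq : (11 : ℝ) ≤ Fintype.card F := by exact_mod_cast hF'
  have h1 : IsSquare (-1 : F) := FiniteField.isSquare_neg_one_iff.2 (by omega)
  rw [maxUdsProb_eq hodd hF' (g := (Fintype.card F - 1) / 2) fun τ hτ ↦ by
    have := card_goodTraces (two_ne_zero_iff_odd.2 hodd) hτ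
    rw [if_pos h1] at this; omega]
  have h3 : (((Fintype.card F - 1) / 2 : ℕ) : ℝ) = ((Fintype.card F : ℝ) - 1) / 2 := by
    rw [eq_div_iff two_ne_zero, eq_sub_iff_add_eq]
    exact_mod_cast (by omega : (Fintype.card F - 1) / 2 * 2 + 1 = Fintype.card F)
  rw [h3]
  have : (Fintype.card F : ℝ) - 1 ≠ 0 := by intro h; linarith
  have : (Fintype.card F : ℝ) ≠ 0 := by intro h; linarith
  field_simp

theorem maxUdsProb_of_three_mod_four (hF : Fintype.card F % 4 = 3) (hF' : 11 ≤ Fintype.card F) :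
    maxUdsProb PSL(2, F) 2 = 1 / 2 * (1 - ((Fintype.card F : ℝ) + 3) /
      ((Fintype.card F : ℝ) * ((Fintype.card F : ℝ) - 1))) := by
  have hodd : Odd (Fintype.card F) := Nat.odd_iff.2 (by omega)
  have hq : (11 : ℝ) ≤ Fintype.card F := by exact_mod_cast hF'
  have h1 : ¬ IsSquare (-1 : F) := by rw [FiniteField.isSquare_neg_one_iff]; omega
  rw [maxUdsProb_eq hodd hF' (g := (Fintype.card F - 3) / 2) fun τ hτ ↦ by
    have := card_goodTraces (two_ne_zero_iff_odd.2 hodd) hτ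
    rw [if_neg h1] at this; omega]
  have h3 : (((Fintype.card F - 3) / 2 : ℕ) : ℝ) = ((Fintype.card F : ℝ) - 3) / 2 := by
    rw [eq_div_iff two_ne_zero, eq_sub_iff_add_eq]
    exact_mod_cast (by omega : (Fintype.card F - 3) / 2 * 2 + 3 = Fintype.card F)
  rw [h3]
  have : (Fintype.card F : ℝ) - 1 ≠ 0 := by intro h; linarith
  have : (Fintype.card F : ℝ) ≠ 0 := by intro h; linarith
  field_simp
  ring

theorem maxUdsProb_ge (hF : Odd (Fintype.card F)) (hF' : 11 ≤ Fintype.card F) :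
    24 / 55 ≤ maxUdsProb PSL(2, F) 2 ∧
      (maxUdsProb PSL(2, F) 2 = 24 / 55 ↔ Fintype.card F = 11) := by
  have hq : (11 : ℝ) ≤ Fintype.card F := by exact_mod_cast hF'
  rcases Nat.odd_mod_four_iff.1 (Nat.odd_iff.1 hF) with h | h
  · rw [maxUdsProb_of_one_mod_four h hF']
    have h1 : 0 < 1 / (Fintype.card F : ℝ) := by positivity
    refine ⟨by linarith, fun e ↦ by linarith, fun e ↦ by omega⟩
  · rw [maxUdsProb_of_three_mod_four h hF']
    set q : ℝ := (Fintype.card F : ℝ) with hqd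
    have hpos : 0 < q * (q - 1) := by nlinarith
    -- After clearing denominators this is (q - 11)(7q + 15) ≥ 0.
    have h1 : (q + 3) / (q * (q - 1)) ≤ 7 / 55 := by
      rw [div_le_div_iff₀ hpos (by norm_num)]; nlinarith
    refine ⟨by linarith, fun e ↦ ?_, fun e ↦ ?_⟩
    · have h3 : (q + 3) / (q * (q - 1)) = 7 / 55 := by linarith
      rw [div_eq_div_iff hpos.ne' (by norm_num)] at h3
      have h4 : (q - 11) * (7 * q + 15) = 0 := by linear_combination -h3
      rcases mul_eq_zero.1 h4 with h5 | h5
      · have : q = 11 := by linarith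
        rw [hqd] at this; exact_mod_cast this
      · exfalso; nlinarith
    · have : q = 11 := by rw [hqd, e]; norm_num
      rw [this]; norm_num

end odd

end uds

end SL2

namespace SL2

open Matrix Matrix.SpecialLinearGroup OnePoint

/-! ### Transport along isomorphisms -/

section transport

variable {K F : Type*} [Field K] [Field F]

lemma isScalar_map_iff (φ : SL(2, K) ≃* SL(2, F)) {x : SL(2, K)} :
    IsScalar (φ x) ↔ IsScalar x := by
  rw [← mem_center_iff_isScalar, ← mem_center_iff_isScalar, Subgroup.mem_center_iff,
    Subgroup.mem_center_iff]
  constructor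
  · intro h g
    apply φ.injective
    rw [map_mul, map_mul, h]
  · intro h g
    obtain ⟨g, rfl⟩ := φ.surjective g
    rw [← map_mul, ← map_mul, h]

lemma Generates.map (φ : SL(2, K) ≃* SL(2, F)) {x y : SL(2, K)} (h : Generates x y) :
    Generates (φ x) (φ y) := by
  refine generates_iff.2 fun Γ hc hx hy ↦ ?_
  have h1 := generates_iff.1 h (Γ.comap φ.toMonoidHom) (fun z hz ↦ hc (by
    rw [mem_center_iff_isScalar] at *
    exact (isScalar_map_iff φ).2 hz)) hx hy
  rw [eq_top_iff]
  intro g _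
  obtain ⟨g, rfl⟩ := φ.surjective g
  exact (h1 ▸ Subgroup.mem_top g : g ∈ Γ.comap φ.toMonoidHom)

lemma Dominates.map (φ : SL(2, K) ≃* SL(2, F)) {n : ℕ} {y : Fin n → SL(2, K)} (h : Dominates y) :
    Dominates fun i ↦ φ (y i) := by
  intro x hx
  obtain ⟨x, rfl⟩ := φ.surjective x
  rw [isScalar_map_iff] at hx
  obtain ⟨i, hi⟩ := h x hx
  exact ⟨i, hi.map φ⟩

lemma ConjTo.map (φ : SL(2, K) ≃* SL(2, F)) {s y : SL(2, K)} (h : ConjTo s y) :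
    ConjTo (φ s) (φ y) := by
  obtain ⟨g, rfl⟩ := h
  exact ⟨φ g, by simp⟩

lemma HasUDS.map (φ : SL(2, K) ≃* SL(2, F)) {n : ℕ} (h : HasUDS K n) : HasUDS F n := by
  obtain ⟨s, hs, y, hy, hd⟩ := h
  exact ⟨φ s, by rwa [isScalar_map_iff], fun i ↦ φ (y i), fun i ↦ (hy i).map φ, hd.map φ⟩

/-- The isomorphism of special linear groups induced by a ring isomorphism. -/
noncomputable def mapEquiv (e : K ≃+* F) : SL(2, K) ≃* SL(2, F) :=
  MulEquiv.ofBijective (Matrix.SpecialLinearGroup.map (n := Fin 2) (e : K →+* F)) (by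
    refine Function.bijective_iff_has_inverse.2
      ⟨Matrix.SpecialLinearGroup.map (n := Fin 2) (e.symm : F →+* K), fun A ↦ ?_, fun A ↦ ?_⟩
    · ext i j; simp
    · ext i j; simp)

lemma hasUDS_iff_of_ringEquiv (e : K ≃+* F) {n : ℕ} : HasUDS K n ↔ HasUDS F n :=
  ⟨fun h ↦ h.map (mapEquiv e), fun h ↦ h.map (mapEquiv e.symm)⟩

/-- Conjugation by `diag (d, 1)`. -/
def twist (d : K) (hd : d ≠ 0) : SL(2, K) ≃* SL(2, K) where
  toFun A := ofEntries (A 0 0) (d * A 0 1) (d⁻¹ * A 1 0) (A 1 1) (by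
    have := det_eq A; field_simp; linear_combination this)
  invFun A := ofEntries (A 0 0) (d⁻¹ * A 0 1) (d * A 1 0) (A 1 1) (by
    have := det_eq A; field_simp; linear_combination this)
  left_inv A := by apply ext_entries <;> simp [hd]
  right_inv A := by apply ext_entries <;> simp [hd]
  map_mul' A B := by
    apply ext_entries <;> simp
    · field_simp
    · ring
    · ring
    · field_simp

end transport

/-! ### Dominating tuples and subgroups of small index -/

section index

variable {F : Type*} [Field F] [Fintype F] [DecidableEq F]

/-- Every one of the q trace classes has at least q(q - 1) elements. -/
lemma le_card : Fintype.card F ^ 2 * (Fintype.card F - 1) ≤ Nat.card SL(2, F) := by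
  classical
  rw [Nat.card_eq_fintype_card, ← Finset.card_univ (α := SL(2, F)),
    Finset.card_eq_sum_card_fiberwise (f := tr) (t := Finset.univ) (fun _ _ ↦ Finset.mem_univ _)]
  calc Fintype.card F ^ 2 * (Fintype.card F - 1) =
      ∑ τ : F, Fintype.card F * (Fintype.card F - 1) := by
        rw [Finset.sum_const, Finset.card_univ, smul_eq_mul]; ring
    _ ≤ _ := Finset.sum_le_sum fun τ _ ↦
      (le_card_traceClass τ).trans_eq (congrArg _ (by ext; simp))

lemma ConjTo.trans {s y z : SL(2, F)} (h : ConjTo s y) (h' : ConjTo y z) : ConjTo s z := by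
  obtain ⟨g, rfl⟩ := h
  obtain ⟨k, rfl⟩ := h'
  exact ⟨k * g, by group⟩

/-- Few conjugates of an element lying in a subgroup of small index do not dominate. -/
lemma not_dominates_of_index {Γ : Subgroup SL(2, F)} (hc : Subgroup.center SL(2, F) ≤ Γ)
    (hΓ : Γ ≠ ⊤) {n c : ℕ} (hidx : Γ.index ≤ n)
    (hn : n ^ c * 2 < Fintype.card F ^ 2 * (Fintype.card F - 1)) {s : SL(2, F)} (hs : s ∈ Γ)
    {y : Fin c → SL(2, F)} (hy : ∀ i, ConjTo s (y i)) : ¬ Dominates y := by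
  intro hd
  choose g hg using hy
  let Δ : Fin c → Subgroup SL(2, F) := fun i ↦ Γ.map (MulAut.conj (g i)).toMonoidHom
  have hmem : ∀ i x, x ∈ Δ i ↔ (g i)⁻¹ * x * g i ∈ Γ := by
    intro i x
    simp only [Δ, Subgroup.mem_map]
    constructor
    · rintro ⟨z, hz, rfl⟩
      have : (g i)⁻¹ * ((MulAut.conj (g i)).toMonoidHom z) * g i = z := by simp [mul_assoc]
      rwa [this]
    · intro h
      exact ⟨_, h, by simp [mul_assoc]⟩
  -- The conjugates of Γ containing the y i intersect in a subgroup of index at most n^c. It has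
  -- more than two elements, hence a nonscalar one, which generates the group with none of the y i.
  have h1 : (⨅ i, Δ i).index ≤ n ^ c := by
    refine (Subgroup.index_iInf_le Δ).trans ?_
    calc ∏ i, (Δ i).index ≤ ∏ _i : Fin c, n := Finset.prod_le_prod' fun i _ ↦ by
          rw [Subgroup.index_map_of_bijective (MulAut.conj (g i)).bijective]; exact hidx
      _ = n ^ c := by simp
  have h2 := Subgroup.card_mul_index (⨅ i, Δ i)
  have h3 := le_card (F := F)
  have h4 : 2 < Nat.card (⨅ i, Δ i : Subgroup SL(2, F)) := by
    by_contra! h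
    have := Nat.mul_le_mul h h1
    rw [h2] at this
    omega
  obtain ⟨x, hx, hxs⟩ : ∃ x ∈ ⨅ i, Δ i, ¬ IsScalar x := by
    by_contra! h
    have h5 : ((⨅ i, Δ i : Subgroup SL(2, F)) : Set SL(2, F)) ⊆ {1, -1} := fun x hx ↦ by
      simpa using isScalar_iff_eq.1 (h x hx)
    have h6 := Set.ncard_le_ncard h5 (Set.toFinite _)
    have h7 : ({1, -1} : Set SL(2, F)).ncard ≤ 2 := (Set.ncard_insert_le _ _).trans (by simp)
    rw [← Nat.card_coe_set_eq] at h6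
    exact absurd (h4.trans_le h6) (by omega)
  obtain ⟨i, hi⟩ := hd x hxs
  rw [Subgroup.mem_iInf] at hx
  refine not_generates_of_mem (Γ := Δ i) (fun z hz ↦ ?_) (hx i) ?_ ?_ hi
  · rw [hmem]
    refine hc ?_
    have := Subgroup.mem_center_iff.1 hz (g i)⁻¹
    rw [this, inv_mul_cancel_right]
    exact hz
  · rw [hmem, ← hg i]
    convert hs using 1
    group
  · intro h
    apply hΓ
    rw [← Subgroup.index_eq_one] at h ⊢
    rwa [Subgroup.index_map_of_bijective (MulAut.conj (g i)).bijective] at h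

open scoped Pointwise in
/-- A union of left cosets that is stable under generators is everything. -/
lemma index_le_of_reps {Γ : Subgroup SL(2, F)} {ι : Type*} [Fintype ι] (t : ι → SL(2, F))
    (h0 : ∃ j, t j ∈ Γ) {B : Set F} (hB : AddSubgroup.closure B = ⊤)
    (hu : ∀ b ∈ B, ∀ j, ∃ k, (t k)⁻¹ * upper b * t j ∈ Γ) {w : SL(2, F)}
    (hw0 : w 1 0 ≠ 0) (hw : ∀ j, ∃ k, (t k)⁻¹ * w * t j ∈ Γ) : Γ.index ≤ Fintype.card ι := by
  have key : ∀ g : SL(2, F), (∀ j, ∃ k, (t k)⁻¹ * g * t j ∈ Γ) →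
      g ∈ MulAction.stabilizer SL(2, F) {x : SL(2, F) | ∃ j, (t j)⁻¹ * x ∈ Γ} := by
    intro g hg
    rw [MulAction.mem_stabilizer_set_iff_smul_set_subset (Set.toFinite _)]
    rintro _ ⟨x, ⟨j, hj⟩, rfl⟩
    obtain ⟨k, hk⟩ := hg j
    refine ⟨k, ?_⟩
    have := Γ.mul_mem hk hj
    simpa [mul_assoc] using this
  have htop := eq_top_of_upper (fun b ↦ (AddSubgroup.closure_le (upperGroup (MulAction.stabilizer SL(2, F)
      {x : SL(2, F) | ∃ j, (t j)⁻¹ * x ∈ Γ}))).2 (fun b hb ↦ key _ (hu b hb))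
      (hB ▸ AddSubgroup.mem_top b)) (key _ hw) hw0
  obtain ⟨j₀, hj₀⟩ := h0
  have hall : ∀ x : SL(2, F), ∃ j, (t j)⁻¹ * x ∈ Γ := by
    intro x
    have h1 : x * (t j₀)⁻¹ ∈ MulAction.stabilizer SL(2, F)
      {x : SL(2, F) | ∃ j, (t j)⁻¹ * x ∈ Γ} := htop ▸ Subgroup.mem_top _
    rw [MulAction.mem_stabilizer_set_iff_smul_set_subset (Set.toFinite _)] at h1
    have h2 := h1 ⟨t j₀, ⟨j₀, by simp⟩, rfl⟩
    simpa using h2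
  rw [Subgroup.index, ← Nat.card_eq_fintype_card]
  refine Nat.card_le_card_of_surjective (fun j ↦ (t j : SL(2, F) ⧸ Γ)) fun x ↦ ?_
  obtain ⟨x, rfl⟩ := QuotientGroup.mk_surjective x
  obtain ⟨j, hj⟩ := hall x
  exact ⟨j, QuotientGroup.eq.2 hj⟩

end index

/-! ### Stabilisers of lists of matrices, for explicit computations -/

section quad

/-- The entries of a two by two matrix, row by row. -/
abbrev Quad (K : Type*) := K × K × K × K

variable {K : Type*} [Field K]

/-- The list of entries of a matrix. -/
def quad (A : SL(2, K)) : Quad K := (A 0 0, A 0 1, A 1 0, A 1 1)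

/-- Matrix multiplication. -/
def qmul (x y : Quad K) : Quad K :=
  (x.1 * y.1 + x.2.1 * y.2.2.1, x.1 * y.2.1 + x.2.1 * y.2.2.2,
    x.2.2.1 * y.1 + x.2.2.2 * y.2.2.1, x.2.2.1 * y.2.1 + x.2.2.2 * y.2.2.2)

/-- The adjugate matrix. -/
def qadj (x : Quad K) : Quad K := (x.2.2.2, -x.2.1, -x.2.2.1, x.1)

lemma quad_mul (A B : SL(2, K)) : quad (A * B) = qmul (quad A) (quad B) := by
  simp [quad, qmul]

lemma quad_inv (A : SL(2, K)) : quad A⁻¹ = qadj (quad A) := by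
  simp [quad, qadj]

lemma quad_injective : Function.Injective (quad (K := K)) := fun A B h ↦ by
  simp only [quad, Prod.mk_inj] at h
  exact ext_entries h.1 h.2.1 h.2.2.1 h.2.2.2

lemma qmul_assoc (x y z : Quad K) : qmul (qmul x y) z = qmul x (qmul y z) := by
  simp only [qmul, Prod.mk_inj]
  refine ⟨?_, ?_, ?_, ?_⟩ <;> ring

lemma qadj_qmul (x y : Quad K) : qadj (qmul x y) = qmul (qadj y) (qadj x) := by
  simp only [qmul, qadj, Prod.mk_inj]
  refine ⟨?_, ?_, ?_, ?_⟩ <;> ring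

lemma quad_one_qmul (x : Quad K) : qmul (quad 1) x = x := by
  obtain ⟨a, b, c, d⟩ := x
  simp [quad, qmul]

lemma qmul_quad_one (x : Quad K) : qmul x (quad 1) = x := by
  obtain ⟨a, b, c, d⟩ := x
  simp [quad, qmul]

/-- Conjugation by `g`, up to a factor `det g`. -/
def qconj (g m : Quad K) : Quad K := qmul (qmul g m) (qadj g)

lemma qconj_mul (g h : SL(2, K)) (m : Quad K) :
    qconj (quad (g * h)) m = qconj (quad g) (qconj (quad h) m) := by
  simp only [qconj, quad_mul, qadj_qmul, qmul_assoc]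

lemma qconj_one (m : Quad K) : qconj (quad 1) m = m := by
  rw [qconj, quad_one_qmul, ← quad_inv, inv_one, qmul_quad_one]

/-- The elements permuting a finite set of matrices by conjugation. -/
def conjStabilizer (L : List (Quad K)) : Subgroup SL(2, K) where
  carrier := {g | ∀ m ∈ L, qconj (quad g) m ∈ L}
  one_mem' m hm := by rwa [qconj_one]
  mul_mem' {a b} ha hb m hm := by rw [qconj_mul]; exact ha _ (hb m hm)
  inv_mem' {a} ha m hm := by
    classical
    have hinj : Function.Injective (qconj (quad a)) := fun x y h ↦ by
      have := congrArg (qconj (quad a⁻¹)) h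
      simpa [← qconj_mul, qconj_one] using this
    -- An injective map of a finite set into itself is onto, so the inverse also preserves the list.
    have him : L.toFinset.image (qconj (quad a)) = L.toFinset := by
      refine Finset.eq_of_subset_of_card_le (fun x hx ↦ ?_)
        (Finset.card_image_of_injective _ hinj).ge
      obtain ⟨z, hz, rfl⟩ := Finset.mem_image.1 hx
      exact List.mem_toFinset.2 (ha z (List.mem_toFinset.1 hz))
    obtain ⟨z, hz, rfl⟩ := Finset.mem_image.1 (him.symm ▸ List.mem_toFinset.2 hm)
    rw [← qconj_mul, inv_mul_cancel, qconj_one]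
    exact List.mem_toFinset.1 hz

lemma mem_conjStabilizer {L : List (Quad K)} {g : SL(2, K)} :
    g ∈ conjStabilizer L ↔ ∀ m ∈ L, qconj (quad g) m ∈ L := Iff.rfl

lemma center_le_conjStabilizer (L : List (Quad K)) :
    Subgroup.center SL(2, K) ≤ conjStabilizer L := by
  intro z hz m hm
  rw [mem_center_iff_isScalar, isScalar_iff_eq] at hz
  rcases hz with rfl | rfl
  · rwa [qconj_one]
  · have : qconj (quad (-1 : SL(2, K))) m = m := by
      obtain ⟨a, b, c, d⟩ := m
      simp [quad, qconj, qmul, qadj]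
    rwa [this]

lemma neg_mem_conjStabilizer {L : List (Quad K)} {g : SL(2, K)} (h : g ∈ conjStabilizer L) :
    -g ∈ conjStabilizer L := by
  rw [← neg_one_mul]
  exact (conjStabilizer L).mul_mem (center_le_conjStabilizer L
    (mem_center_iff_isScalar.2 (isScalar_iff_eq.2 (.inr rfl)))) h

end quad

/-! ### Fields with five and seven elements -/

section prime

variable {F : Type*} [Field F] [Fintype F] [DecidableEq F]

/-- Three unipotent elements with different fixed points suffice: a nonscalar x fixes at most two
points, and it generates with a unipotent whose fixed point it moves. -/
lemma hasUDS_three_of_prime (hp : (Fintype.card F).Prime) : HasUDS F 3 := by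
  classical
  choose g hg using fun p : OnePoint F ↦ exists_smul_infty_eq p
  let p : Fin 3 → OnePoint F := ![∞, (0 : F), (1 : F)]
  have hpinj : Function.Injective p := by
    intro i j h
    fin_cases i <;> fin_cases j <;> simp_all [p]
  refine ⟨upper 1, fun h ↦ one_ne_zero h.1, fun i ↦ g (p i) * upper 1 * (g (p i))⁻¹,
    fun i ↦ ⟨_, rfl⟩, fun x hx ↦ ?_⟩
  by_contra! hc
  have hfix : ∀ i, x • p i = p i := by
    intro i
    by_contra h
    refine hc i (generates_conj_upper_one hp ?_)
    rwa [hg]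
  have h1 : (Finset.univ.image p).card ≤ (fixedPts x).card := Finset.card_le_card fun z hz ↦ by
    obtain ⟨i, -, rfl⟩ := Finset.mem_image.1 hz
    exact mem_fixedPts.2 (hfix i)
  rw [Finset.card_image_of_injective _ hpinj, Finset.card_univ, Fintype.card_fin] at h1
  have := card_fixedPts_le_two hx
  omega

end prime

instance : Fact (Nat.Prime 5) := ⟨by norm_num⟩
instance : Fact (Nat.Prime 7) := ⟨by norm_num⟩

/-- Orthogonal triples of involutions are blocks of imprimitivity; this bounds the index of their
stabilisers in terms of unipotent coset representatives. -/
lemma index_conjStabilizer_le {p : ℕ} [Fact p.Prime] (L : List (Quad (ZMod p)))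
    (h : ∀ j : ZMod p, ∃ k : ZMod p, ∀ m ∈ L,
      qconj (qmul (1, -k, 0, 1) (qmul (0, -1, 1, 0) (1, j, 0, 1))) m ∈ L) :
    (conjStabilizer L).index ≤ p := by
  have := index_le_of_reps (Γ := conjStabilizer L) (fun j : ZMod p ↦ upper j)
    ⟨0, by convert (conjStabilizer L).one_mem using 1; apply ext_entries <;> simp⟩
    (B := Set.univ) (by simp) (fun b _ j ↦ ⟨b + j, by
      convert (conjStabilizer L).one_mem using 1
      rw [mul_assoc, upper_mul, inv_mul_cancel]⟩)
    (w := ofEntries 0 (-1) 1 0 (by ring)) one_ne_zero (fun j ↦ by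
      obtain ⟨k, hk⟩ := h j
      refine ⟨k, fun m hm ↦ ?_⟩
      convert hk m hm using 2
      rw [mul_assoc, upper_inv, quad_mul, quad_mul]
      simp [quad])
  rwa [ZMod.card] at this

lemma not_hasUDS_two_zmod_five : ¬ HasUDS (ZMod 5) 2 := by
  rintro ⟨s, hs, y, hy, hd⟩
  have hc5 : Fintype.card (ZMod 5) = 5 := ZMod.card 5
  have hns : Nonsplit (tr s) := by
    rcases hd.exists_nonsplit (by omega) with h | h <;> rwa [(hy _).tr_eq] at h
  have htr : tr s = 1 ∨ tr s = -1 := by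
    revert hns
    generalize tr s = τ
    unfold Nonsplit
    revert τ
    decide +kernel
  -- These are the noncentral elements of a quaternion group of order 8, whose normaliser maps onto
  -- A₄ in PSL(2,5). It meets both nonsplit traces ±1.
  set L : List (Quad (ZMod 5)) := [(2, 0, 0, 3), (3, 0, 0, 2), (0, 1, 4, 0), (0, 4, 1, 0),
    (0, 2, 2, 0), (0, 3, 3, 0)] with hL
  let s₀ : SL(2, ZMod 5) := ofEntries 4 4 3 2 (by decide +kernel)
  have hs₀ : s₀ ∈ conjStabilizer L := by
    rw [mem_conjStabilizer, show quad s₀ = (4, 4, 3, 2) from rfl]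
    decide +kernel
  have ht₀ : tr s₀ = 1 := by change (4 + 2 : ZMod 5) = 1; decide +kernel
  have hidx : (conjStabilizer L).index ≤ 5 := index_conjStabilizer_le L (by decide +kernel)
  have htop : conjStabilizer L ≠ ⊤ := fun h ↦ by
    have h1 : upper 1 ∈ conjStabilizer L := h ▸ Subgroup.mem_top _
    rw [mem_conjStabilizer, show quad (upper (1 : ZMod 5)) = (1, 1, 0, 1) from rfl] at h1
    revert h1
    decide +kernel
  have fin : ∀ t ∈ conjStabilizer L, tr s = tr t → False := fun t ht hst ↦
    not_dominates_of_index (center_le_conjStabilizer L) htop hidx (c := 2) (by rw [hc5]; norm_num)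
      ht (fun i ↦ ConjTo.trans (exists_conj_of_tr_eq (hst ▸ hns) hst) (hy i)) hd
  rcases htr with h | h
  · exact fin s₀ hs₀ (h.trans ht₀.symm)
  · exact fin (-s₀) (neg_mem_conjStabilizer hs₀) (by rw [tr_neg, ht₀, h])

lemma not_hasUDS_two_zmod_seven : ¬ HasUDS (ZMod 7) 2 := by
  rintro ⟨s, hs, y, hy, hd⟩
  have hc7 : Fintype.card (ZMod 7) = 7 := ZMod.card 7
  have hns : Nonsplit (tr s) := by
    rcases hd.exists_nonsplit (by omega) with h | h <;> rwa [(hy _).tr_eq] at h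
  have htr : tr s = 0 ∨ tr s = 3 ∨ tr s = -3 := by
    revert hns
    generalize tr s = τ
    unfold Nonsplit
    revert τ
    decide +kernel
  -- Again a quaternion group without ±1; its normaliser maps onto S₄ in PSL(2,7) and meets the
  -- nonsplit traces ±3. Trace 0 belongs to involutions and is treated separately.
  set L : List (Quad (ZMod 7)) := [(3, 2, 2, 4), (4, 5, 5, 3), (0, 1, 6, 0), (0, 6, 1, 0),
    (5, 3, 3, 2), (2, 4, 4, 5)] with hL
  let s₀ : SL(2, ZMod 7) := ofEntries 6 3 3 4 (by decide +kernel)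
  have hs₀ : s₀ ∈ conjStabilizer L := by
    rw [mem_conjStabilizer, show quad s₀ = (6, 3, 3, 4) from rfl]
    decide +kernel
  have ht₀ : tr s₀ = 3 := by change (6 + 4 : ZMod 7) = 3; decide +kernel
  have hidx : (conjStabilizer L).index ≤ 7 := index_conjStabilizer_le L (by decide +kernel)
  have htop : conjStabilizer L ≠ ⊤ := fun h ↦ by
    have h1 : upper 1 ∈ conjStabilizer L := h ▸ Subgroup.mem_top _
    rw [mem_conjStabilizer, show quad (upper (1 : ZMod 7)) = (1, 1, 0, 1) from rfl] at h1
    revert h1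
    decide +kernel
  have fin : ∀ t ∈ conjStabilizer L, tr s = tr t → False := fun t ht hst ↦
    not_dominates_of_index (center_le_conjStabilizer L) htop hidx (c := 2) (by rw [hc7]; norm_num)
      ht (fun i ↦ ConjTo.trans (exists_conj_of_tr_eq (hst ▸ hns) hst) (hy i)) hd
  rcases htr with h | h | h
  · have h0 := (hy 0).not_isScalar hs
    obtain ⟨i, hi⟩ := hd (y 0) h0
    exact not_generates_of_tr_eq_zero (by omega) h0 ((hy 0).tr_eq.trans h) ((hy i).tr_eq.trans h) hi
  · exact fin s₀ hs₀ (h.trans ht₀.symm)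
  · exact fin (-s₀) (neg_mem_conjStabilizer hs₀) (by rw [tr_neg, ht₀, h])

section

variable {F : Type*} [Field F] [Fintype F] [DecidableEq F]

theorem uniformDominationNumber_of_card_eq_five (hF : Fintype.card F = 5) :
    uniformDominationNumber PSL(2, F) = 3 := by
  refine uniformDominationNumber_eq (hasUDS_three_of_prime (by rw [hF]; norm_num)) ?_
  rw [hasUDS_iff_of_ringEquiv (FiniteField.ringEquivOfCardEq (hF.trans (ZMod.card 5).symm))]
  exact not_hasUDS_two_zmod_five

theorem uniformDominationNumber_of_card_eq_seven (hF : Fintype.card F = 7) :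
    uniformDominationNumber PSL(2, F) = 3 := by
  refine uniformDominationNumber_eq (hasUDS_three_of_prime (by rw [hF]; norm_num)) ?_
  rw [hasUDS_iff_of_ringEquiv (FiniteField.ringEquivOfCardEq (hF.trans (ZMod.card 7).symm))]
  exact not_hasUDS_two_zmod_seven

end

end SL2

namespace SL2

open Matrix Matrix.SpecialLinearGroup OnePoint

/-! ### The field with nine elements -/

instance : Fact (Nat.Prime 3) := ⟨by norm_num⟩

instance : Fact (∀ r : ZMod 3, r ^ 2 ≠ -1 + 0 * r) := ⟨by decide⟩

/-- The field `ℤ[i] / 3`. -/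
abbrev K9 := QuadraticAlgebra (ZMod 3) (-1) 0

instance : Fintype K9 := Fintype.ofEquiv _ (QuadraticAlgebra.equivProd (-1 : ZMod 3) 0).symm

lemma card_K9 : Fintype.card K9 = 9 := by
  rw [Fintype.card_congr (QuadraticAlgebra.equivProd (-1 : ZMod 3) 0), Fintype.card_prod,
    ZMod.card]

/-! Elements of `K9` and matrices over `K9` are encoded by natural numbers, for the sake of
computations in the kernel. -/

/-- The element `a + b i` has the code `a + 3 b`. -/
def val (n : ℕ) : K9 := ⟨n, (n / 3 : ℕ)⟩

/-- The code of `x y + z w`. -/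
def dot (x y z w : ℕ) : ℕ :=
  (x % 3 * (y % 3) + 2 * (x / 3 * (y / 3)) + z % 3 * (w % 3) + 2 * (z / 3 * (w / 3))) % 3 +
    3 * ((x % 3 * (y / 3) + x / 3 * (y % 3) + z % 3 * (w / 3) + z / 3 * (w % 3)) % 3)

lemma dot_lt (x y z w : ℕ) : dot x y z w < 9 := by unfold dot; omega

lemma val_dot (x y z w : ℕ) : val (dot x y z w) = val x * val y + val z * val w := by
  have h2 : (2 : ZMod 3) = -1 := by decide
  have h3 : (3 : ZMod 3) = 0 := by decide
  have hd (r s : ℕ) : (r % 3 + 3 * s) / 3 = s := by omega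
  apply QuadraticAlgebra.ext
  · simp only [val, dot, QuadraticAlgebra.re_add, QuadraticAlgebra.re_mul, Nat.cast_add,
      Nat.cast_mul, ZMod.natCast_mod, Nat.cast_ofNat, h2, h3]
    ring
  · simp only [val, dot, hd, QuadraticAlgebra.im_add, QuadraticAlgebra.im_mul, Nat.cast_add,
      Nat.cast_mul, ZMod.natCast_mod]
    ring

lemma val_zero : val 0 = 0 := rfl
lemma val_one : val 1 = 1 := rfl

/-- The code of an element. -/
def code (x : K9) : ℕ := x.1.val + 3 * x.2.val

lemma code_lt (x : K9) : code x < 9 := by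
  have h1 := x.1.val_lt
  have h2 := x.2.val_lt
  unfold code
  omega

lemma val_code (x : K9) : val (code x) = x := by
  have h1 := x.1.val_lt
  have h3 : (3 : ZMod 3) = 0 := by decide
  have h2 : (x.1.val + 3 * x.2.val) / 3 = x.2.val := by omega
  apply QuadraticAlgebra.ext
  · simp [val, code, h3]
  · simp only [val, code, h2, ZMod.natCast_val, ZMod.cast_id', id]

lemma code_val {n : ℕ} (hn : n < 9) : code (val n) = n := by
  revert n
  decide

/-- The matrix with a given code. -/
def mat (n : ℕ) : Quad K9 := (val (n % 9), val (n / 9 % 9), val (n / 81 % 9), val (n / 729 % 9))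

/-- The code of a matrix, from the codes of its entries. -/
def matCode (a b c d : ℕ) : ℕ := a + 9 * b + 81 * c + 729 * d

lemma mat_matCode {a b c d : ℕ} (ha : a < 9) (hb : b < 9) (hc : c < 9) (hd : d < 9) :
    mat (matCode a b c d) = (val a, val b, val c, val d) := by
  unfold mat matCode
  rw [show (a + 9 * b + 81 * c + 729 * d) % 9 = a by omega,
    show (a + 9 * b + 81 * c + 729 * d) / 9 % 9 = b by omega,
    show (a + 9 * b + 81 * c + 729 * d) / 81 % 9 = c by omega,
    show (a + 9 * b + 81 * c + 729 * d) / 729 % 9 = d by omega]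

lemma mat_injOn {m n : ℕ} (hm : m < 6561) (hn : n < 6561) (h : mat m = mat n) : m = n := by
  simp only [mat, Prod.mk_inj] at h
  have key (a b : ℕ) (h : val (a % 9) = val (b % 9)) : a % 9 = b % 9 := by
    have := congrArg code h
    rwa [code_val (Nat.mod_lt _ (by norm_num)), code_val (Nat.mod_lt _ (by norm_num))] at this
  have h0 := key _ _ h.1
  have h1 := key _ _ h.2.1
  have h2 := key _ _ h.2.2.1
  have h3 := key _ _ h.2.2.2
  omega

/-- The code of a product of matrices. -/
def mulCode (x y : ℕ) : ℕ :=
  matCode (dot (x % 9) (y % 9) (x / 9 % 9) (y / 81 % 9))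
    (dot (x % 9) (y / 9 % 9) (x / 9 % 9) (y / 729 % 9))
    (dot (x / 81 % 9) (y % 9) (x / 729 % 9) (y / 81 % 9))
    (dot (x / 81 % 9) (y / 9 % 9) (x / 729 % 9) (y / 729 % 9))

lemma mat_mulCode (x y : ℕ) : mat (mulCode x y) = qmul (mat x) (mat y) := by
  rw [mulCode, mat_matCode (dot_lt _ _ _ _) (dot_lt _ _ _ _) (dot_lt _ _ _ _) (dot_lt _ _ _ _)]
  simp only [val_dot]
  rfl

/-- The code of an adjugate matrix. -/
def adjCode (x : ℕ) : ℕ :=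
  matCode (x / 729 % 9) (dot 2 (x / 9 % 9) 0 0) (dot 2 (x / 81 % 9) 0 0) (x % 9)

lemma val_neg (x : ℕ) : val (dot 2 x 0 0) = -val x := by
  rw [val_dot, val_zero, zero_mul, add_zero, show val 2 = -1 by decide, neg_one_mul]

lemma mat_adjCode (x : ℕ) : mat (adjCode x) = qadj (mat x) := by
  rw [adjCode, mat_matCode (by omega) (dot_lt _ _ _ _) (dot_lt _ _ _ _) (by omega)]
  simp only [val_neg]
  rfl

/-- The code of `qconj`. -/
def conjCode (x y : ℕ) : ℕ := mulCode (mulCode x y) (adjCode x)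

lemma mat_conjCode (x y : ℕ) : mat (conjCode x y) = qconj (mat x) (mat y) := by
  rw [conjCode, mat_mulCode, mat_mulCode, mat_adjCode]
  rfl

/-- The code of a trace. -/
def trCode (x : ℕ) : ℕ := dot 1 (x % 9) 1 (x / 729 % 9)

/-- The code of a determinant. -/
def detCode (x : ℕ) : ℕ := dot (x % 9) (x / 729 % 9) (x / 9 % 9) (dot 2 (x / 81 % 9) 0 0)

/-- The element of `SL₂` with a given code. -/
def ofCode (n : ℕ) (h : detCode n = 1) : SL(2, K9) :=
  ofEntries (val (n % 9)) (val (n / 9 % 9)) (val (n / 81 % 9)) (val (n / 729 % 9)) (by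
    have := congrArg val h
    rw [detCode, val_dot, val_neg, val_one] at this
    rw [← this]
    ring)

@[simp] lemma quad_ofCode (n : ℕ) (h : detCode n = 1) : quad (ofCode n h) = mat n := rfl

lemma tr_eq_val {A : SL(2, K9)} {n : ℕ} (h : quad A = mat n) : tr A = val (trCode n) := by
  rw [trCode, val_dot, val_one, one_mul, one_mul]
  exact congrArg (fun m : Quad K9 ↦ m.1 + m.2.2.2) h

lemma quad_upper_val (b : ℕ) (hb : b < 9) : quad (upper (val b)) = mat (matCode 1 b 0 1) := by
  rw [mat_matCode (by norm_num) hb (by norm_num) (by norm_num)]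
  rfl

lemma mem_conjStabilizer_map {L : List ℕ} {g : SL(2, K9)} {n : ℕ} (hg : quad g = mat n)
    (h : ∀ m ∈ L, conjCode n m ∈ L) : g ∈ conjStabilizer (L.map mat) := by
  intro m hm
  obtain ⟨k, hk, rfl⟩ := List.mem_map.1 hm
  rw [hg, ← mat_conjCode]
  exact List.mem_map_of_mem (h k hk)

lemma matCode_lt {a b c d : ℕ} (ha : a < 9) (hb : b < 9) (hc : c < 9) (hd : d < 9) :
    matCode a b c d < 6561 := by unfold matCode; omega

lemma notMem_conjStabilizer_map {L : List ℕ} {g : SL(2, K9)} {n : ℕ} (hg : quad g = mat n)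
    (hL : ∀ m ∈ L, m < 6561) (h : ∃ m ∈ L, conjCode n m ∉ L) :
    g ∉ conjStabilizer (L.map mat) := fun hc ↦ by
  obtain ⟨m, hm, hn⟩ := h
  have := hc (mat m) (List.mem_map_of_mem hm)
  rw [hg, ← mat_conjCode] at this
  obtain ⟨k, hk, he⟩ := List.mem_map.1 this
  refine hn (?_ : matCode _ _ _ _ ∈ L)
  rwa [← mat_injOn (hL k hk) (matCode_lt (dot_lt _ _ _ _) (dot_lt _ _ _ _) (dot_lt _ _ _ _)
    (dot_lt _ _ _ _)) he]

/-- The preimage in `SL₂(9)` of a subgroup of `PSL₂(9)` isomorphic to `A₅` permutes these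
elements of order ten. -/
def icosahedral : List ℕ :=
  [matCode 5 4 4 2, matCode 8 8 1 8, matCode 4 1 2 0, matCode 8 1 8 8,
    matCode 8 4 2 8, matCode 4 2 1 0, matCode 5 8 8 2, matCode 0 2 1 4,
    matCode 2 4 4 5, matCode 2 8 8 5, matCode 0 1 2 4, matCode 8 2 4 8]

/-- Representatives of the cosets of the stabiliser of `icosahedral`. -/
def cosetRep : Fin 6 → ℕ := ![matCode 1 0 0 1, matCode 1 3 0 1, matCode 1 6 0 1,
    matCode 0 2 1 3, matCode 0 2 1 6, matCode 3 1 1 3]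

lemma closure_one_i : AddSubgroup.closure ({1, ⟨0, 1⟩} : Set K9) = ⊤ := by
  rw [eq_top_iff]
  rintro ⟨a, b⟩ -
  have h1 : (1 : K9) ∈ AddSubgroup.closure ({1, ⟨0, 1⟩} : Set K9) :=
    AddSubgroup.subset_closure (by simp)
  have h2 : (⟨0, 1⟩ : K9) ∈ AddSubgroup.closure ({1, ⟨0, 1⟩} : Set K9) :=
    AddSubgroup.subset_closure (by simp)
  convert add_mem (nsmul_mem h1 a.val) (nsmul_mem h2 b.val) using 1
  revert a b
  decide +kernel

/-- Six cosets are permuted by `upper 1`, `upper i` and the Weyl element; the code 3 stands for i,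
and 1 and i generate the additive group. -/
lemma index_icosahedral : (conjStabilizer (icosahedral.map mat)).index ≤ 6 := by
  have hd : ∀ j, detCode (cosetRep j) = 1 := by decide +kernel
  have hw : detCode (matCode 0 2 1 0) = 1 := by decide +kernel
  have hupper : ∀ b ∈ [1, 3], ∀ j, ∃ k, ∀ m ∈ icosahedral,
      conjCode (mulCode (mulCode (adjCode (cosetRep k)) (matCode 1 b 0 1)) (cosetRep j)) m ∈
        icosahedral := by decide +kernel
  have hweyl : ∀ j, ∃ k, ∀ m ∈ icosahedral,
      conjCode (mulCode (mulCode (adjCode (cosetRep k)) (matCode 0 2 1 0)) (cosetRep j)) m ∈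
        icosahedral := by decide +kernel
  have := index_le_of_reps (Γ := conjStabilizer (icosahedral.map mat))
    (fun j ↦ ofCode (cosetRep j) (hd j))
    ⟨0, mem_conjStabilizer_map (quad_ofCode _ _) (by decide +kernel)⟩ closure_one_i
    (fun b hb j ↦ by
      obtain ⟨n, hn, hn9, rfl⟩ : ∃ n ∈ [1, 3], n < 9 ∧ b = val n := by
        rcases hb with rfl | rfl
        · exact ⟨1, by simp, by simp, rfl⟩
        · exact ⟨3, by simp, by simp, rfl⟩
      obtain ⟨k, hk⟩ := hupper n hn j
      exact ⟨k, mem_conjStabilizer_map (by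
        rw [quad_mul, quad_mul, quad_inv, quad_upper_val _ hn9, quad_ofCode, quad_ofCode,
          mat_mulCode, mat_mulCode, mat_adjCode]) hk⟩)
    (w := ofCode _ hw) one_ne_zero
    (fun j ↦ by
      obtain ⟨k, hk⟩ := hweyl j
      exact ⟨k, mem_conjStabilizer_map (by
        rw [quad_mul, quad_mul, quad_inv, quad_ofCode, quad_ofCode, quad_ofCode,
          mat_mulCode, mat_mulCode, mat_adjCode]) hk⟩)
  simpa using this

lemma not_dominates_of_mem_icosahedral {t s : SL(2, K9)}
    (ht : t ∈ conjStabilizer (icosahedral.map mat)) (hts : ConjTo t s)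
    {y : Fin 3 → SL(2, K9)} (hy : ∀ i, ConjTo s (y i)) : ¬ Dominates y := by
  refine not_dominates_of_index (center_le_conjStabilizer _) (fun h ↦ ?_) index_icosahedral (c := 3)
    (by rw [card_K9]; norm_num) ht fun i ↦ hts.trans (hy i)
  exact notMem_conjStabilizer_map (quad_upper_val 1 (by norm_num)) (by decide +kernel)
    (by decide +kernel) (h ▸ Subgroup.mem_top (upper (val 1)))

/-- Traces of elements without eigenvectors in `K9 ^ 2`. -/
lemma nonsplit_iff_im {τ : K9} : Nonsplit τ ↔ τ.1 ≠ 0 ∧ τ.2 ≠ 0 := by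
  revert τ
  unfold Nonsplit
  decide +kernel

/-- The nonsplit traces are ±(1 + i) and ±(1 - i). They are the traces of ±t and ±t² for an element
t of the icosahedral group, which therefore meets every nonsplit class. -/
lemma not_dominates_of_nonsplit {s : SL(2, K9)} (hs : Nonsplit (tr s))
    {y : Fin 3 → SL(2, K9)} (hy : ∀ i, ConjTo s (y i)) : ¬ Dominates y := by
  have hd : detCode (matCode 0 2 1 4) = 1 := by decide +kernel
  have hmem : ofCode _ hd ∈ conjStabilizer (icosahedral.map mat) :=
    mem_conjStabilizer_map (quad_ofCode _ _) (by decide +kernel)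
  have hsq := Subgroup.mul_mem _ hmem hmem
  have h1 : tr (ofCode _ hd) = val 4 := tr_eq_val (quad_ofCode _ hd)
  have h2 : tr (ofCode _ hd * ofCode _ hd) = val 7 := tr_eq_val (n := mulCode (matCode 0 2 1 4) (matCode 0 2 1 4)) (by
    rw [quad_mul, quad_ofCode, ← mat_mulCode])
  have key : ∀ τ : K9, τ.1 ≠ 0 ∧ τ.2 ≠ 0 → τ = val 4 ∨ τ = -val 4 ∨ τ = val 7 ∨ τ = -val 7 := by
    decide +kernel
  have fin : ∀ t ∈ conjStabilizer (icosahedral.map mat), tr s = tr t → ¬ Dominates y :=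
    fun t ht hst ↦ not_dominates_of_mem_icosahedral ht (exists_conj_of_tr_eq (hst ▸ hs) hst) hy
  rcases key _ (nonsplit_iff_im.1 hs) with h | h | h | h
  · exact fin _ hmem (h.trans h1.symm)
  · exact fin _ (neg_mem_conjStabilizer hmem) (by rw [tr_neg, h, h1])
  · exact fin _ hsq (h.trans h2.symm)
  · exact fin _ (neg_mem_conjStabilizer hsq) (by rw [tr_neg, h, h2])

lemma upper_mem_icosahedral : upper ⟨1, 1⟩ ∈ conjStabilizer (icosahedral.map mat) :=
  mem_conjStabilizer_map (quad_upper_val 4 (by norm_num)) (by decide +kernel)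

/-- The icosahedral group contains `upper (1 + i)`, and a diagonal automorphism carries any other
nontrivial unipotent to this one. -/
lemma not_dominates_of_conjTo_upper {s : SL(2, K9)} {b : K9} (hb : b ≠ 0)
    (hs : ConjTo (upper b) s ∨ ConjTo (-upper b) s)
    {y : Fin 3 → SL(2, K9)} (hy : ∀ i, ConjTo s (y i)) : ¬ Dominates y := fun h ↦ by
  have h1 : (⟨1, 1⟩ : K9) ≠ 0 := by decide +kernel
  have hd : (⟨1, 1⟩ : K9) / b ≠ 0 := div_ne_zero h1 hb
  have hu : twist _ hd (upper b) = upper ⟨1, 1⟩ := by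
    apply ext_entries <;> simp [twist, div_mul_cancel₀ _ hb]
  have hu' : twist _ hd (-upper b) = -upper ⟨1, 1⟩ := by
    apply ext_entries <;> simp [twist, div_mul_cancel₀ _ hb]
  refine (show ∃ t ∈ conjStabilizer (icosahedral.map mat), ConjTo t (twist _ hd s) from ?_).elim
    fun t ht ↦ not_dominates_of_mem_icosahedral ht.1 ht.2 (fun i ↦ (hy i).map (twist _ hd)) (h.map _)
  rcases hs with hs | hs
  · exact ⟨_, upper_mem_icosahedral, hu ▸ hs.map _⟩
  · exact ⟨_, neg_mem_conjStabilizer upper_mem_icosahedral, hu' ▸ hs.map _⟩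

lemma ConjTo.symm {K : Type*} [Field K] {s y : SL(2, K)} (h : ConjTo s y) : ConjTo y s := by
  obtain ⟨g, rfl⟩ := h
  exact ⟨g⁻¹, by group⟩

/-- In characteristic 3 the traces 2 = -1 and -2 = 1 belong to a double eigenvalue 1 or -1, so a
triangular form is ±`upper b` with b ≠ 0. -/
lemma not_dominates_of_unipotent {s : SL(2, K9)} (hs : ¬ IsScalar s) (h : tr s = 1 ∨ tr s = -1)
    {y : Fin 3 → SL(2, K9)} (hy : ∀ i, ConjTo s (y i)) : ¬ Dominates y := by
  have hns : ¬ Nonsplit (tr s) := by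
    rcases h with h | h <;> rw [h] <;> unfold Nonsplit <;> decide +kernel
  obtain ⟨g, hg⟩ := exists_conj_triangular hns
  have hc : ConjTo (g * s * g⁻¹) s := ConjTo.symm ⟨g, rfl⟩
  have ht : tr (g * s * g⁻¹) = tr s := ConjTo.tr_eq ⟨g, rfl⟩
  have hn : ¬ IsScalar (g * s * g⁻¹) := not_isScalar_conj hs g
  generalize g * s * g⁻¹ = z at hg hc ht hn
  have hdet := det_eq z
  rw [tr] at ht
  rw [hg, mul_zero, sub_zero] at hdet
  have key : ∀ a d τ : K9, a * d = 1 → a + d = τ → τ = 1 ∨ τ = -1 →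
      a = 1 ∧ d = 1 ∨ a = -1 ∧ d = -1 := by decide +kernel
  rcases key _ _ _ hdet ht h with ⟨ha, hd⟩ | ⟨ha, hd⟩
  · have hb : z 0 1 ≠ 0 := fun hb ↦ hn ⟨hb, hg, ha.trans hd.symm⟩
    refine not_dominates_of_conjTo_upper hb (.inl ?_) hy
    convert hc using 1
    apply ext_entries <;> simp [*]
  · have hb : -z 0 1 ≠ 0 := fun hb ↦ hn ⟨neg_eq_zero.1 hb, hg, ha.trans hd.symm⟩
    refine not_dominates_of_conjTo_upper hb (.inr ?_) hy
    convert hc using 1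
    apply ext_entries <;> simp [*]

end SL2

/-! ### Three elements never dominate for q = 9. -/

namespace SL2

open Matrix Matrix.SpecialLinearGroup OnePoint

/-- The trace of a product of matrices, in codes. -/
def trMul (x y : ℕ) : ℕ :=
  dot 1 (dot (x % 9) (y % 9) (x / 9 % 9) (y / 81 % 9)) 1
    (dot (x / 81 % 9) (y / 9 % 9) (x / 729 % 9) (y / 729 % 9))

lemma tr_mul_eq_val {A B : SL(2, K9)} {m n : ℕ} (hA : quad A = mat m) (hB : quad B = mat n) :
    tr (A * B) = val (trMul m n) := by
  have h : tr (A * B) = (quad (A * B)).1 + (quad (A * B)).2.2.2 := rfl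
  rw [trMul, val_dot, val_one, one_mul, one_mul, val_dot, val_dot, h, quad_mul, hA, hB]
  rfl

lemma val_re_eq_zero_iff {n : ℕ} : (val n).1 = 0 ↔ n % 3 = 0 := by
  rw [← Nat.dvd_iff_mod_eq_zero, ← ZMod.natCast_eq_zero_iff, val]

lemma val_im_eq_zero_iff {n : ℕ} : (val n).2 = 0 ↔ n / 3 % 3 = 0 := by
  rw [← Nat.dvd_iff_mod_eq_zero, ← ZMod.natCast_eq_zero_iff, val]

/-- Whether `n` is the code of an element `τ` with `Nonsplit τ`. -/
def nonsplitCode (n : ℕ) : Bool := n % 3 != 0 && n / 3 % 3 != 0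

lemma nonsplit_val_iff {n : ℕ} : Nonsplit (val n) ↔ nonsplitCode n := by
  rw [nonsplit_iff_im, Ne, Ne, val_re_eq_zero_iff, val_im_eq_zero_iff]
  simp [nonsplitCode]

/-! ### Elements of trace zero -/

lemma exists_ofCode {n : ℕ} (h : detCode n = 1) : ∃ A : SL(2, K9), quad A = mat n :=
  ⟨ofCode n h, rfl⟩

lemma length_le_card {L : List ℕ} (hL : L.Nodup) (h : ∀ n ∈ L, n < 6561 ∧ detCode n = 1)
    {S : Finset SL(2, K9)} (hS : ∀ n ∈ L, ∀ A, quad A = mat n → A ∈ S) : L.length ≤ S.card := by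
  classical
  choose f hf using fun n (hn : n ∈ L) ↦ exists_ofCode (h n hn).2
  rw [← List.toFinset_card_of_nodup hL]
  refine Finset.card_le_card_of_injOn (fun n ↦ if hn : n ∈ L then f n hn else 1) ?_ ?_
  · intro n hn
    have hn : n ∈ L := by simpa using hn
    simp only [hn, dif_pos, Finset.mem_coe]
    exact hS n hn _ (hf n hn)
  · intro m hm n hn he
    have hm : m ∈ L := by simpa using hm
    have hn : n ∈ L := by simpa using hn
    simp only [hn, hm, dif_pos] at he
    refine mat_injOn (h m hm).1 (h n hn).1 ?_
    rw [← hf m hm, ← hf n hn, he]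

lemma card_le_length {L : List ℕ} {S : Finset SL(2, K9)}
    (hS : ∀ A ∈ S, ∃ n ∈ L, quad A = mat n) : S.card ≤ L.length := by
  classical
  refine le_trans ?_ (List.toFinset_card_le L)
  choose f hf hf' using hS
  refine Finset.card_le_card_of_injOn (fun A ↦ if hA : A ∈ S then f A hA else 0) ?_ ?_
  · intro A hA
    have hA : A ∈ S := hA
    simp only [hA, dif_pos, Finset.mem_coe, List.mem_toFinset]
    exact hf A hA
  · intro A hA B hB he
    have hA : A ∈ S := hA
    have hB : B ∈ S := hB
    simp only [hA, hB, dif_pos] at he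
    refine quad_injective ?_
    rw [hf' A hA, hf' B hB, he]

/-- The codes of the matrices of trace `0` and determinant `1`. -/
def traceZero : List ℕ :=
  (List.range 9).flatMap fun p ↦ (List.range 9).flatMap fun r ↦
    ((List.range 9).filter fun t ↦ dot p p r t = 2).map fun t ↦ matCode p r t (dot 2 p 0 0)

/-- The codes of the matrices of trace `0` and determinant `1` whose product with `diag (i, -i)`
has no eigenvector. -/
def traceZeroDiag : List ℕ :=
  [4, 5, 7, 8].flatMap fun p ↦ (List.range 9).flatMap fun r ↦
    ((List.range 9).filter fun t ↦ dot p p r t = 2).map fun t ↦ matCode p r t (dot 2 p 0 0)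

lemma exists_entries_of_tr_eq_zero {A : SL(2, K9)} (h : tr A = 0) :
    ∃ p < 9, ∃ r < 9, ∃ t < 9, dot p p r t = 2 ∧ quad A = mat (matCode p r t (dot 2 p 0 0)) := by
  refine ⟨code (A 0 0), code_lt _, code (A 0 1), code_lt _, code (A 1 0), code_lt _, ?_, ?_⟩
  · have : val (dot (code (A 0 0)) (code (A 0 0)) (code (A 0 1)) (code (A 1 0))) = val 2 := by
      rw [val_dot, val_code, val_code, val_code, show val 2 = -1 by decide]
      have hd := det_eq A
      rw [tr] at h
      linear_combination A 0 0 * h - hd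
    have := congrArg code this
    rwa [code_val (dot_lt _ _ _ _), code_val (by norm_num)] at this
  · rw [mat_matCode (code_lt _) (code_lt _) (code_lt _) (dot_lt _ _ _ _)]
    simp only [val_neg, val_code, quad, Prod.mk_inj, true_and]
    rw [tr] at h
    linear_combination h

lemma mem_traceZero {A : SL(2, K9)} (h : tr A = 0) : ∃ n ∈ traceZero, quad A = mat n := by
  obtain ⟨p, hp, r, hr, t, ht, h, hA⟩ := exists_entries_of_tr_eq_zero h
  refine ⟨_, ?_, hA⟩
  simp only [traceZero, List.mem_flatMap, List.mem_map, List.mem_filter, List.mem_range]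
  exact ⟨p, hp, r, hr, t, ⟨ht, by simpa using h⟩, rfl⟩

lemma mem_traceZeroDiag {A : SL(2, K9)} (h : tr A = 0) {D : SL(2, K9)}
    (hD : quad D = mat (matCode 3 0 0 6)) (hAD : Nonsplit (tr (A * D))) :
    ∃ n ∈ traceZeroDiag, quad A = mat n := by
  obtain ⟨p, hp, r, hr, t, ht, h, hA⟩ := exists_entries_of_tr_eq_zero h
  refine ⟨_, ?_, hA⟩
  rw [tr_mul_eq_val hA hD, nonsplit_val_iff] at hAD
  have key : ∀ p ∈ List.range 9, ∀ r ∈ List.range 9, ∀ t ∈ List.range 9, dot p p r t = 2 →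
      nonsplitCode (trMul (matCode p r t (dot 2 p 0 0)) (matCode 3 0 0 6)) → p ∈ [4, 5, 7, 8] := by
    decide +kernel
  simp only [traceZeroDiag, List.mem_flatMap, List.mem_map, List.mem_filter, List.mem_range]
  exact ⟨p, key p (List.mem_range.2 hp) r (List.mem_range.2 hr) t (List.mem_range.2 ht) h hAD, r, hr, t, ⟨ht, by simpa using h⟩, rfl⟩

lemma length_traceZero : traceZero.length = 90 := by decide +kernel
lemma length_traceZeroDiag : traceZeroDiag.length = 32 := by decide +kernel

lemma traceZero_spec : traceZero.Nodup ∧ ∀ n ∈ traceZero, n < 6561 ∧ detCode n = 1 := by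
  constructor <;> decide +kernel

lemma traceZeroDiag_spec : traceZeroDiag.Nodup ∧ ∀ n ∈ traceZeroDiag,
    n < 6561 ∧ detCode n = 1 ∧ trCode n = 0 ∧ nonsplitCode (trMul n (matCode 3 0 0 6)) := by
  constructor <;> decide +kernel

/-- The lower bound on intersections is what makes the final count strict: 3 · 32 exceeds 90, but 3
· 32 - 8 does not. -/
lemma overlap : ∀ m ∈ traceZero,
    8 ≤ (traceZeroDiag.filter fun n ↦ nonsplitCode (trMul n m)).length := by
  decide +kernel

/-- The elements `X` of trace `0` such that `X Y` has no eigenvector. -/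
noncomputable def nonsplitPartners (Y : SL(2, K9)) : Finset SL(2, K9) := by
  classical exact (traceClass 0).filter fun X ↦ Nonsplit (tr (X * Y))

lemma mem_nonsplitPartners {X Y : SL(2, K9)} :
    X ∈ nonsplitPartners Y ↔ tr X = 0 ∧ Nonsplit (tr (X * Y)) := by
  simp [nonsplitPartners]

lemma conj_mem_nonsplitPartners {X Y : SL(2, K9)} (h : X ∈ nonsplitPartners Y) (g : SL(2, K9)) :
    g * X * g⁻¹ ∈ nonsplitPartners (g * Y * g⁻¹) := by
  rw [mem_nonsplitPartners] at h ⊢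
  rwa [show g * X * g⁻¹ * (g * Y * g⁻¹) = g * (X * Y) * g⁻¹ by group, tr_conj, tr_conj]

/-- Over this field elements of trace 0 have the distinct eigenvalues i and -i, with codes 3 and 6,
so they form a single class. -/
lemma exists_conj_of_tr_eq_zero {Y : SL(2, K9)} (hY : tr Y = 0) :
    ∃ g : SL(2, K9), quad (g * Y * g⁻¹) = mat (matCode 3 0 0 6) := by
  have h0 : (⟨0, 1⟩ : K9) ≠ 0 := by decide +kernel
  have hinv : (⟨0, 1⟩ : K9)⁻¹ = ⟨0, 2⟩ := inv_eq_of_mul_eq_one_right (by decide +kernel)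
  obtain ⟨g, hg⟩ := exists_conj_diag (x := Y) h0 (by decide +kernel) (by
    rw [hY, hinv]; decide +kernel)
  refine ⟨g, ?_⟩
  rw [hg, mat_matCode (by norm_num) (by norm_num) (by norm_num) (by norm_num), quad]
  simp only [diag, ofEntries_00, ofEntries_01, ofEntries_10, ofEntries_11, hinv]
  decide +kernel

lemma card_nonsplitPartners_le {Y : SL(2, K9)} (hY : tr Y = 0) :
    (nonsplitPartners Y).card ≤ 32 := by
  classical
  obtain ⟨g, hg⟩ := exists_conj_of_tr_eq_zero hY
  refine le_trans (Finset.card_le_card_of_injOn (t := nonsplitPartners (g * Y * g⁻¹))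
    (fun X ↦ g * X * g⁻¹) (fun X hX ↦ conj_mem_nonsplitPartners hX g) fun X _ Z _ h ↦ by
      simpa using h) ?_
  rw [← length_traceZeroDiag]
  refine card_le_length fun A hA ↦ ?_
  rw [mem_nonsplitPartners] at hA
  exact mem_traceZeroDiag hA.1 hg hA.2

open Classical in
lemma card_inter_nonsplitPartners {Y Z : SL(2, K9)} (hY : tr Y = 0) (hZ : tr Z = 0) :
    8 ≤ (nonsplitPartners Y ∩ nonsplitPartners Z).card := by
  obtain ⟨g, hg⟩ := exists_conj_of_tr_eq_zero hY
  refine le_trans ?_ (Finset.card_le_card_of_injOn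
    (s := nonsplitPartners (g * Y * g⁻¹) ∩ nonsplitPartners (g * Z * g⁻¹))
    (fun X ↦ g⁻¹ * X * g⁻¹⁻¹) (fun X hX ↦ ?_) fun X _ Z _ h ↦ by simpa using h)
  · obtain ⟨m, hm, hZm⟩ := mem_traceZero (A := g * Z * g⁻¹) (by rw [tr_conj, hZ])
    refine (overlap m hm).trans (length_le_card (traceZeroDiag_spec.1.filter _) ?_ ?_)
    · intro n hn
      have := traceZeroDiag_spec.2 n (List.mem_of_mem_filter hn)
      exact ⟨this.1, this.2.1⟩
    · intro n hn A hA
      have h := traceZeroDiag_spec.2 n (List.mem_of_mem_filter hn)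
      have h0 : tr A = 0 := by rw [tr_eq_val hA, h.2.2.1]; rfl
      rw [Finset.mem_inter, mem_nonsplitPartners, mem_nonsplitPartners, tr_mul_eq_val hA hg,
        tr_mul_eq_val hA hZm, nonsplit_val_iff, nonsplit_val_iff]
      exact ⟨⟨h0, h.2.2.2⟩, h0, (List.mem_filter.1 hn).2⟩
  · rw [Finset.mem_coe, Finset.mem_inter] at hX ⊢
    have h1 := conj_mem_nonsplitPartners hX.1 g⁻¹
    have h2 := conj_mem_nonsplitPartners hX.2 g⁻¹
    rw [show g⁻¹ * (g * Y * g⁻¹) * g⁻¹⁻¹ = Y by group] at h1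
    rw [show g⁻¹ * (g * Z * g⁻¹) * g⁻¹⁻¹ = Z by group] at h2
    exact ⟨h1, h2⟩

lemma le_card_traceClass_zero : 90 ≤ (traceClass (0 : K9)).card := by
  rw [← length_traceZero]
  have key : ∀ n ∈ traceZero, trCode n = 0 := by decide +kernel
  refine length_le_card traceZero_spec.1 traceZero_spec.2 fun n hn A hA ↦ ?_
  rw [mem_traceClass, tr_eq_val hA, key n hn]
  rfl

/-- Three elements of trace `0` have a common partner `X` of trace `0` such that the products have
eigenvectors. -/
lemma exists_split_partner {Y : Fin 3 → SL(2, K9)} (hY : ∀ i, tr (Y i) = 0) :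
    ∃ X : SL(2, K9), tr X = 0 ∧ ∀ i, ¬ Nonsplit (tr (X * Y i)) := by
  classical
  by_contra! hc
  -- At least 90 elements would be covered by three sets of at most 32, two of which share at least
  -- 8, hence by at most 88.
  have hsub : traceClass (0 : K9) ⊆
      nonsplitPartners (Y 0) ∪ nonsplitPartners (Y 1) ∪ nonsplitPartners (Y 2) := by
    intro X hX
    rw [mem_traceClass] at hX
    obtain ⟨i, hi⟩ := hc X hX
    simp only [Finset.mem_union, mem_nonsplitPartners]
    fin_cases i
    · exact .inl (.inl ⟨hX, hi⟩)
    · exact .inl (.inr ⟨hX, hi⟩)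
    · exact .inr ⟨hX, hi⟩
  have h1 := Finset.card_le_card hsub
  have h2 := Finset.card_union_le (nonsplitPartners (Y 0) ∪ nonsplitPartners (Y 1))
    (nonsplitPartners (Y 2))
  have h3 := Finset.card_union_add_card_inter (nonsplitPartners (Y 0)) (nonsplitPartners (Y 1))
  have h4 := card_inter_nonsplitPartners (hY 0) (hY 1)
  have h5 := card_nonsplitPartners_le (hY 0)
  have h6 := card_nonsplitPartners_le (hY 1)
  have h7 := card_nonsplitPartners_le (hY 2)
  have h8 := le_card_traceClass_zero
  omega

/-- The preimage in `SL₂(9)` of a subgroup of `PSL₂(9)` isomorphic to `S₄` permutes these. -/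
def octahedral : List ℕ :=
  [matCode 3 0 0 6, matCode 6 0 0 3, matCode 0 3 3 0, matCode 0 6 6 0, matCode 0 2 1 0,
    matCode 0 1 2 0]

lemma octahedral_ne_top : conjStabilizer (octahedral.map mat) ≠ ⊤ := fun h ↦
  notMem_conjStabilizer_map (quad_upper_val 1 (by norm_num)) (by decide +kernel)
    (by decide +kernel) (h ▸ Subgroup.mem_top (upper (val 1)))

/-- The hypothesis leaves few values of p = x 0 0. For p = 0, x inverts the diagonal matrix; for p²
= -1 it shares a fixed point with it; for p = ±1 a diagonal automorphism takes both into the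
preimage of S₄. -/
lemma not_generates_diag {s : K9} (hs : s ≠ 0) (h4 : s ^ 2 * s ^ 2 = -1) {x : SL(2, K9)}
    (hx : tr x = 0) (h : ¬ Nonsplit (tr (x * (diag s hs * diag s hs)))) :
    ¬ Generates x (diag s hs) := by
  have hinv : s * s⁻¹ = 1 := mul_inv_cancel₀ hs
  have hsc : ¬ IsScalar (diag s hs) := fun h ↦ by
    have e : s = s⁻¹ := h.2.2
    have : s ^ 2 = 1 := by rw [sq]; nth_rw 2 [e]; exact hinv
    rw [this] at h4
    revert h4
    decide +kernel
  have hdet := det_eq x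
  have h11 : x 1 1 = -x 0 0 := by rw [tr] at hx; linear_combination hx
  rw [h11] at hdet
  have htr : tr (x * (diag s hs * diag s hs)) = x 0 0 * (s * s - s⁻¹ * s⁻¹) := by
    simp [tr, diag, h11]; ring
  have key : ∀ s t p : K9, s * t = 1 → s ^ 2 * s ^ 2 = -1 → ¬ Nonsplit (p * (s * s - t * t)) →
      p = 0 ∨ p * p = -1 ∨ p = 1 ∨ p = -1 := by
    simp only [nonsplit_iff_im]
    decide +kernel
  rw [htr] at h
  rcases key _ _ _ hinv h4 h with h | h | h
  · intro hg
    refine hg.notMem_dihedral (by rw [card_K9]; norm_num) hsc ?_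
    rw [mem_dihedral_iff_tr hsc]
    refine .inr ⟨hx, ?_⟩
    simp [tr, diag, h, h11]
  · have : x 0 1 * x 1 0 = 0 := by linear_combination -hdet - h
    rcases mul_eq_zero.1 this with h0 | h0
    · refine not_generates_of_smul_eq (p := ((0 : K9) : OnePoint K9)) ?_ ?_
      · rw [smul_coe_eq_self_iff]; simp [h0]
      · rw [smul_coe_eq_self_iff]; simp [diag]
    · exact not_generates_of_smul_eq (smul_infty_eq_self_iff.2 h0) (smul_infty_eq_self_iff.2 rfl)
  · intro hg
    have hp : x 0 0 * x 0 0 = 1 := by rcases h with h | h <;> rw [h] <;> ring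
    have h2 : (2 : K9) = -1 := by decide +kernel
    have hrt : x 0 1 * x 1 0 = 1 := by linear_combination -hdet - hp - h2
    have hd : x 1 0 ≠ 0 := right_ne_zero_of_mul (hrt ▸ one_ne_zero)
    have hg' := hg.map (twist (x 1 0) hd)
    have hc : ∀ a ∈ List.range 9, ∀ b ∈ List.range 9, val a * val b = 1 → val a ^ 2 * val a ^ 2 = -1 →
        ∀ m ∈ octahedral, conjCode (matCode a 0 0 b) m ∈ octahedral := by decide +kernel
    have hc' : ∀ p ∈ [1, 2], ∀ m ∈ octahedral,
      conjCode (matCode p 1 1 (dot 2 p 0 0)) m ∈ octahedral := by decide +kernel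
    obtain ⟨n, hn, hn9, hxn⟩ : ∃ n ∈ [1, 2], n < 9 ∧ x 0 0 = val n := by
      rcases h with h | h
      · exact ⟨1, by simp, by simp, h⟩
      · exact ⟨2, by simp, by simp, h⟩
    refine not_generates_of_mem (center_le_conjStabilizer (octahedral.map mat)) ?_ ?_
      octahedral_ne_top hg'
    · refine mem_conjStabilizer_map ?_ (hc' n hn)
      rw [mat_matCode hn9 (by norm_num) (by norm_num) (dot_lt _ _ _ _), val_neg]
      have hr : x 1 0 * x 0 1 = 1 := by rw [mul_comm, hrt]
      simp [quad, twist, hr, hd, hxn, h11, val_one]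
    · refine mem_conjStabilizer_map ?_ (hc (code s) (List.mem_range.2 (code_lt _)) (code s⁻¹)
        (List.mem_range.2 (code_lt _)) ?_ ?_)
      · rw [mat_matCode (code_lt _) (by norm_num) (by norm_num) (code_lt _), val_code, val_code]
        simp [quad, twist, diag, val_zero]
      · rwa [val_code, val_code]
      · rwa [val_code]

lemma not_generates_of_split {x y : SL(2, K9)} (hx : tr x = 0) (hy : (tr y).1 = 0)
    (hy' : (tr y).2 ≠ 0) (h : ¬ Nonsplit (tr (x * (y * y)))) : ¬ Generates x y := by
  have key : ∀ τ : K9, τ.1 = 0 → τ.2 ≠ 0 → ∃ s t : K9, s * t = 1 ∧ s ^ 2 * s ^ 2 = -1 ∧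
      s ^ 2 ≠ 1 ∧ s ≠ 0 ∧ τ = s + t := by decide +kernel
  obtain ⟨s, t, hst, h4, h1, h0, hτ⟩ := key _ hy hy'
  obtain ⟨g, hg⟩ := exists_conj_diag h0 h1 (hτ.trans (by rw [eq_inv_of_mul_eq_one_right hst]))
  intro hgen
  refine not_generates_diag h0 h4 (x := g * x * g⁻¹) (by rwa [tr_conj]) ?_ (hg ▸ hgen.conj g)
  rwa [← hg, show g * x * g⁻¹ * (g * y * g⁻¹ * (g * y * g⁻¹)) = g * (x * (y * y)) * g⁻¹ by group,
    tr_conj]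

lemma tr_mul_self {K : Type*} [Field K] (y : SL(2, K)) : tr (y * y) = tr y ^ 2 - 2 := by
  have := det_eq y
  simp [tr]
  linear_combination -2 * this

/-- The classes other than the nonsplit ones, involutions and unipotents have purely imaginary trace
and map to order 4. There the squares y i ² have trace 0, and a common partner X fails to generate
with any y i. -/
lemma not_hasUDS_three : ¬ HasUDS K9 3 := by
  rintro ⟨s, hs, y, hy, hd⟩
  by_cases hns : Nonsplit (tr s)
  · exact not_dominates_of_nonsplit hns hy hd
  have key : ∀ τ : K9, ¬ (τ.1 ≠ 0 ∧ τ.2 ≠ 0) → τ = 0 ∨ (τ = 1 ∨ τ = -1) ∨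
      τ.1 = 0 ∧ τ.2 ≠ 0 ∧ τ ^ 2 - 2 = 0 := by decide +kernel
  rw [nonsplit_iff_im] at hns
  rcases key _ hns with h | h | ⟨h1, h2, h3⟩
  · have h0 := (hy 0).not_isScalar hs
    obtain ⟨i, hi⟩ := hd (y 0) h0
    exact not_generates_of_tr_eq_zero (by rw [card_K9]; norm_num) h0 ((hy 0).tr_eq.trans h)
      ((hy i).tr_eq.trans h) hi
  · exact not_dominates_of_unipotent hs h hy hd
  · obtain ⟨X, hX, hXY⟩ := exists_split_partner (Y := fun i ↦ y i * y i) fun i ↦ by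
      rw [tr_mul_self, (hy i).tr_eq, h3]
    have hXs : ¬ IsScalar X := fun h ↦ by
      rcases isScalar_iff_eq.1 h with rfl | rfl <;> revert hX <;> simp [tr] <;> decide +kernel
    obtain ⟨i, hi⟩ := hd X hXs
    refine not_generates_of_split hX ?_ ?_ (hXY i) hi <;> rwa [(hy i).tr_eq]

end SL2

/-! ### Four elements of order five dominate for q = 9. -/

namespace SL2

open Matrix Matrix.SpecialLinearGroup OnePoint

section order_eight

variable {F : Type*} [Field F] [Fintype F] [DecidableEq F] {Γ : Subgroup SL(2, F)}

/-- A transitive subgroup with few eigenvalues at `∞` contains no elements with eigenvalues of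
order `8`. -/
lemma not_mem_of_card_range_le (h1 : numOrbits Γ = 1) (hr : Nat.card (eigenvalueHom Γ).range ≤ 4)
    {w : SL(2, F)} (hw : ∀ e e' : F, e * e' = 1 → e + e' = tr w → e ^ 4 = -1)
    (h2 : (2 : F) ≠ 0) (hns : ¬ Nonsplit (tr w)) : w ∉ Γ := fun hwΓ ↦ by
  have : Subsingleton (MulAction.orbitRel.Quotient Γ (OnePoint F)) :=
    Finite.card_le_one_iff_subsingleton.1 h1.le
  have := (MulAction.pretransitive_iff_subsingleton_quotient Γ (OnePoint F)).2 this
  obtain ⟨p, hp⟩ := exists_smul_eq_of_not_nonsplit hns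
  obtain ⟨γ, hγ⟩ := MulAction.exists_smul_eq Γ (∞ : OnePoint F) p
  have hγ : γ.1 • (∞ : OnePoint F) = p := hγ
  let v : Γ := γ⁻¹ * ⟨w, hwΓ⟩ * γ
  have hv : v.1 = γ.1⁻¹ * w * γ.1 := rfl
  have hv0 : v.1 1 0 = 0 := by
    rw [← smul_infty_eq_self_iff, hv, mul_smul, mul_smul, hγ, hp, ← hγ, inv_smul_smul]
  have hvt : tr v.1 = tr w := by rw [hv]; simpa using tr_conj γ.1⁻¹ w
  have hdet := det_eq v.1
  rw [hv0, mul_zero, sub_zero] at hdet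
  have he := hw _ _ hdet hvt
  let u : MulAction.stabilizer Γ (∞ : OnePoint F) := ⟨v, mem_stabilizer_infty.2 hv0⟩
  have hu4 : eigenvalueHom Γ u ^ 4 = -1 := by ext; simpa using he
  have hneg : (-1 : Fˣ) ≠ 1 := fun h ↦ h2 (by
    have := congrArg Units.val h
    simp only [Units.val_neg, Units.val_one] at this
    linear_combination -this)
  have hord : orderOf (eigenvalueHom Γ u) = 2 ^ 3 := by
    refine orderOf_eq_prime_pow ?_ ?_
    · rw [show 2 ^ 2 = 4 by norm_num, hu4]; exact hneg
    · rw [show 2 ^ (2 + 1) = 4 * 2 by norm_num, pow_mul, hu4, neg_one_sq]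
  have h8 : orderOf (eigenvalueHom Γ u) ∣ Nat.card (eigenvalueHom Γ).range := by
    rw [← Subgroup.orderOf_mk (eigenvalueHom Γ u) (MonoidHom.mem_range.2 ⟨u, rfl⟩)]
    exact orderOf_dvd_natCard _
  have := Nat.le_of_dvd Nat.card_pos h8
  omega

end order_eight

/-- Together with -1, y generates the whole torus of order 10, so the alternatives for overgroups
apply. The element xy^k has eigenvalues of order 8. It is not in the normaliser, being split with
nonzero trace, and the exceptional transitive overgroup has at most 2(3 - 1) = 4 eigenvalues at ∞.
-/
lemma generates_of_tr_mul_pow {x y : SL(2, K9)} (hy : Nonsplit (tr y)) (hy5 : y ^ 5 = 1) {k : ℕ}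
    (h : (tr (x * y ^ k)).1 = 0) (h' : (tr (x * y ^ k)).2 ≠ 0) : Generates x y := by
  have h2 : (2 : K9) ≠ 0 := by decide +kernel
  have hodd : Odd (Fintype.card K9) := by rw [card_K9]; decide
  refine generates_iff.2 fun Γ hc hxΓ hyΓ ↦ ?_
  have hw : x * y ^ k ∈ Γ := Γ.mul_mem hxΓ (Γ.pow_mem hyΓ k)
  have hns : ¬ Nonsplit (tr (x * y ^ k)) := fun hn ↦ (nonsplit_iff_im.1 hn).1 h
  have hT : torus y ≤ Γ := by
    have hle : torus y ⊓ Γ ≤ torus y := inf_le_left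
    have hcard : Nat.card (torus y) = 10 := by rw [card_torus hy, Nat.card_eq_fintype_card, card_K9]
    have h5 : 5 ∣ Nat.card (torus y ⊓ Γ : Subgroup SL(2, K9)) := by
      have hmem : y ∈ torus y ⊓ Γ := ⟨self_mem_torus y, hyΓ⟩
      have hy1 : y ≠ 1 := fun h ↦ hy.not_isScalar (isScalar_iff_eq.2 (.inl h))
      rw [← orderOf_eq_prime hy5 hy1, ← Subgroup.orderOf_mk y hmem]
      exact orderOf_dvd_natCard _
    have h2 : 2 ∣ Nat.card (torus y ⊓ Γ : Subgroup SL(2, K9)) := by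
      have hz : (-1 : SL(2, K9)) ∈ Subgroup.center SL(2, K9) :=
        mem_center_iff_isScalar.2 (isScalar_iff_eq.2 (.inr rfl))
      have hmem : (-1 : SL(2, K9)) ∈ torus y ⊓ Γ := ⟨center_le_torus y hz, hc hz⟩
      have hne : (-1 : SL(2, K9)) ≠ 1 := fun h ↦ by
        have : (-1 : K9) = 1 := by simpa using congrArg (fun A : SL(2, K9) ↦ A 0 0) h
        exact h2 (by linear_combination -this)
      have := orderOf_dvd_natCard (⟨-1, hmem⟩ : (torus y ⊓ Γ : Subgroup SL(2, K9)))
      rwa [Subgroup.orderOf_mk, orderOf_eq_prime (p := 2) (by rw [neg_one_sq]) hne] at this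
    have h10 : 10 ∣ Nat.card (torus y ⊓ Γ : Subgroup SL(2, K9)) :=
      Nat.Coprime.mul_dvd_of_dvd_of_dvd (by norm_num) h2 h5
    have := Subgroup.eq_of_le_of_card_ge hle (hcard ▸ Nat.le_of_dvd Nat.card_pos h10)
    exact inf_eq_left.1 this
  rcases overgroup_alternatives hy hT (.inr (by rw [card_K9])) with hd | hd | ⟨-, h1, hu⟩
  · exfalso
    have hsc : ¬ IsScalar (x * y ^ k) := fun hs ↦ by
      rcases isScalar_iff_eq.1 hs with hs | hs <;> rw [hs] at h' <;> revert h' <;>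
        simp [tr] <;> decide +kernel
    rcases (mem_dihedral_iff_tr hy.not_isScalar).1 (hd hw) with hcomm | h0
    · exact hns (nonsplit_of_mem_torus hy (mem_torus.2 hcomm) hsc)
    · rw [h0.1] at h'; exact h' rfl
  · exact hd
  · refine absurd hw (not_mem_of_card_range_le h1 ?_ ?_ h2 hns)
    · have := card_range_le (Γ := Γ) (by omega)
      rwa [hu, numScalars_eq_two_of_odd hodd] at this
    · have key : ∀ e e' : K9, e * e' = 1 → (e + e').1 = 0 → (e + e').2 ≠ 0 →
          e ^ 2 * e ^ 2 = -1 := by decide +kernel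
      intro e e' he ht
      rw [← ht] at h h'
      rw [show e ^ 4 = e ^ 2 * e ^ 2 by ring, key e e' he h h']

/-- Codes of four elements of order `5`. -/
def fives : Fin 4 → ℕ :=
  ![matCode 0 2 1 4, matCode 0 3 3 4, matCode 3 6 8 1, matCode 3 1 5 1]

/-- The code of a power. -/
def powCode (n : ℕ) : ℕ → ℕ
  | 0 => 730
  | k + 1 => mulCode (powCode n k) n

lemma quad_one : quad (1 : SL(2, K9)) = mat 730 := by
  rw [show quad (1 : SL(2, K9)) = (1, 0, 0, 1) from rfl]
  decide +kernel

lemma quad_neg_one : quad (-1 : SL(2, K9)) = mat 1460 := by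
  rw [show quad (-1 : SL(2, K9)) = (-1, -0, -0, -1) from rfl]
  decide +kernel

lemma quad_pow {A : SL(2, K9)} {n : ℕ} (h : quad A = mat n) (k : ℕ) :
    quad (A ^ k) = mat (powCode n k) := by
  induction k with
  | zero => exact quad_one
  | succ k ih => rw [pow_succ, quad_mul, ih, h, powCode, mat_mulCode]

/-- Whether `n` is the code of a nonzero multiple of `i`. -/
def imaginaryCode (n : ℕ) : Bool := n % 3 == 0 && n / 3 % 3 != 0

/-- Pairs `(i, k)`, specifying the power `k` of the element `i` of order five. -/
def powerList : List (Fin 4 × ℕ) :=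
  [(0, 0), (0, 1), (1, 3), (3, 2), (2, 1), (2, 2), (3, 3), (0, 2), (1, 2), (0, 4), (1, 1), (2, 4),
    (3, 1)]

/-- Matrices with a ≠ 0 are enumerated by a, a' = a⁻¹, b and c, the last entry being a'(bc + 1). The
codes 730 and 1460 are those of 1 and -1. -/
lemma exists_imaginary_of_ne_zero : ∀ a ∈ List.range 9, ∀ a' ∈ List.range 9, dot a a' 0 0 = 1 →
    ∀ b ∈ List.range 9, ∀ c ∈ List.range 9,
      matCode a b c (dot a' (dot b c 1 1) 0 0) = 730 ∨
      matCode a b c (dot a' (dot b c 1 1) 0 0) = 1460 ∨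
      ∃ p ∈ powerList, imaginaryCode (trMul (matCode a b c (dot a' (dot b c 1 1) 0 0))
        (powCode (fives p.1) p.2)) := by
  decide +kernel

lemma exists_imaginary_of_eq_zero : ∀ b ∈ List.range 9, ∀ c ∈ List.range 9, dot b c 0 0 = 2 →
    ∀ d ∈ List.range 9, ∃ p ∈ powerList,
      imaginaryCode (trMul (matCode 0 b c d) (powCode (fives p.1) p.2)) := by
  decide +kernel

lemma imaginary_val_iff {n : ℕ} : imaginaryCode n ↔ (val n).1 = 0 ∧ (val n).2 ≠ 0 := by
  rw [Ne, val_re_eq_zero_iff, val_im_eq_zero_iff]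
  simp [imaginaryCode]

lemma exists_imaginary {x : SL(2, K9)} (hx : ¬ IsScalar x) : ∃ n, quad x = mat n ∧
    ∃ p ∈ powerList, imaginaryCode (trMul n (powCode (fives p.1) p.2)) := by
  have hr (z : K9) : code z ∈ List.range 9 := List.mem_range.2 (code_lt z)
  have hinj {m n : ℕ} (hm : m < 9) (hn : n < 9) (h : val m = val n) : m = n := by
    rw [← code_val hm, h, code_val hn]
  have hq : quad x = mat (matCode (code (x 0 0)) (code (x 0 1)) (code (x 1 0)) (code (x 1 1))) := by
    rw [mat_matCode (code_lt _) (code_lt _) (code_lt _) (code_lt _)]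
    simp only [val_code]
    rfl
  have hdet := det_eq x
  refine ⟨_, hq, ?_⟩
  by_cases h0 : x 0 0 = 0
  · rw [h0, zero_mul, zero_sub] at hdet
    rw [show code (x 0 0) = 0 by rw [h0]; rfl]
    refine exists_imaginary_of_eq_zero _ (hr _) _ (hr _)
      (hinj (dot_lt _ _ _ _) (by norm_num) ?_) _ (hr _)
    rw [val_dot, val_code, val_code, val_zero, mul_zero, add_zero, show val 2 = -1 by decide]
    linear_combination -hdet
  · have hd : code (x 1 1) = dot (code (x 0 0)⁻¹) (dot (code (x 0 1)) (code (x 1 0)) 1 1) 0 0 :=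
      hinj (code_lt _) (dot_lt _ _ _ _) (by
        simp only [val_dot, val_code, val_zero, val_one]
        field_simp
        linear_combination hdet)
    have key := exists_imaginary_of_ne_zero (code (x 0 0)) (hr _) (code (x 0 0)⁻¹) (hr _)
      (hinj (dot_lt _ _ _ _) (by norm_num) (by
        simp only [val_dot, val_code, val_zero, val_one]
        field_simp
        ring)) (code (x 0 1)) (hr _) (code (x 1 0)) (hr _)
    rw [← hd] at key
    rcases key with h | h | h
    · refine absurd (isScalar_iff_eq.2 (.inl (quad_injective ?_))) hx
      rw [hq, h]
      exact quad_one.symm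
    · refine absurd (isScalar_iff_eq.2 (.inr (quad_injective ?_))) hx
      rw [hq, h, quad_neg_one]
    · exact h

/-- The criterion is that every nonscalar x has a product with a power of one of the four elements
whose trace is a nonzero multiple of i; this is checked by enumeration. -/
lemma hasUDS_four : HasUDS K9 4 := by
  have hdet : ∀ i, detCode (fives i) = 1 := by decide +kernel
  have htr (i) : tr (ofCode (fives i) (hdet i)) = val 4 := by
    rw [tr_eq_val (quad_ofCode _ _)]
    congr 1
    revert i
    decide +kernel
  have hns (i) : Nonsplit (tr (ofCode (fives i) (hdet i))) := by
    rw [htr, nonsplit_val_iff]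
    decide
  refine ⟨_, (hns 0).not_isScalar, fun i ↦ ofCode (fives i) (hdet i),
    fun i ↦ exists_conj_of_tr_eq (hns _) ((htr _).trans (htr _).symm), fun x hx ↦ ?_⟩
  obtain ⟨n, hn, p, -, hp⟩ := exists_imaginary hx
  rw [imaginary_val_iff, ← tr_mul_eq_val hn (quad_pow (quad_ofCode _ (hdet p.1)) _)] at hp
  refine ⟨p.1, generates_of_tr_mul_pow (hns _) (quad_injective ?_) hp.1 hp.2⟩
  rw [quad_pow (quad_ofCode _ (hdet p.1)), show powCode (fives p.1) 5 = 730 by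
    generalize p.1 = i; revert i; decide +kernel, quad_one]

theorem uniformDominationNumber_of_card_eq_nine {F : Type*} [Field F] [Fintype F] [DecidableEq F]
    (hF : Fintype.card F = 9) : uniformDominationNumber PSL(2, F) = 4 := by
  have e := FiniteField.ringEquivOfCardEq (hF.trans card_K9.symm)
  refine uniformDominationNumber_eq ((hasUDS_iff_of_ringEquiv e).2 hasUDS_four) ?_
  rw [hasUDS_iff_of_ringEquiv e]
  exact not_hasUDS_three

end SL2

/-! ### Assembly of the cases. -/

theorem theorem5 {F : Type*} [Field F] [Finite F] (q : ℕ) (hqF : Nat.card F = q) (hq : 4 ≤ q) :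
    (11 ≤ q → q % 4 = 1 → spread PSL(2, F) = q - 1 ∧ uniformSpread PSL(2, F) = q - 1) ∧
    (11 ≤ q → Even q → spread PSL(2, F) = q - 2 ∧ uniformSpread PSL(2, F) = q - 2) ∧
    (11 ≤ q → q % 4 = 3 → q - 4 ≤ uniformSpread PSL(2, F) ∧ q - 3 ≤ spread PSL(2, F)) ∧
    (11 ≤ q → q % 4 = 3 → q.Prime →
      (3 * (q : ℝ) - 7) / 2 ≤ (spread PSL(2, F) : ℝ) ∧
      (spread PSL(2, F) : ℝ) - (uniformSpread PSL(2, F) : ℝ) = ((q : ℝ) + 1) / 2) ∧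
    (q = 9 → uniformDominationNumber PSL(2, F) = 4) ∧
    (q = 5 ∨ q = 7 ∨ Even q → uniformDominationNumber PSL(2, F) = 3) ∧
    (11 ≤ q → Odd q → uniformDominationNumber PSL(2, F) = 2) ∧
    (11 ≤ q → q % 4 = 1 → maxUdsProb PSL(2, F) 2 = 1 / 2 * (1 + 1 / (q : ℝ))) ∧
    (11 ≤ q → q % 4 = 3 →
      maxUdsProb PSL(2, F) 2 = 1 / 2 * (1 - ((q : ℝ) + 3) / ((q : ℝ) * ((q : ℝ) - 1)))) ∧
    (11 ≤ q → Odd q →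
      24 / 55 ≤ maxUdsProb PSL(2, F) 2 ∧ (maxUdsProb PSL(2, F) 2 = 24 / 55 ↔ q = 11)) := by
  classical
  have := Fintype.ofFinite F
  obtain rfl : Fintype.card F = q := by rw [← hqF, Nat.card_eq_fintype_card]
  refine ⟨fun h h1 ↦ SL2.spread_of_one_mod_four h1 h, fun h h1 ↦ SL2.spread_of_even h1 hq,
    fun h h1 ↦ ⟨SL2.le_uniformSpread_of_three_mod_four h1 h, SL2.le_spread_of_three_mod_four h1 h⟩,
    fun h h1 hp ↦ ?_, fun h ↦ ?_, ?_, fun h h1 ↦ SL2.uniformDominationNumber_of_odd h1 h,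
    fun h h1 ↦ SL2.maxUdsProb_of_one_mod_four h1 h, fun h h1 ↦ SL2.maxUdsProb_of_three_mod_four h1 h,
    fun h h1 ↦ SL2.maxUdsProb_ge h1 h⟩
  · have h2 := SL2.spread_of_prime h1 h hp
    have h3 := SL2.le_spread_of_prime h1 h hp
    -- As q is odd, (q + 1)/2 is exact, and twice q - 4 + (q + 1)/2 is 3q - 7.
    have h4 : 3 * Fintype.card F ≤ 2 * spread PSL(2, F) + 7 := by omega
    have h5 : 2 * spread PSL(2, F) = 2 * uniformSpread PSL(2, F) + (Fintype.card F + 1) := by omega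
    have h4' : 3 * (Fintype.card F : ℝ) ≤ 2 * (spread PSL(2, F) : ℝ) + 7 := by exact_mod_cast h4
    have h5' : 2 * (spread PSL(2, F) : ℝ) =
        2 * (uniformSpread PSL(2, F) : ℝ) + ((Fintype.card F : ℝ) + 1) := by exact_mod_cast h5
    exact ⟨by linarith, by linarith⟩
  · exact SL2.uniformDominationNumber_of_card_eq_nine h
  · rintro (h | h | h)
    · exact SL2.uniformDominationNumber_of_card_eq_five h
    · exact SL2.uniformDominationNumber_of_card_eq_seven h
    · exact SL2.uniformDominationNumber_of_even h hq
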